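/- Let $K$ be a field, $S=K[x_1,\dots,x_n]$ with $\deg x_i=1$, and let $I\subset S$ be a graded ideal with $0\ne I\neq S$. A Hilbert decomposition of a graded ideal is an isomorphism of graded $K$-vector spaces from the ideal to a finite direct sum $\bigoplus_k K[Z_k](-s_k)$ with $s_k\ge 0$ and $Z_k$ a set of variables of the ambient polynomial ring; $\mathrm{hdepth}$ of the ideal is the maximum, over all its Hilbert decompositions, of $\min_k|Z_k|$. For a monomial $u=x_{i_1}\cdots x_{i_e}$ with $i_1\le\dots\le i_e$, $e\geq 1$, put $\mathrm m(u)=i_e$ and $u^\sigma=x_{i_1}x_{i_2+1}\cdots x_{i_e+e-1}$. Lex means lexicographic with $x_1>\dots>x_n$; a lex ideal is a monomial ideal whose monomials of each degree form an initial segment in this order. (0) The initial ideal $\mathrm{in}_{\mathrm{lex}}(I)$ has the same Hilbert function as $I$, and there is exactly one lex ideal $L\subset S$ with this Hilbert function. Let $u_1,\dots,u_s$ be the minimal monomial generators of $L$, $m=\max_i\{\mathrm m(u_i)+\deg u_i-1\}$, and $L^\sigma=(u_1^\sigma,\dots,u_s^\sigma)\subset S'=K[x_1,\dots,x_m]$.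 Then the maxima defining $\mathrm{hdepth}(I)$, $\mathrm{hdepth}(L)$, $\mathrm{hdepth}(L^\sigma)$ exist, and the following two algorithms terminate and are correct. (1) Let $d$ be the least degree of a minimal monomial generator of $L^\sigma$, let $a_i$ be the number of squarefree monomials of degree $i$ in $L^\sigma$, and $j_0=\min\{\lfloor a_{d+1}/a_d\rfloor,\,m-d\}$. For $j=j_0,j_0-1,\dots,0$ put $p=d+j$, start with $g=a_dt^d+\dots+a_pt^p$ and, successively for $i=d,\dots,p$, let $b_i$ be the coefficient of $t^i$ in the current polynomial and subtract $b_it^i(1+t)^{p-i}$ from it. For some $j$ all of $b_d,\dots,b_p$ are non-negative, and for the first such $j$ in this order $\mathrm{hdepth}(L^\sigma)=d+j$. Moreover $$\mathrm{hdepth}(I)=\mathrm{hdepth}(L)=\mathrm{hdepth}(L^\sigma)-(m-n).$$ (2) The Hilbert series of $I$ is $H_I(t)=Q(t)/(1-t)^n$ with $Q\in\mathbb Z[t]$ and $\deg Q\le m$. Let $t^d$ be the lowest power of $t$ occurring in $Q$. For $q=0,1,2,\dots$ start with $Q$ and, successively for $i=d,\dots,m$, let $b_i$ be the coefficient of $t^i$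 in the current polynomial and subtract $b_it^i(1-t)^{\min\{q,\,m-i\}}$ from it. There is $q$ with $0\le q\le m-d$ for which all of $b_d,\dots,b_m$ are non-negative, and for the least such $q$ one has $\mathrm{hdepth}(I)=n-q$. -/

import Mathlib

open MvPolynomial

noncomputable section

namespace HilbertDepth

/-! ### Graded ideals, Hilbert function and Hilbert series

`K[x₁, …, xₙ]` is `MvPolynomial (Fin n) K` with its standard grading `deg xᵢ = 1`; the variable
`xᵢ` is `X (i - 1)`. -/

/-- `I` is a graded (homogeneous) ideal for the standard grading. -/
def IsGradedIdeal {K : Type*} [Field K] {n : ℕ} (I : Ideal (MvPolynomial (Fin n) K)) : Prop :=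
  letI : GradedAlgebra (homogeneousSubmodule (Fin n) K) := MvPolynomial.gradedAlgebra
  Ideal.IsHomogeneous (homogeneousSubmodule (Fin n) K) I

/-- The Hilbert function `i ↦ dim_K I_i`. -/
def hilbertFunction {K : Type*} [Field K] {n : ℕ} (I : Ideal (MvPolynomial (Fin n) K))
    (i : ℕ) : ℕ :=
  Module.finrank K ↥(I.restrictScalars K ⊓ homogeneousSubmodule (Fin n) K i)

/-- The Hilbert series `H_I(t) = ∑ (dim_K I_i) tⁱ`. -/
def hilbertSeries {K : Type*} [Field K] {n : ℕ} (I : Ideal (MvPolynomial (Fin n) K)) :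
    PowerSeries ℤ :=
  PowerSeries.mk fun i => (hilbertFunction I i : ℤ)

/-! ### Hilbert decompositions and Hilbert depth -/

/-- The degree `j` part of `K[Z](-s)`, that is, the degree `j - s` part of `K[Z]`
(zero if `j < s`). -/
def shiftedPart (K : Type*) [Field K] {n : ℕ} (Z : Finset (Fin n)) (s j : ℕ) :
    Submodule K (MvPolynomial Z K) :=
  if s ≤ j then homogeneousSubmodule Z K (j - s) else ⊥

/-- A Hilbert decomposition of `I`: an isomorphism `I ≅ ⨁ K[Z_k](-s_k)` of graded `K`-vector
spaces, with finitely many summands, where `Z_k` is a set of variables and `s_k ≥ 0`. -/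
structure HilbertDecomposition {K : Type*} [Field K] {n : ℕ}
    (I : Ideal (MvPolynomial (Fin n) K)) where
  r : ℕ
  s : Fin r → ℕ
  Z : Fin r → Finset (Fin n)
  iso : ↥(I.restrictScalars K) ≃ₗ[K] (∀ k : Fin r, MvPolynomial (Z k) K)
  graded : ∀ (j : ℕ) (f : ↥(I.restrictScalars K)),
    (f : MvPolynomial (Fin n) K) ∈ homogeneousSubmodule (Fin n) K j ↔
      ∀ k, iso f k ∈ shiftedPart K (Z k) (s k) j

/-- The Hilbert depth of a decomposition: `min_k |Z_k|`. -/
def HilbertDecomposition.depth {K : Type*} [Field K] {n : ℕ}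
    {I : Ideal (MvPolynomial (Fin n) K)} (D : HilbertDecomposition I) : ℕ :=
  ⨅ k, (D.Z k).card

/-- The set of the Hilbert depths of all Hilbert decompositions of `I`. -/
def hdepthSet {K : Type*} [Field K] {n : ℕ} (I : Ideal (MvPolynomial (Fin n) K)) : Set ℕ :=
  Set.range fun D : HilbertDecomposition I => D.depth

/-- `hdepth(I)`, the largest Hilbert depth of a Hilbert decomposition of `I`. -/
def hdepth {K : Type*} [Field K] {n : ℕ} (I : Ideal (MvPolynomial (Fin n) K)) : ℕ :=
  sSup (hdepthSet I)

/-! ### Monomial ideals, lex ideals, initial ideals -/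

/-- `I` is generated by monomials. -/
def IsMonomialIdeal {K : Type*} [Field K] {n : ℕ} (I : Ideal (MvPolynomial (Fin n) K)) : Prop :=
  ∃ A : Set (Fin n →₀ ℕ), I = Ideal.span ((fun u => monomial u (1 : K)) '' A)

/-- Lex ideals: monomial ideals such that, in each degree, the monomials in the ideal form an
initial segment for the lexicographic order with `x₁ > x₂ > ⋯ > xₙ`. -/
def IsLexIdeal {K : Type*} [Field K] {n : ℕ} (I : Ideal (MvPolynomial (Fin n) K)) : Prop :=
  IsMonomialIdeal I ∧
    ∀ u v : Fin n →₀ ℕ, monomial u (1 : K) ∈ I → v.degree = u.degree → toLex u < toLex v →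
      monomial v (1 : K) ∈ I

/-- The initial ideal with respect to the lexicographic order with `x₁ > x₂ > ⋯ > xₙ`. -/
def lexInitialIdeal {K : Type*} [Field K] {n : ℕ} (I : Ideal (MvPolynomial (Fin n) K)) :
    Ideal (MvPolynomial (Fin n) K) :=
  Ideal.span {p | ∃ f ∈ I, f ≠ 0 ∧ p = monomial (MonomialOrder.lex.degree f) (1 : K)}

/-- The exponents of the minimal monomial generators of a monomial ideal: the monomials in the
ideal that are minimal for divisibility. -/
def minGens {K : Type*} [Field K] {n : ℕ} (I : Ideal (MvPolynomial (Fin n) K)) :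
    Set (Fin n →₀ ℕ) :=
  {u | monomial u (1 : K) ∈ I ∧ ∀ v, v ≤ u → monomial v (1 : K) ∈ I → v = u}

/-- The smallest degree of a minimal monomial generator. -/
def minGenDegree {K : Type*} [Field K] {n : ℕ} (I : Ideal (MvPolynomial (Fin n) K)) : ℕ :=
  sInf (Finsupp.degree '' minGens I)

/-! ### Kalai's squarefree operator -/

/-- `m(u)`, the largest index (counted from `1`) of a variable that divides the monomial `u`. -/
def maxIndex {n : ℕ} (u : Fin n →₀ ℕ) : ℕ :=
  u.support.sup fun i => (i : ℕ) + 1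

/-- For `u = x_{i₁} ⋯ x_{i_d}` with `i₁ ≤ ⋯ ≤ i_d`, the list `i₁, i₂ + 1, …, i_d + d - 1`
(with variables indexed from `0`). -/
def sigmaIndices {n : ℕ} (u : Fin n →₀ ℕ) : List ℕ :=
  ((List.finRange n).flatMap fun i => List.replicate (u i) (i : ℕ)).mapIdx fun k i => i + k

/-- The exponent of the monomial `u^σ` in the variables `x₁, …, x_m`. -/
def sigmaExponent {n : ℕ} (m : ℕ) (u : Fin n →₀ ℕ) : Fin m →₀ ℕ :=
  Finsupp.equivFunOnFinite.symm fun j => (sigmaIndices u).count (j : ℕ)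

/-- `m = max {m(u) + deg(u) - 1}` over the minimal monomial generators `u`. -/
def sigmaVars {K : Type*} [Field K] {n : ℕ} (I : Ideal (MvPolynomial (Fin n) K)) : ℕ :=
  sSup ((fun u => maxIndex u + u.degree - 1) '' minGens I)

/-- The ideal `I^σ` of `K[x₁, …, x_m]` generated by the `u^σ`, for `u` a minimal monomial
generator of the monomial ideal `I`. -/
def sigmaIdeal {K : Type*} [Field K] {n : ℕ} (I : Ideal (MvPolynomial (Fin n) K)) :
    Ideal (MvPolynomial (Fin (sigmaVars I)) K) :=
  Ideal.span ((fun u => monomial (sigmaExponent (sigmaVars I) u) (1 : K)) '' minGens I)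

/-! ### The successive subtraction procedure -/

/-- Starting from `h`, step `k + 1` takes the coefficient `b` of `t^(d+k)` in the current
polynomial and subtracts `b` times the polynomial `e (d + k)`.  This is the polynomial after `k`
steps. -/
def remainder (e : ℕ → Polynomial ℤ) (d : ℕ) (h : Polynomial ℤ) : ℕ → Polynomial ℤ
  | 0 => h
  | k + 1 => remainder e d h k -
      Polynomial.C ((remainder e d h k).coeff (d + k)) * e (d + k)

/-- The number `b_i` (`i ≥ d`) produced by the procedure. -/
def procCoeff (e : ℕ → Polynomial ℤ) (d : ℕ) (h : Polynomial ℤ) (i : ℕ) : ℤ :=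
  (remainder e d h (i - d)).coeff i

/-! ### The algorithm for squarefree monomial ideals -/

/-- The number of squarefree monomials of degree `i` in the ideal. -/
def squarefreeCount {K : Type*} [Field K] {n : ℕ} (J : Ideal (MvPolynomial (Fin n) K))
    (i : ℕ) : ℕ :=
  Set.ncard {u : Fin n →₀ ℕ | (∀ j, u j ≤ 1) ∧ u.degree = i ∧ monomial u (1 : K) ∈ J}

/-- For `d` the least degree of a generator, `a_i` the number of squarefree monomials of degree
`i` in `J` and `p = d + j`: subtracting successively from `g = a_d t^d + ⋯ + a_p t^p` the
polynomials `b_i tⁱ (1 + t)^(p - i)`, `i = d, …, p`, gives only numbers `b_i ≥ 0`. -/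
def SquarefreeTest {K : Type*} [Field K] {n : ℕ} (J : Ideal (MvPolynomial (Fin n) K))
    (j : ℕ) : Prop :=
  let d := minGenDegree J
  let g : Polynomial ℤ :=
    ∑ i ∈ Finset.Icc d (d + j), Polynomial.monomial i (squarefreeCount J i : ℤ)
  ∀ i ∈ Finset.Icc d (d + j),
    0 ≤ procCoeff (fun i => Polynomial.X ^ i * (1 + Polynomial.X) ^ (d + j - i)) d g i

/-- The algorithm that runs the test for `j = j₀, j₀ - 1, j₀ - 2, …`, where
`j₀ = min {⌊a_{d+1} / a_d⌋, n - d}`, and at the first success returns `d + j`, stops and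
returns `p`. -/
def SquarefreeAlgorithmReturns {K : Type*} [Field K] {n : ℕ}
    (J : Ideal (MvPolynomial (Fin n) K)) (p : ℕ) : Prop :=
  let d := minGenDegree J
  let j₀ := min (squarefreeCount J (d + 1) / squarefreeCount J d) (n - d)
  ∃ j ≤ j₀, SquarefreeTest J j ∧ (∀ j', j < j' → j' ≤ j₀ → ¬ SquarefreeTest J j') ∧ p = d + j

/-! ### The algorithm that works with the numerator of the Hilbert series -/

/-- Subtracting successively from `Q` the polynomials `b_i tⁱ (1 - t)^(min {q, m - i})`,
`i = d, …, m`, where `t^d` is the lowest power of `t` that occurs in `Q`, gives only numbers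
`b_i ≥ 0`. -/
def NumeratorTest (m : ℕ) (Q : Polynomial ℤ) (q : ℕ) : Prop :=
  ∀ i ∈ Finset.Icc Q.natTrailingDegree m,
    0 ≤ procCoeff (fun i => Polynomial.X ^ i * (1 - Polynomial.X) ^ min q (m - i))
      Q.natTrailingDegree Q i

/-- The algorithm that runs the test for `q = 0, 1, 2, …` and at the first success returns
`n - q` stops, within the range `0 ≤ q ≤ m - d`, and returns `p`. -/
def NumeratorAlgorithmReturns (n m : ℕ) (Q : Polynomial ℤ) (p : ℤ) : Prop :=
  ∃ q : ℕ, Q.natTrailingDegree + q ≤ m ∧ NumeratorTest m Q q ∧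
    (∀ q' < q, ¬ NumeratorTest m Q q') ∧ p = (n : ℤ) - (q : ℤ)

end HilbertDepth

end

noncomputable section

namespace HilbertDepth

/-! ### Expansions in a triangular family of polynomials -/

/-! Graded vector spaces with finite-dimensional pieces are isomorphic exactly when their Hilbert
series agree. So a Hilbert decomposition of `I` is a way of writing its series as a finite sum of
terms `t^s/(1-t)^z` with `z ≤ n`. Multiplying by `(1-t)^n`, a decomposition with all `|Z_k| ≥ n - q`
(`q ≤ n`) exists if and only if the numerator `Q` is a sum of polynomials `t^s(1-t)^e` with `e ≤ q`,
that is, `Q ∈ cone q`. Hence the Hilbert depth is `n - q` for the least such `q`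
(`isGreatest_hdepthSet`), and it depends on `Q` and `n` only.

The ideals `I` and `L` have the same `Q`. So has `L^σ`, with `m` in place of `n`. Write monomials as
sorted words. In a lex ideal every monomial has exactly one minimal generator as a prefix of its
word (`IsLexIdeal.exists_prefix`, `eq_of_prefix`), so `Q` is the sum of the `t^(deg
u)(1-t)^(m(u)-1)`. Every squarefree monomial of `L^σ` likewise has exactly one `u^σ` as a prefix, so
the generating function of the `a_i` is the sum of the `t^(deg u)(1+t)^(m-(m(u)+deg u-1))`. The
substitution `P ↦ (1-t)^m P(t/(1-t))` (`bernstein`) sends the second sum to the first, whence `Q = ∑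
a_i t^i(1-t)^(m-i)` (`IsLexIdeal.numerator_eq`); this is also the numerator for `L^σ`, a squarefree
ideal.

Both algorithms decide whether `Q ∈ cone q`, with `p = d + j = m - q`. Under the same substitution,
`b_i t^i(1+t)^(p-i)` becomes `b_i t^i(1-t)^q`, so `Q = ∑_{i≤p} b_i t^i(1-t)^q + ∑_{i>p} a_i
t^i(1-t)^(m-i)`. If the `b_i` are non-negative this shows `Q ∈ cone q`. Conversely the `b_i` are the
first coefficients of `Q/(1-t)^q`, and these are non-negative for every element of the cone
(`numeratorTest_iff_mem_cone`).

The existence of `L` is Macaulay's theorem, proved by compression and induction on the number of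
variables (`macaulayBound`). Passing to leading monomials reduces graded ideals to monomial ones
(`exists_gradedBasis`). -/

/-- The `i`-th polynomial has lowest term `tⁱ` with coefficient one. -/
def IsTriangular (e : ℕ → Polynomial ℤ) : Prop :=
  ∀ i j, j ≤ i → (e i).coeff j = if j = i then 1 else 0

lemma isTriangular_of_eq {e : ℕ → Polynomial ℤ} (f : ℕ → Polynomial ℤ)
    (hf : ∀ i, (f i).coeff 0 = 1) (he : ∀ i, e i = Polynomial.X ^ i * f i) : IsTriangular e := by
  intro i j hj
  rw [he, Polynomial.coeff_X_pow_mul']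
  rcases hj.eq_or_lt with rfl | hlt
  · simp [hf]
  · simp [hlt.not_ge, hlt.ne]

lemma isTriangular_one_sub (r : ℕ → ℕ) :
    IsTriangular fun i => Polynomial.X ^ i * (1 - Polynomial.X) ^ r i :=
  isTriangular_of_eq (fun i => (1 - Polynomial.X) ^ r i)
    (fun i => by simp [Polynomial.coeff_zero_eq_eval_zero]) fun _ => rfl

lemma isTriangular_one_add (r : ℕ → ℕ) :
    IsTriangular fun i => Polynomial.X ^ i * (1 + Polynomial.X) ^ r i :=
  isTriangular_of_eq (fun i => (1 + Polynomial.X) ^ r i)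
    (fun i => by simp [Polynomial.coeff_zero_eq_eval_zero]) fun _ => rfl

lemma IsTriangular.coeff_sum {e : ℕ → Polynomial ℤ} (he : IsTriangular e) (c : ℕ → ℤ) (d M : ℕ)
    {j : ℕ} (hj : j ≤ d) :
    (∑ i ∈ Finset.Icc d M, Polynomial.C (c i) * e i).coeff j =
      if j = d ∧ d ≤ M then c d else 0 := by
  rw [Polynomial.finsetSum_coeff]
  have h : ∀ i ∈ Finset.Icc d M, (Polynomial.C (c i) * e i).coeff j =
      if i = d then (if j = d then c d else 0) else 0 := by
    intro i hi
    rw [Finset.mem_Icc] at hi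
    rw [Polynomial.coeff_C_mul, he i j (hj.trans hi.1)]
    by_cases h1 : i = d
    · subst h1; simp
    · have : j ≠ i := by omega
      simp [h1, this]
  rw [Finset.sum_congr rfl h, Finset.sum_ite_eq']
  simp only [Finset.mem_Icc, le_refl, true_and]
  by_cases h1 : d ≤ M <;> simp [h1]

lemma Ioc_eq_Icc_succ (a b : ℕ) : Finset.Ioc a b = Finset.Icc (a + 1) b := by
  ext; simp

/-- In a triangular family the lowest coefficient of what remains is the coordinate of its first
summand, so each step removes exactly that summand. -/
lemma remainder_eq_of_expansion {e : ℕ → Polynomial ℤ} (he : IsTriangular e) {d M : ℕ}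
    {h : Polynomial ℤ} {c : ℕ → ℤ}
    (hh : h = ∑ i ∈ Finset.Icc d M, Polynomial.C (c i) * e i) :
    ∀ k, d + k ≤ M + 1 →
      remainder e d h k = ∑ i ∈ Finset.Icc (d + k) M, Polynomial.C (c i) * e i := by
  intro k
  induction k with
  | zero => intro _; simpa [remainder] using hh
  | succ k ih =>
    intro hk
    rw [remainder, ih (by omega), he.coeff_sum c (d + k) M le_rfl]
    have hle : d + k ≤ M := by omega
    rw [if_pos ⟨rfl, hle⟩, ← Finset.Ioc_insert_left hle, Finset.sum_insert (by simp)]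
    rw [add_sub_cancel_left]
    exact Finset.sum_congr (Ioc_eq_Icc_succ _ _) fun _ _ => rfl

/-- The procedure reads off coordinates. Exhibiting any expansion therefore determines its whole
output, and this is how the two algorithms are compared. -/
lemma procCoeff_eq_of_expansion {e : ℕ → Polynomial ℤ} (he : IsTriangular e) {d M : ℕ}
    {h : Polynomial ℤ} {c : ℕ → ℤ}
    (hh : h = ∑ i ∈ Finset.Icc d M, Polynomial.C (c i) * e i) {i : ℕ}
    (hi : i ∈ Finset.Icc d M) : procCoeff e d h i = c i := by
  rw [Finset.mem_Icc] at hi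
  rw [procCoeff, remainder_eq_of_expansion he hh (i - d) (by omega)]
  have : d + (i - d) = i := by omega
  rw [this, he.coeff_sum c i M le_rfl, if_pos ⟨rfl, hi.2⟩]

/-- Subtracting the lowest term raises the order by one without exceeding degree `M`. The induction
runs over the number `k` of degrees still available. -/
lemma exists_expansion {e : ℕ → Polynomial ℤ} (he : IsTriangular e) {M : ℕ}
    (hdeg : ∀ i ≤ M, (e i).natDegree ≤ M) :
    ∀ (k d : ℕ), d + k = M + 1 → ∀ h : Polynomial ℤ, h.natDegree ≤ M →
      (∀ j < d, h.coeff j = 0) →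
      ∃ c : ℕ → ℤ, h = ∑ i ∈ Finset.Icc d M, Polynomial.C (c i) * e i := by
  intro k
  induction k with
  | zero =>
    intro d hd h hM hlow
    refine ⟨0, ?_⟩
    rw [Finset.Icc_eq_empty (by omega), Finset.sum_empty]
    ext j
    by_cases hj : j < d
    · simp [hlow j hj]
    · rw [Polynomial.coeff_eq_zero_of_natDegree_lt (by omega)]; simp
  | succ k ih =>
    intro d hd h hM hlow
    obtain ⟨c, hc⟩ := ih (d + 1) (by omega) (h - Polynomial.C (h.coeff d) * e d)
      ((Polynomial.natDegree_sub_le _ _).trans (max_le hM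
        ((Polynomial.natDegree_C_mul_le _ _).trans (hdeg d (by omega))))) (by
        intro j hj
        rw [Polynomial.coeff_sub, Polynomial.coeff_C_mul, he d j (by omega)]
        by_cases h1 : j = d
        · subst h1; simp
        · simp [h1, hlow j (by omega)])
    refine ⟨Function.update c d (h.coeff d), ?_⟩
    have hle : d ≤ M := by omega
    rw [← Finset.Ioc_insert_left hle, Finset.sum_insert (by simp), Function.update_self]
    have : ∑ x ∈ Finset.Ioc d M, Polynomial.C (Function.update c d (h.coeff d) x) * e x =
        ∑ i ∈ Finset.Icc (d + 1) M, Polynomial.C (c i) * e i := by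
      refine Finset.sum_congr (Ioc_eq_Icc_succ _ _) fun x hx => ?_
      rw [Finset.mem_Icc] at hx
      rw [Function.update_of_ne (by omega)]
    rw [this, ← hc]
    ring

/-! ### The cone generated by the `tˢ (1 - t)ᵉ` -/

/-- The sums of polynomials `tˢ (1 - t)ᵉ` with `e ≤ q`. -/
def cone (q : ℕ) : AddSubmonoid (Polynomial ℤ) :=
  AddSubmonoid.closure
    {p | ∃ s e : ℕ, e ≤ q ∧ p = Polynomial.X ^ s * (1 - Polynomial.X) ^ e}

lemma mem_cone_of_le {q : ℕ} (s : ℕ) {e : ℕ} (he : e ≤ q) :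
    (Polynomial.X ^ s * (1 - Polynomial.X) ^ e : Polynomial ℤ) ∈ cone q :=
  AddSubmonoid.subset_closure ⟨s, e, he, rfl⟩

lemma C_mul_mem_cone {q : ℕ} {p : Polynomial ℤ} (hp : p ∈ cone q) {c : ℤ} (hc : 0 ≤ c) :
    Polynomial.C c * p ∈ cone q := by
  lift c to ℕ using hc
  have : Polynomial.C (c : ℤ) * p = c • p := by simp
  rw [this]
  exact AddSubmonoid.nsmul_mem _ hp c

lemma coe_finsetSum {ι : Type*} (s : Finset ι) (f : ι → Polynomial ℤ) :
    ((∑ i ∈ s, f i : Polynomial ℤ) : PowerSeries ℤ) = ∑ i ∈ s, (f i : PowerSeries ℤ) :=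
  map_sum (Polynomial.coeToPowerSeries.ringHom (R := ℤ)) f s

/-- The geometric series `1 + t + t² + ⋯`. -/
abbrev geom : PowerSeries ℤ := PowerSeries.mk 1

lemma geom_mul : geom * (1 - PowerSeries.X) = 1 := PowerSeries.mk_one_mul_one_sub_eq_one ℤ

lemma geom_pow_mul (k : ℕ) : geom ^ k * (1 - PowerSeries.X) ^ k = 1 := by
  rw [← mul_pow, geom_mul, one_pow]

lemma coeff_geom_pow_nonneg (k j : ℕ) : 0 ≤ PowerSeries.coeff j (geom ^ k) := by
  induction k generalizing j with
  | zero => rw [pow_zero, PowerSeries.coeff_one]; split_ifs <;> norm_num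
  | succ k ih =>
    rw [pow_succ, PowerSeries.coeff_mul]
    exact Finset.sum_nonneg fun x _ => mul_nonneg (ih _) (by simp)

/-- Dividing a generator `t^s(1-t)^e` by `(1-t)^q` leaves `t^s/(1-t)^(q-e)`. This is the obstruction
to membership used in `numeratorTest_iff_mem_cone`. -/
lemma coeff_nonneg_of_mem_cone {q : ℕ} {Q : Polynomial ℤ} (hQ : Q ∈ cone q) (j : ℕ) :
    0 ≤ PowerSeries.coeff j ((Q : PowerSeries ℤ) * geom ^ q) := by
  induction hQ using AddSubmonoid.closure_induction with
  | mem p hp =>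
    obtain ⟨s, e, he, rfl⟩ := hp
    obtain ⟨r, rfl⟩ := Nat.exists_eq_add_of_le he
    have : ((Polynomial.X ^ s * (1 - Polynomial.X) ^ e : Polynomial ℤ) : PowerSeries ℤ) *
        geom ^ (e + r) = PowerSeries.X ^ s * geom ^ r := by
      push_cast
      rw [pow_add]
      calc _ = PowerSeries.X ^ s * geom ^ r * (geom ^ e * (1 - PowerSeries.X) ^ e) := by ring
        _ = _ := by rw [geom_pow_mul, mul_one]
    rw [this, PowerSeries.coeff_X_pow_mul']
    split_ifs
    · exact coeff_geom_pow_nonneg _ _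
    · exact le_rfl
  | zero => simp
  | add x y _ _ hx hy =>
    push_cast
    rw [add_mul, map_add]
    exact add_nonneg hx hy

/-! ### Homogenization -/

/-- The polynomial `∑ Pₖ tᵏ (1 - t)^(N - k)`, for `P = ∑ Pₖ tᵏ`. -/
def bernstein (N : ℕ) (P : Polynomial ℤ) : Polynomial ℤ :=
  ∑ k ∈ Finset.range (N + 1),
    Polynomial.C (P.coeff k) * (Polynomial.X ^ k * (1 - Polynomial.X) ^ (N - k))

lemma bernstein_add (N : ℕ) (P R : Polynomial ℤ) :
    bernstein N (P + R) = bernstein N P + bernstein N R := by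
  simp [bernstein, add_mul, Finset.sum_add_distrib]

lemma bernstein_C_mul (N : ℕ) (c : ℤ) (P : Polynomial ℤ) :
    bernstein N (Polynomial.C c * P) = Polynomial.C c * bernstein N P := by
  simp [bernstein, Finset.mul_sum, mul_assoc]

lemma bernstein_sum {ι : Type*} (N : ℕ) (s : Finset ι) (P : ι → Polynomial ℤ) :
    bernstein N (∑ i ∈ s, P i) = ∑ i ∈ s, bernstein N (P i) := by
  classical
  induction s using Finset.induction_on with
  | empty => simp [bernstein]
  | insert a s ha ih => rw [Finset.sum_insert ha, Finset.sum_insert ha, bernstein_add, ih]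

lemma bernstein_X_pow {N i : ℕ} (hi : i ≤ N) :
    bernstein N (Polynomial.X ^ i) = Polynomial.X ^ i * (1 - Polynomial.X) ^ (N - i) := by
  rw [bernstein, Finset.sum_eq_single i]
  · simp
  · intro b _ hb
    simp [Polynomial.coeff_X_pow, hb]
  · intro h
    exact absurd (Finset.mem_range.2 (by omega)) h

/-- Homogenize with `t ↦ t` and `1 ↦ 1 - t`: the factor `1 + t` becomes `1`, so each of the `c`
factors only uses up one unit of the degree `N`. -/
lemma bernstein_X_pow_mul {N : ℕ} (c : ℕ) : ∀ i, i + c ≤ N →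
    bernstein N (Polynomial.X ^ i * (1 + Polynomial.X) ^ c) =
      Polynomial.X ^ i * (1 - Polynomial.X) ^ (N - i - c) := by
  induction c with
  | zero => intro i hi; simpa using bernstein_X_pow hi
  | succ c ih =>
    intro i hi
    have h : (Polynomial.X ^ i * (1 + Polynomial.X) ^ (c + 1) : Polynomial ℤ) =
        Polynomial.X ^ i * (1 + Polynomial.X) ^ c +
          Polynomial.X ^ (i + 1) * (1 + Polynomial.X) ^ c := by ring
    rw [h, bernstein_add, ih i (by omega), ih (i + 1) (by omega)]
    obtain ⟨r, rfl⟩ := Nat.exists_eq_add_of_le hi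
    have h1 : i + (c + 1) + r - i - c = r + 1 := by omega
    have h2 : i + (c + 1) + r - (i + 1) - c = r := by omega
    have h3 : i + (c + 1) + r - i - (c + 1) = r := by omega
    rw [h1, h2, h3]
    ring

/-! ### Comparison of the two procedures -/

lemma sum_Icc_split {M : Type*} [AddCommMonoid M] {d p m : ℕ} (hdp : d ≤ p + 1) (hpm : p ≤ m)
    (f : ℕ → M) :
    ∑ i ∈ Finset.Icc d m, f i = ∑ i ∈ Finset.Icc d p, f i + ∑ i ∈ Finset.Icc (p + 1) m, f i := by
  have h : ∀ a b, Finset.Icc a b = Finset.Ico a (b + 1) := fun a b => by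
    ext; simp
  rw [h, h, h, Finset.sum_Ico_consecutive f hdp (by omega)]

section Comparison

variable {d m : ℕ} {a : ℕ → ℕ} {Q : Polynomial ℤ}

lemma natTrailingDegree_of_expansion (hdm : d ≤ m) (had : 0 < a d)
    (hQ : Q = ∑ i ∈ Finset.Icc d m,
      Polynomial.C (a i : ℤ) * (Polynomial.X ^ i * (1 - Polynomial.X) ^ (m - i))) :
    Q.natTrailingDegree = d := by
  have he := isTriangular_one_sub fun i => m - i
  have h1 : Q.coeff d = a d := by
    rw [hQ, he.coeff_sum (fun i => (a i : ℤ)) d m le_rfl, if_pos ⟨rfl, hdm⟩]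
  have h0 : Q.coeff d ≠ 0 := by rw [h1]; exact_mod_cast had.ne'
  refine le_antisymm (Polynomial.natTrailingDegree_le_of_ne_zero h0) ?_
  refine Polynomial.le_natTrailingDegree (fun h => h0 (by simp [h])) fun j hj => ?_
  rw [hQ, he.coeff_sum (fun i => (a i : ℤ)) d m hj.le, if_neg (by omega)]

lemma natDegree_X_pow_mul_le (i c : ℕ) :
    (Polynomial.X ^ i * (1 - Polynomial.X) ^ c : Polynomial ℤ).natDegree ≤ i + c := by
  refine Polynomial.natDegree_mul_le.trans (add_le_add (by simp) ?_)
  refine Polynomial.natDegree_pow_le.trans ?_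
  have : (1 - Polynomial.X : Polynomial ℤ).natDegree ≤ 1 :=
    (Polynomial.natDegree_sub_le _ _).trans (by simp)
  nlinarith

lemma natDegree_X_pow_mul_le' (i c : ℕ) :
    (Polynomial.X ^ i * (1 + Polynomial.X) ^ c : Polynomial ℤ).natDegree ≤ i + c := by
  refine Polynomial.natDegree_mul_le.trans (add_le_add (by simp) ?_)
  refine Polynomial.natDegree_pow_le.trans ?_
  have : (1 + Polynomial.X : Polynomial ℤ).natDegree ≤ 1 :=
    (Polynomial.natDegree_add_le _ _).trans (by simp)
  nlinarith

/-- The truncation `∑ aᵢ tⁱ`, `d ≤ i ≤ p`. -/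
def truncSum (a : ℕ → ℕ) (d p : ℕ) : Polynomial ℤ :=
  ∑ i ∈ Finset.Icc d p, Polynomial.monomial i (a i : ℤ)

lemma truncSum_eq (a : ℕ → ℕ) (d p : ℕ) :
    truncSum a d p = ∑ i ∈ Finset.Icc d p, Polynomial.C (a i : ℤ) * Polynomial.X ^ i :=
  Finset.sum_congr rfl fun i _ => by rw [Polynomial.C_mul_X_pow_eq_monomial]

/-- The numbers produced by the procedure for the truncation at `p = d + j`. -/
def truncCoeff (a : ℕ → ℕ) (d j i : ℕ) : ℤ :=
  procCoeff (fun i => Polynomial.X ^ i * (1 + Polynomial.X) ^ (d + j - i)) d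
    (truncSum a d (d + j)) i

lemma truncSum_expansion (a : ℕ → ℕ) (d j : ℕ) :
    truncSum a d (d + j) = ∑ i ∈ Finset.Icc d (d + j), Polynomial.C (truncCoeff a d j i) *
      (Polynomial.X ^ i * (1 + Polynomial.X) ^ (d + j - i)) := by
  have he := isTriangular_one_add fun i => d + j - i
  obtain ⟨c, hc⟩ := exists_expansion he (M := d + j)
    (fun i hi => (natDegree_X_pow_mul_le' _ _).trans (by omega)) (j + 1) d (by omega)
    (truncSum a d (d + j))
    (Polynomial.natDegree_sum_le_of_forall_le _ _ fun i hi =>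
      (Polynomial.natDegree_monomial_le _).trans (Finset.mem_Icc.1 hi).2)
    (fun k hk => by
      rw [truncSum, Polynomial.finsetSum_coeff]
      refine Finset.sum_eq_zero fun i hi => ?_
      rw [Finset.mem_Icc] at hi
      rw [Polynomial.coeff_monomial, if_neg (by omega)])
  refine hc.trans (Finset.sum_congr rfl fun i hi => ?_)
  rw [truncCoeff, procCoeff_eq_of_expansion he hc hi]

lemma truncCoeff_left (a : ℕ → ℕ) (d j : ℕ) : truncCoeff a d j d = a d := by
  have h := congrArg (fun p => Polynomial.coeff p d) (truncSum_expansion a d j)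
  rw [(isTriangular_one_add fun i => d + j - i).coeff_sum _ d _ le_rfl, if_pos ⟨rfl, by omega⟩]
    at h
  rw [← h, truncSum, Polynomial.finsetSum_coeff, Finset.sum_eq_single d]
  · simp
  · intro b _ hb; rw [Polynomial.coeff_monomial, if_neg hb]
  · intro hd; exact absurd (Finset.mem_Icc.2 ⟨le_rfl, by omega⟩) hd

/-- Source of the bound `⌊a_{d+1}/a_d⌋` on `j`. For `j = 0` the degree `d + 1` lies outside the
truncation. -/
lemma truncCoeff_succ (a : ℕ → ℕ) (d j : ℕ) (hj : 0 < j) :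
    truncCoeff a d j (d + 1) = a (d + 1) - j * a d := by
  have h := congrArg (fun p => Polynomial.coeff p (d + 1)) (truncSum_expansion a d j)
  rw [sum_Icc_split (p := d) (by omega) (by omega), Finset.Icc_self, Finset.sum_singleton,
    Polynomial.coeff_add,
    (isTriangular_one_add fun i => d + j - i).coeff_sum _ (d + 1) _ le_rfl,
    if_pos ⟨rfl, by omega⟩, truncCoeff_left, Polynomial.coeff_C_mul, add_comm d 1,
    Polynomial.coeff_X_pow_mul, Polynomial.coeff_one_add_X_pow, Nat.choose_one_right,
    Nat.add_sub_cancel_left] at h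
  have h2 : (truncSum a d (d + j)).coeff (1 + d) = a (1 + d) := by
    rw [truncSum, Polynomial.finsetSum_coeff, Finset.sum_eq_single (1 + d)]
    · simp
    · intro b _ hb; rw [Polynomial.coeff_monomial, if_neg hb]
    · intro hd; exact absurd (Finset.mem_Icc.2 ⟨by omega, by omega⟩) hd
  rw [h2] at h
  rw [add_comm d 1]
  linarith

/-- Homogenizing `t^i(1+t)^(p-i)` in degree `m` gives exponent `m - i - (p - i) = q`, the same for
every `i ≤ p = d + j`; the terms beyond `p` are left alone. -/
lemma numerator_expansion {q j : ℕ} (hq : d + j + q = m)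
    (hQ : Q = ∑ i ∈ Finset.Icc d m,
      Polynomial.C (a i : ℤ) * (Polynomial.X ^ i * (1 - Polynomial.X) ^ (m - i))) :
    Q = ∑ i ∈ Finset.Icc d (d + j), Polynomial.C (truncCoeff a d j i) *
        (Polynomial.X ^ i * (1 - Polynomial.X) ^ q) +
      ∑ i ∈ Finset.Icc (d + j + 1) m,
        Polynomial.C (a i : ℤ) * (Polynomial.X ^ i * (1 - Polynomial.X) ^ (m - i)) := by
  rw [hQ, sum_Icc_split (p := d + j) (by omega) (by omega)]
  congr 1
  have h := congrArg (bernstein m) (truncSum_expansion a d j)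
  rw [truncSum_eq, bernstein_sum, bernstein_sum] at h
  refine Eq.trans (Finset.sum_congr rfl fun i hi => ?_)
    (h.trans (Finset.sum_congr rfl fun i hi => ?_))
  · rw [Finset.mem_Icc] at hi
    rw [bernstein_C_mul, bernstein_X_pow (by omega)]
  · rw [Finset.mem_Icc] at hi
    rw [bernstein_C_mul, bernstein_X_pow_mul _ _ (by omega)]
    congr 3
    omega

/-- The exponents `q` for `i ≤ m - q` and `m - i` beyond are together `min q (m - i)`. So this is
the expansion computed by the numerator algorithm, with the `b_i` of the squarefree algorithm up to
`p` and then the counts `a_i`. -/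
lemma numerator_expansion_min {q j : ℕ} (hq : d + j + q = m)
    (hQ : Q = ∑ i ∈ Finset.Icc d m,
      Polynomial.C (a i : ℤ) * (Polynomial.X ^ i * (1 - Polynomial.X) ^ (m - i))) :
    Q = ∑ i ∈ Finset.Icc d m,
      Polynomial.C (if i ≤ d + j then truncCoeff a d j i else a i) *
        (Polynomial.X ^ i * (1 - Polynomial.X) ^ min q (m - i)) := by
  rw [sum_Icc_split (p := d + j) (by omega) (by omega)]
  refine (numerator_expansion hq hQ).trans (congrArg₂ _ ?_ ?_)
  · refine Finset.sum_congr rfl fun i hi => ?_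
    rw [Finset.mem_Icc] at hi
    rw [if_pos hi.2, min_eq_left (by omega)]
  · refine Finset.sum_congr rfl fun i hi => ?_
    rw [Finset.mem_Icc] at hi
    rw [if_neg (by omega), min_eq_right (by omega)]

lemma numeratorTest_iff {q j : ℕ} (hq : d + j + q = m) (had : 0 < a d)
    (hQ : Q = ∑ i ∈ Finset.Icc d m,
      Polynomial.C (a i : ℤ) * (Polynomial.X ^ i * (1 - Polynomial.X) ^ (m - i))) :
    NumeratorTest m Q q ↔ ∀ i ∈ Finset.Icc d (d + j), 0 ≤ truncCoeff a d j i := by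
  have hp := fun i (hi : i ∈ Finset.Icc d m) =>
    procCoeff_eq_of_expansion (isTriangular_one_sub fun i => min q (m - i))
      (numerator_expansion_min hq hQ) hi
  rw [NumeratorTest, natTrailingDegree_of_expansion (by omega) had hQ]
  constructor
  · intro h i hi
    rw [Finset.mem_Icc] at hi
    have hi' : i ∈ Finset.Icc d m := Finset.mem_Icc.2 ⟨hi.1, by omega⟩
    have := h i hi'
    rwa [hp i hi', if_pos hi.2] at this
  · intro h i hi
    rw [hp i hi]
    split_ifs with h1
    · exact h i (Finset.mem_Icc.2 ⟨(Finset.mem_Icc.1 hi).1, h1⟩)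
    · positivity

/-- Non-negative `b_i` display `Q` as an element of the cone. For the converse, `b_i` with `i ≤ d +
j` is the coefficient of `t^i` in `Q/(1-t)^q`. -/
lemma numeratorTest_iff_mem_cone {q j : ℕ} (hq : d + j + q = m) (had : 0 < a d)
    (hQ : Q = ∑ i ∈ Finset.Icc d m,
      Polynomial.C (a i : ℤ) * (Polynomial.X ^ i * (1 - Polynomial.X) ^ (m - i))) :
    NumeratorTest m Q q ↔ Q ∈ cone q := by
  rw [numeratorTest_iff hq had hQ]
  constructor
  · intro h
    rw [numerator_expansion hq hQ]
    refine add_mem (sum_mem fun i hi => C_mul_mem_cone (mem_cone_of_le _ le_rfl) (h i hi))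
      (sum_mem fun i hi => ?_)
    rw [Finset.mem_Icc] at hi
    exact C_mul_mem_cone (mem_cone_of_le _ (by omega)) (by positivity)
  · intro h i hi
    have hc := coeff_nonneg_of_mem_cone h i
    rw [Finset.mem_Icc] at hi
    -- After division by `(1-t)^q` the head is `∑ b_k t^k`, and the tail starts in degree `d + j +
    -- 1`, so it cannot disturb these coefficients.
    have e1 : (Q : PowerSeries ℤ) * geom ^ q =
        ((∑ k ∈ Finset.Icc d (d + j), Polynomial.C (truncCoeff a d j k) * Polynomial.X ^ k :
          Polynomial ℤ) : PowerSeries ℤ) +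
        ∑ k ∈ Finset.Icc (d + j + 1) m, PowerSeries.X ^ k *
          (PowerSeries.C (a k : ℤ) * (1 - PowerSeries.X) ^ (m - k) * geom ^ q) := by
      have h1 := congrArg (fun P : Polynomial ℤ => (P : PowerSeries ℤ) * geom ^ q)
        (numerator_expansion hq hQ)
      refine h1.trans ?_
      simp only [Polynomial.coe_add, add_mul]
      congr 1
      · have : (∑ i ∈ Finset.Icc d (d + j), Polynomial.C (truncCoeff a d j i) *
            (Polynomial.X ^ i * (1 - Polynomial.X) ^ q) : Polynomial ℤ) =
            (∑ k ∈ Finset.Icc d (d + j), Polynomial.C (truncCoeff a d j k) * Polynomial.X ^ k) *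
            (1 - Polynomial.X) ^ q := by
          rw [Finset.sum_mul]
          exact Finset.sum_congr rfl fun k _ => by ring
        rw [this]
        push_cast
        rw [mul_assoc, mul_comm (_ ^ q) (geom ^ q), geom_pow_mul, mul_one]
      · rw [coe_finsetSum, Finset.sum_mul]
        refine Finset.sum_congr rfl fun k _ => ?_
        push_cast
        ring
    rw [e1, map_add, map_sum, Polynomial.coeff_coe, Polynomial.finsetSum_coeff,
      Finset.sum_eq_single i, Finset.sum_eq_zero, add_zero] at hc
    · simpa using hc
    · intro k hk
      rw [Finset.mem_Icc] at hk
      rw [PowerSeries.coeff_X_pow_mul', if_neg (by omega)]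
    · intro k _ hk
      rw [Polynomial.coeff_C_mul_X_pow, if_neg hk.symm]
    · intro hk
      exact absurd (Finset.mem_Icc.2 hi) hk

end Comparison

/-! ### Macaulay's theorem for sets of monomials

A monomial is a function `Fin n → ℕ`. -/

/-- The lexicographic order on monomials, for `x₁ > x₂ > ⋯`. -/
def lexLT {n : ℕ} (u v : Fin n → ℕ) : Prop := toLex u < toLex v

lemma lexLT_iff {n : ℕ} {u v : Fin n → ℕ} :
    lexLT u v ↔ ∃ i, (∀ j < i, u j = v j) ∧ u i < v i := Iff.rfl

lemma lexLT.asymm {n : ℕ} {u v : Fin n → ℕ} (h : lexLT u v) : ¬ lexLT v u := lt_asymm h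

lemma lexLT_trichotomy {n : ℕ} (u v : Fin n → ℕ) : lexLT u v ∨ u = v ∨ lexLT v u :=
  (lt_trichotomy (toLex u) (toLex v)).imp id fun h => h.imp (fun h => toLex.injective h) id

/-- Used to exclude lex comparisons between monomials of equal degree when the smaller one has no
variable after the first difference. -/
lemma sum_lt_sum_of_lex {n : ℕ} {x y : Fin n → ℕ} (p : Fin n) (h : ∀ j < p, x j = y j)
    (hp : x p < y p) (h0 : ∀ j, p < j → x j = 0) : ∑ i, x i < ∑ i, y i := by
  refine Finset.sum_lt_sum (fun j _ => ?_) ⟨p, Finset.mem_univ _, hp⟩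
  rcases lt_trichotomy j p with hj | rfl | hj
  · exact (h j hj).le
  · exact hp.le
  · rw [h0 j hj]; exact Nat.zero_le _

/-- The monomials of degree `d`. -/
def mons (n d : ℕ) : Finset (Fin n → ℕ) := Finset.Nat.antidiagonalTuple n d

@[simp] lemma mem_mons {n d : ℕ} {u : Fin n → ℕ} : u ∈ mons n d ↔ ∑ i, u i = d :=
  Finset.Nat.mem_antidiagonalTuple

/-- Initial segments (in descending order) for the lexicographic order, in degree `d`. -/
structure IsSeg {n : ℕ} (d : ℕ) (L : Finset (Fin n → ℕ)) : Prop where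
  subset : L ⊆ mons n d
  mem_of_lt : ∀ u ∈ L, ∀ v ∈ mons n d, lexLT u v → v ∈ L

/-- Segments grow by adjoining the lex-largest monomial not yet included. -/
lemma exists_isSeg (n d : ℕ) : ∀ N ≤ (mons n d).card, ∃ L, IsSeg (n := n) d L ∧ L.card = N := by
  intro N
  induction N with
  | zero => exact fun _ => ⟨∅, ⟨Finset.empty_subset _, by simp⟩, rfl⟩
  | succ N ih =>
    intro hN
    obtain ⟨L, hL, hc⟩ := ih (by omega)
    have hne : (mons n d \ L).Nonempty := by
      rw [← Finset.card_pos, Finset.card_sdiff_of_subset hL.subset]; omega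
    obtain ⟨v, hv, hmax⟩ := Finset.exists_max_image (mons n d \ L) toLex hne
    rw [Finset.mem_sdiff] at hv
    refine ⟨insert v L, ⟨Finset.insert_subset hv.1 hL.subset, ?_⟩, by
      rw [Finset.card_insert_of_notMem hv.2, hc]⟩
    intro u hu w hw huw
    by_contra hcon
    rw [Finset.mem_insert, not_or] at hcon
    rcases Finset.mem_insert.1 hu with rfl | hu
    · exact (hmax w (Finset.mem_sdiff.2 ⟨hw, hcon.2⟩)).not_gt huw
    · exact hcon.2 (hL.mem_of_lt u hu w hw huw)

lemma IsSeg.subset_or_subset {n d : ℕ} {L L' : Finset (Fin n → ℕ)} (hL : IsSeg d L)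
    (hL' : IsSeg d L') : L ⊆ L' ∨ L' ⊆ L := by
  by_contra! h
  obtain ⟨⟨u, hu, hu'⟩, v, hv, hv'⟩ := And.imp Finset.not_subset.1 Finset.not_subset.1 h
  rcases lexLT_trichotomy u v with h1 | rfl | h1
  · exact hv' (hL.mem_of_lt u hu v (hL'.subset hv) h1)
  · exact hu' hv
  · exact hu' (hL'.mem_of_lt v hv u (hL.subset hu) h1)

lemma IsSeg.subset_of_card_le {n d : ℕ} {L L' : Finset (Fin n → ℕ)} (hL : IsSeg d L)
    (hL' : IsSeg d L') (h : L.card ≤ L'.card) : L ⊆ L' := by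
  rcases hL.subset_or_subset hL' with h1 | h1
  · exact h1
  · exact (Finset.eq_of_subset_of_card_le h1 h).ge

/-! ### Shadows of sets of monomials -/

/-- The monomials `xᵢ u` with `u ∈ A`. -/
def shadow {n : ℕ} (A : Finset (Fin n → ℕ)) : Finset (Fin n → ℕ) :=
  A.biUnion fun u => Finset.univ.image fun i => u + Pi.single i 1

lemma mem_shadow {n : ℕ} {A : Finset (Fin n → ℕ)} {w : Fin n → ℕ} :
    w ∈ shadow A ↔ ∃ u ∈ A, ∃ i, u + Pi.single i 1 = w := by
  simp [shadow]

lemma add_single_mem_shadow {n : ℕ} {A : Finset (Fin n → ℕ)} {u : Fin n → ℕ} (hu : u ∈ A)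
    (i : Fin n) : u + Pi.single i 1 ∈ shadow A := mem_shadow.2 ⟨u, hu, i, rfl⟩

lemma shadow_mono {n : ℕ} {A B : Finset (Fin n → ℕ)} (h : A ⊆ B) : shadow A ⊆ shadow B :=
  Finset.biUnion_subset_biUnion_of_subset_left _ h

lemma sum_add_single {n : ℕ} (u : Fin n → ℕ) (i : Fin n) :
    ∑ j, (u + Pi.single i 1 : Fin n → ℕ) j = ∑ j, u j + 1 := by
  simp [Finset.sum_add_distrib]

lemma shadow_subset {n d : ℕ} {A : Finset (Fin n → ℕ)} (h : A ⊆ mons n d) :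
    shadow A ⊆ mons n (d + 1) := by
  intro w hw
  obtain ⟨u, hu, i, rfl⟩ := mem_shadow.1 hw
  rw [mem_mons, sum_add_single, mem_mons.1 (h hu)]

lemma exists_last {n : ℕ} {u : Fin n → ℕ} {k : Fin n} (hk : 0 < u k) :
    ∃ l, k ≤ l ∧ 0 < u l ∧ ∀ j, l < j → u j = 0 := by
  obtain ⟨l, hl, hmax⟩ := Finset.exists_max_image (Finset.univ.filter fun i => 0 < u i) id
    ⟨k, by simpa using hk⟩
  refine ⟨l, hmax k (by simpa using hk), by simpa using hl, fun j hj => ?_⟩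
  by_contra h
  exact (hmax j (by simpa using Nat.pos_of_ne_zero h)).not_gt hj

lemma exists_eq_add_single {n : ℕ} {u : Fin n → ℕ} {l : Fin n} (hl : 0 < u l) :
    ∃ u' : Fin n → ℕ, u = u' + Pi.single l 1 := by
  refine ⟨u - Pi.single l 1, ?_⟩
  rw [tsub_add_cancel_of_le]
  intro j
  by_cases h : j = l
  · subst h; simpa using Nat.succ_le_iff.2 hl
  · simp [h]

/-- If `v` exceeds `x_i u` with `u` in the segment, divide `v` by its last variable `x_l`. The
quotient cannot be below `u`, since multiplying it by `x_l` would not lift it above `x_i u`; so it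
lies in the segment. -/
lemma IsSeg.shadow {n d : ℕ} {L : Finset (Fin n → ℕ)} (hL : IsSeg d L) :
    IsSeg (d + 1) (shadow L) := by
  refine ⟨shadow_subset hL.subset, ?_⟩
  intro w hw v hv hwv
  obtain ⟨u, hu, i, rfl⟩ := mem_shadow.1 hw
  obtain ⟨k, hk, hk'⟩ := lexLT_iff.1 hwv
  obtain ⟨l, hkl, hl, hlast⟩ := exists_last (Nat.zero_lt_of_lt hk')
  obtain ⟨v, rfl⟩ := exists_eq_add_single hl
  have hud := mem_mons.1 (hL.subset hu)
  have hvd : ∑ j, v j = d := by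
    rw [mem_mons, sum_add_single] at hv; omega
  refine add_single_mem_shadow ?_ l
  rcases lexLT_trichotomy u v with h | rfl | h
  · exact hL.mem_of_lt u hu v (mem_mons.2 hvd) h
  · exact hu
  exfalso
  obtain ⟨p, hp, hp'⟩ := lexLT_iff.1 h
  have hv0 : ∀ j, l < j → v j = 0 := fun j hj => by
    have := hlast j hj
    simp only [Pi.add_apply] at this
    omega
  -- Here `p` is the first place where the quotient falls below `u`. Beyond `l` it vanishes, so `l <
  -- p` contradicts equality of degrees; for `p ≤ l` compare `p` with `k`, the first place where
  -- `x_i u` falls below `x_l v`.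
  rcases lt_or_ge l p with hlp | hpl
  · have := sum_lt_sum_of_lex p hp hp' fun j hj => hv0 j (hlp.trans hj)
    omega
  simp only [Pi.add_apply, Pi.single_apply] at hk hk'
  rcases lt_trichotomy p k with h1 | rfl | h1
  · have := hk p h1
    rw [if_neg (h1.trans_le hkl).ne] at this
    omega
  · rcases hpl.eq_or_lt with rfl | h2
    · rw [if_pos rfl] at hk'
      split_ifs at hk' <;> omega
    · rw [if_neg h2.ne] at hk'
      omega
  · have h2 := hp k h1
    rw [if_neg (h1.trans_le hpl).ne] at hk'
    omega

/-! ### Strongly stable sets and the size of their shadows -/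

/-- Strongly stable sets of monomials. -/
def IsStable {n : ℕ} (A : Finset (Fin n → ℕ)) : Prop :=
  ∀ (u : Fin n → ℕ) (i j : Fin n), i < j → u + Pi.single j 1 ∈ A → u + Pi.single i 1 ∈ A

lemma lexLT_add_single {n : ℕ} (u : Fin n → ℕ) {i j : Fin n} (h : i < j) :
    lexLT (u + Pi.single j 1) (u + Pi.single i 1) := by
  refine lexLT_iff.2 ⟨i, fun k hk => ?_, ?_⟩
  · simp [hk.ne, (hk.trans h).ne]
  · simp [h.ne]

lemma IsSeg.isStable {n d : ℕ} {L : Finset (Fin n → ℕ)} (hL : IsSeg d L) : IsStable L := by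
  intro u i j hij hu
  refine hL.mem_of_lt _ hu _ ?_ (lexLT_add_single u hij)
  have := mem_mons.1 (hL.subset hu)
  rw [sum_add_single] at this
  rw [mem_mons, sum_add_single, this]

/-- The monomials of `A` in the variables `x₁, …, xᵢ`. -/
def upTo {n : ℕ} (A : Finset (Fin n → ℕ)) (i : Fin n) : Finset (Fin n → ℕ) :=
  A.filter fun u => ∀ j, i < j → u j = 0

lemma mem_upTo {n : ℕ} {A : Finset (Fin n → ℕ)} {i : Fin n} {u : Fin n → ℕ} :
    u ∈ upTo A i ↔ u ∈ A ∧ ∀ j, i < j → u j = 0 := Finset.mem_filter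

/-- Every element of the shadow is uniquely `u x_i` with `u ∈ A` and no variable of `u` after `x_i`:
uniqueness because `x_i` is then the last variable of the product, existence by exchanging
variables. -/
lemma IsStable.card_shadow {n : ℕ} {A : Finset (Fin n → ℕ)} (hA : IsStable A) :
    (shadow A).card = ∑ i, (upTo A i).card := by
  have h : shadow A = Finset.univ.biUnion fun i => (upTo A i).image fun u => u + Pi.single i 1 := by
    ext w
    simp only [Finset.mem_biUnion, Finset.mem_univ, true_and, Finset.mem_image, mem_upTo]
    constructor
    · intro hw
      obtain ⟨u, hu, i, rfl⟩ := mem_shadow.1 hw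
      by_cases h : ∀ j, i < j → u j = 0
      · exact ⟨i, u, ⟨hu, h⟩, rfl⟩
      push Not at h
      obtain ⟨k, hik, hk⟩ := h
      obtain ⟨l, hkl, hl, hlast⟩ := exists_last (Nat.pos_of_ne_zero hk)
      obtain ⟨u, rfl⟩ := exists_eq_add_single hl
      have hil := hik.trans_le hkl
      -- The product is regrouped as `(u x_i) x_l` with `x_l` its last variable; stability puts `u
      -- x_i` in `A`.
      refine ⟨l, u + Pi.single i 1, ⟨hA u i l hil hu, fun j hj => ?_⟩, by
        rw [add_right_comm]⟩
      have := hlast j hj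
      simp only [Pi.add_apply] at this ⊢
      rw [Pi.single_eq_of_ne (hil.trans hj).ne']
      omega
    · rintro ⟨i, u, ⟨hu, _⟩, rfl⟩
      exact add_single_mem_shadow hu i
  rw [h, Finset.card_biUnion]
  · exact Finset.sum_congr rfl fun i _ =>
      Finset.card_image_of_injective _ (add_left_injective _)
  · have key : ∀ i i' : Fin n, i < i' → ∀ u ∈ upTo A i, ∀ u' : Fin n → ℕ,
        u + Pi.single i 1 ≠ u' + Pi.single i' 1 := by
      intro i i' hii u hu u' heq
      have := congrFun heq i'
      simp [(mem_upTo.1 hu).2 i' hii, hii.ne'] at this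
    intro i _ i' _ hne
    simp only [Finset.disjoint_left, Finset.mem_image]
    rintro _ ⟨u, hu, rfl⟩ ⟨u', hu', heq⟩
    rcases lt_or_gt_of_ne hne with h | h
    · exact key i i' h u hu u' heq.symm
    · exact key i' i h u' hu' u heq

/-! #### Compression -/

/-- Insert the exponent `c` of the variable `xᵢ`. -/
def ins {n : ℕ} (i : Fin (n + 1)) (c : ℕ) (u : Fin n → ℕ) : Fin (n + 1) → ℕ :=
  i.insertNth (α := fun _ => ℕ) c u

/-- Remove the variable `xᵢ`. -/
def res {n : ℕ} (i : Fin (n + 1)) (w : Fin (n + 1) → ℕ) : Fin n → ℕ := fun j => w (i.succAbove j)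

@[simp] lemma ins_same {n : ℕ} (i : Fin (n + 1)) (c : ℕ) (u : Fin n → ℕ) : ins i c u i = c := by
  simp [ins]

@[simp] lemma ins_succAbove {n : ℕ} (i : Fin (n + 1)) (c : ℕ) (u : Fin n → ℕ) (j : Fin n) :
    ins i c u (i.succAbove j) = u j := by
  simp [ins]

@[simp] lemma res_ins {n : ℕ} (i : Fin (n + 1)) (c : ℕ) (u : Fin n → ℕ) :
    res i (ins i c u) = u := by
  ext j; simp [res]

lemma ext_succAbove {n : ℕ} (i : Fin (n + 1)) {u v : Fin (n + 1) → ℕ} (h : u i = v i)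
    (h' : ∀ j, u (i.succAbove j) = v (i.succAbove j)) : u = v := by
  funext j
  rcases Fin.eq_self_or_eq_succAbove i j with rfl | ⟨k, rfl⟩
  · exact h
  · exact h' k

@[simp] lemma ins_res {n : ℕ} (i : Fin (n + 1)) (w : Fin (n + 1) → ℕ) :
    ins i (w i) (res i w) = w :=
  ext_succAbove i (by simp) fun j => by simp [res]

lemma sum_eq_add_sum_res {n : ℕ} (i : Fin (n + 1)) (w : Fin (n + 1) → ℕ) :
    ∑ j, w j = w i + ∑ j, res i w j := Fin.sum_univ_succAbove w i

lemma lexLT_res {n : ℕ} {i : Fin (n + 1)} {u v : Fin (n + 1) → ℕ} (h : u i = v i) :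
    lexLT (res i u) (res i v) ↔ lexLT u v := by
  rw [lexLT_iff, lexLT_iff]
  constructor
  · rintro ⟨k, hk, hk'⟩
    refine ⟨i.succAbove k, fun j hj => ?_, hk'⟩
    rcases Fin.eq_self_or_eq_succAbove i j with rfl | ⟨l, rfl⟩
    · exact h
    · exact hk l (i.strictMono_succAbove.lt_iff_lt.1 hj)
  · rintro ⟨k, hk, hk'⟩
    rcases Fin.eq_self_or_eq_succAbove i k with rfl | ⟨l, rfl⟩
    · omega
    · exact ⟨l, fun j hj => hk _ (i.strictMono_succAbove hj), hk'⟩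

/-- The monomials `u` in the other variables with `xᵢᶜ u ∈ A`. -/
def fiber {n : ℕ} (i : Fin (n + 1)) (A : Finset (Fin (n + 1) → ℕ)) (c : ℕ) :
    Finset (Fin n → ℕ) :=
  (A.filter fun w => w i = c).image (res i)

lemma mem_fiber {n : ℕ} {i : Fin (n + 1)} {A : Finset (Fin (n + 1) → ℕ)} {c : ℕ}
    {u : Fin n → ℕ} : u ∈ fiber i A c ↔ ins i c u ∈ A := by
  simp only [fiber, Finset.mem_image, Finset.mem_filter]
  constructor
  · rintro ⟨w, ⟨hw, rfl⟩, rfl⟩; simpa using hw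
  · exact fun h => ⟨_, ⟨h, by simp⟩, by simp⟩

lemma res_mem_fiber {n : ℕ} {i : Fin (n + 1)} {A : Finset (Fin (n + 1) → ℕ)}
    {w : Fin (n + 1) → ℕ} : res i w ∈ fiber i A (w i) ↔ w ∈ A := by
  rw [mem_fiber, ins_res]

lemma fiber_subset {n d : ℕ} {i : Fin (n + 1)} {A : Finset (Fin (n + 1) → ℕ)}
    (hA : A ⊆ mons (n + 1) d) (c : ℕ) : fiber i A c ⊆ mons n (d - c) := by
  intro u hu
  have := mem_mons.1 (hA (mem_fiber.1 hu))
  rw [sum_eq_add_sum_res i, ins_same, res_ins] at this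
  rw [mem_mons]; omega

lemma fiber_eq_empty {n d : ℕ} {i : Fin (n + 1)} {A : Finset (Fin (n + 1) → ℕ)}
    (hA : A ⊆ mons (n + 1) d) {c : ℕ} (hc : d < c) : fiber i A c = ∅ := by
  rw [Finset.eq_empty_iff_forall_notMem]
  intro u hu
  have := mem_mons.1 (hA (mem_fiber.1 hu))
  rw [sum_eq_add_sum_res i, ins_same, res_ins] at this
  omega

lemma card_eq_sum_fiber {n d : ℕ} (i : Fin (n + 1)) {A : Finset (Fin (n + 1) → ℕ)}
    (hA : A ⊆ mons (n + 1) d) : A.card = ∑ c ∈ Finset.range (d + 1), (fiber i A c).card := by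
  rw [Finset.card_eq_sum_card_fiberwise (f := fun w => w i) (t := Finset.range (d + 1))]
  · refine Finset.sum_congr rfl fun c _ => (Finset.card_image_of_injOn ?_).symm
    intro w hw w' hw' h
    simp only [Finset.coe_filter, Set.mem_ofPred_eq] at hw hw'
    rw [← ins_res i w, ← ins_res i w', h, hw.2, hw'.2]
  · intro w hw
    have := mem_mons.1 (hA hw)
    rw [sum_eq_add_sum_res i] at this
    simp only [Finset.coe_range, Set.mem_Iio]
    omega

lemma ins_add_single_same {n : ℕ} (i : Fin (n + 1)) (c : ℕ) (u : Fin n → ℕ) :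
    ins i c u + Pi.single i 1 = ins i (c + 1) u :=
  ext_succAbove i (by simp) fun j => by simp [Fin.succAbove_ne]

lemma ins_add_single_succAbove {n : ℕ} (i : Fin (n + 1)) (c : ℕ) (u : Fin n → ℕ) (j : Fin n) :
    ins i c u + Pi.single (i.succAbove j) 1 = ins i c (u + Pi.single j 1) :=
  ext_succAbove i (by simp [Fin.ne_succAbove]) fun k => by
    simp [Pi.single_apply]

lemma ins_inj {n : ℕ} {i : Fin (n + 1)} {c c' : ℕ} {u u' : Fin n → ℕ}
    (h : ins i c u = ins i c' u') : c = c' ∧ u = u' := by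
  constructor
  · simpa using congrFun h i
  · simpa using congrArg (res i) h

lemma mem_fiber_shadow {n : ℕ} {i : Fin (n + 1)} {A : Finset (Fin (n + 1) → ℕ)} {c : ℕ}
    {u : Fin n → ℕ} : u ∈ fiber i (shadow A) c ↔
      (∃ c', c' + 1 = c ∧ u ∈ fiber i A c') ∨ u ∈ shadow (fiber i A c) := by
  rw [mem_fiber, mem_shadow]
  constructor
  · rintro ⟨w, hw, k, hk⟩
    rcases Fin.eq_self_or_eq_succAbove i k with rfl | ⟨j, rfl⟩
    · left
      rw [← ins_res k w, ins_add_single_same] at hk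
      obtain ⟨h1, h2⟩ := ins_inj hk
      exact ⟨w k, h1, by rw [← h2, res_mem_fiber]; exact hw⟩
    · right
      rw [← ins_res i w, ins_add_single_succAbove] at hk
      obtain ⟨h1, h2⟩ := ins_inj hk
      exact mem_shadow.2 ⟨res i w, by rw [← h1, res_mem_fiber]; exact hw, j, h2⟩
  · rintro (⟨c', rfl, h⟩ | h)
    · exact ⟨_, mem_fiber.1 h, i, ins_add_single_same _ _ _⟩
    · obtain ⟨v, hv, j, rfl⟩ := mem_shadow.1 h
      exact ⟨_, mem_fiber.1 hv, _, ins_add_single_succAbove _ _ _ _⟩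

lemma card_fiber_shadow_zero {n : ℕ} (i : Fin (n + 1)) (A : Finset (Fin (n + 1) → ℕ)) :
    fiber i (shadow A) 0 = shadow (fiber i A 0) := by
  ext u; simp [mem_fiber_shadow]

lemma card_fiber_shadow_succ {n : ℕ} (i : Fin (n + 1)) (A : Finset (Fin (n + 1) → ℕ)) (c : ℕ) :
    fiber i (shadow A) (c + 1) = fiber i A c ∪ shadow (fiber i A (c + 1)) := by
  ext u; simp [mem_fiber_shadow]

/-- The inequality of Macaulay's theorem, in `n` variables. -/
def MacaulayBound (n : ℕ) : Prop :=
  ∀ (d : ℕ) (A L : Finset (Fin n → ℕ)), A ⊆ mons n d → IsSeg d L → L.card ≤ A.card →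
    (shadow L).card ≤ (shadow A).card

/-- Replace every fiber over an exponent of `x_i` by the lex segment of the same size. A fiber of
the shadow is the union of a fiber and a shadow of the next fiber. After compression these are
segments of one degree, hence nested, so the union is as large as the larger part, which the
induction hypothesis bounds. -/
lemma exists_compression {n d : ℕ} (hn : MacaulayBound n) (i : Fin (n + 1))
    {A : Finset (Fin (n + 1) → ℕ)} (hA : A ⊆ mons (n + 1) d) :
    ∃ B ⊆ mons (n + 1) d, B.card = A.card ∧ (shadow B).card ≤ (shadow A).card ∧
      (∀ c, (fiber i B c).card = (fiber i A c).card) ∧ ∀ c, IsSeg (d - c) (fiber i B c) := by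
  have h : ∀ c, ∃ L : Finset (Fin n → ℕ), IsSeg (d - c) L ∧ L.card = (fiber i A c).card :=
    fun c => exists_isSeg n (d - c) _ (Finset.card_le_card (fiber_subset hA c))
  choose C hC hCc using h
  set B := (mons (n + 1) d).filter fun w => res i w ∈ C (w i) with hB
  have hBsub : B ⊆ mons (n + 1) d := Finset.filter_subset _ _
  have hfib : ∀ c, fiber i B c = C c := by
    intro c
    ext u
    rw [mem_fiber, hB, Finset.mem_filter, ins_same, res_ins, and_iff_right_iff_imp]
    intro hu
    have hdeg := mem_mons.1 ((hC c).subset hu)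
    have hle : c ≤ d := by
      by_contra hcon
      have := hCc c
      rw [fiber_eq_empty hA (by omega), Finset.card_empty, Finset.card_eq_zero] at this
      rw [this] at hu
      simp at hu
    rw [mem_mons, sum_eq_add_sum_res i, ins_same, res_ins]
    omega
  refine ⟨B, hBsub, ?_, ?_, fun c => by rw [hfib, hCc], fun c => by rw [hfib]; exact hC c⟩
  · rw [card_eq_sum_fiber i hBsub, card_eq_sum_fiber i hA]
    exact Finset.sum_congr rfl fun c _ => by rw [hfib, hCc]
  · rw [card_eq_sum_fiber i (shadow_subset hBsub), card_eq_sum_fiber i (shadow_subset hA)]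
    have hsh : ∀ c, (shadow (C c)).card ≤ (shadow (fiber i A c)).card := fun c =>
      hn (d - c) _ _ (fiber_subset hA c) (hC c) (hCc c).le
    refine Finset.sum_le_sum fun c hc => ?_
    rcases c with _ | c
    · rw [card_fiber_shadow_zero, card_fiber_shadow_zero, hfib]
      exact hsh 0
    · rw [card_fiber_shadow_succ, card_fiber_shadow_succ, hfib, hfib]
      have h1 : (C c).card ≤ (fiber i A c ∪ shadow (fiber i A (c + 1))).card := by
        rw [hCc]; exact Finset.card_le_card Finset.subset_union_left
      have h2 : (shadow (C (c + 1))).card ≤ (fiber i A c ∪ shadow (fiber i A (c + 1))).card :=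
        (hsh _).trans (Finset.card_le_card Finset.subset_union_right)
      -- For `c ≥ d` the fiber over `c + 1` is empty, and the truncated degree `d - (c + 1)` must
      -- not be used.
      by_cases hcd : c + 1 ≤ d
      · have hseg : IsSeg (d - c) (shadow (C (c + 1))) := by
          have := (hC (c + 1)).shadow
          rwa [show d - (c + 1) + 1 = d - c by omega] at this
        rcases (hC c).subset_or_subset hseg with h | h
        · rwa [Finset.union_eq_right.2 h]
        · rwa [Finset.union_eq_left.2 h]
      · have : C (c + 1) = ∅ := by
          rw [← Finset.card_eq_zero, hCc, fiber_eq_empty hA (by omega), Finset.card_empty]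
        rw [this]
        simpa [shadow] using h1

/-- A termination device: replacing elements by lex-larger ones increases a set in the
colexicographic order, so a maximal set is fixed by every such operation. -/
lemma exists_colex_maximal {n : ℕ} (F : Finset (Finset (Fin n → ℕ))) (hF : F.Nonempty) :
    ∃ A ∈ F, ∀ B ∈ F, (∀ a ∈ A, a ∉ B → ∃ b ∈ B, b ∉ A ∧ lexLT a b) → B = A := by
  let φ : (Fin n → ℕ) ↪ Lex (Fin n → ℕ) := toLex.toEmbedding
  obtain ⟨A, hA, hmax⟩ := Finset.exists_max_image F (fun A => toColex (A.map φ)) hF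
  refine ⟨A, hA, fun B hB h => ?_⟩
  by_contra hne
  refine (hmax B hB).not_gt (lt_of_le_of_ne ?_ ?_)
  · rw [Finset.Colex.toColex_le_toColex]
    intro a ha ha'
    obtain ⟨a, ha1, rfl⟩ := Finset.mem_map.1 ha
    obtain ⟨b, hb, hb', hab⟩ := h a ha1 fun h => ha' (Finset.mem_map_of_mem φ h)
    exact ⟨φ b, Finset.mem_map_of_mem φ hb, by simpa using hb', le_of_lt hab⟩
  · intro heq
    exact hne (Finset.map_injective φ (toColex.injective heq)).symm

/-- Choose a colex-maximal set among those with the right size and a shadow no larger. Compression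
in any variable moves monomials upwards and stays among these candidates, so it fixes the chosen
set. -/
lemma exists_compressed {n d : ℕ} (hn : MacaulayBound n) {A : Finset (Fin (n + 1) → ℕ)}
    (hA : A ⊆ mons (n + 1) d) :
    ∃ B ⊆ mons (n + 1) d, B.card = A.card ∧ (shadow B).card ≤ (shadow A).card ∧
      ∀ i c, IsSeg (d - c) (fiber i B c) := by
  classical
  obtain ⟨B, hB, hmax⟩ := exists_colex_maximal
    ((mons (n + 1) d).powerset.filter fun B =>
      B.card = A.card ∧ (shadow B).card ≤ (shadow A).card)
    ⟨A, by simp [hA]⟩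
  rw [Finset.mem_filter, Finset.mem_powerset] at hB
  refine ⟨B, hB.1, hB.2.1, hB.2.2, fun i => ?_⟩
  obtain ⟨C, hC, hCc, hCs, hCf, hCseg⟩ := exists_compression hn i hB.1
  have := hmax C (by
    rw [Finset.mem_filter, Finset.mem_powerset]
    exact ⟨hC, hCc.trans hB.2.1, hCs.trans hB.2.2⟩) (by
    intro a ha ha'
    have h1 : res i a ∈ fiber i B (a i) := res_mem_fiber.2 ha
    have h2 : res i a ∉ fiber i C (a i) := fun h => ha' (res_mem_fiber.1 h)
    -- Fiber sizes are preserved, so a fiber that loses `a` gains some `b`; as the new fiber is a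
    -- segment containing `b` but not `a`, the gained monomial is the larger one.
    have h3 : ¬ fiber i C (a i) ⊆ fiber i B (a i) := fun h => by
      rw [Finset.eq_of_subset_of_card_le h (hCf _).ge] at h2
      exact h2 h1
    obtain ⟨b, hb, hb'⟩ := Finset.not_subset.1 h3
    refine ⟨ins i (a i) b, mem_fiber.1 hb, fun h => hb' (mem_fiber.2 h), ?_⟩
    rw [← lexLT_res (i := i) (by simp), res_ins]
    rcases lexLT_trichotomy (res i a) b with h | rfl | h
    · exact h
    · exact absurd hb h2
    · exact absurd ((hCseg (a i)).mem_of_lt b hb _ (fiber_subset hB.1 _ h1) h) h2)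
  rw [← this]
  exact hCseg

/-! ### Compressed sets and the induction for Macaulay's theorem -/

lemma mem_of_compressed {n d : ℕ} {B : Finset (Fin (n + 1) → ℕ)} {i : Fin (n + 1)}
    (h : ∀ c, IsSeg (d - c) (fiber i B c)) {u v : Fin (n + 1) → ℕ}
    (hu : u ∈ B) (hv : v ∈ mons (n + 1) d) (huv : lexLT u v) (hi : u i = v i) : v ∈ B := by
  rw [← res_mem_fiber (i := i), ← hi]
  refine (h (u i)).mem_of_lt _ (res_mem_fiber.2 hu) _ ?_ ((lexLT_res hi).2 huv)
  have := mem_mons.1 hv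
  rw [sum_eq_add_sum_res i] at this
  rw [mem_mons]; omega

/-- Trading `x_j` for `x_i` leaves the exponent of a third variable unchanged, so the comparison
takes place inside one fiber. This is why at least three variables are required. -/
lemma isStable_of_compressed {n d : ℕ} (hn : 2 ≤ n) {B : Finset (Fin (n + 1) → ℕ)}
    (hB : B ⊆ mons (n + 1) d) (h : ∀ i c, IsSeg (d - c) (fiber i B c)) : IsStable B := by
  intro u i j hij hu
  have hcard : ({i, j} : Finset (Fin (n + 1))).card < Fintype.card (Fin (n + 1)) := by
    rw [Fintype.card_fin]
    exact (Finset.card_le_two).trans_lt (by omega)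
  obtain ⟨k, hk⟩ : ∃ k, k ∉ ({i, j} : Finset (Fin (n + 1))) := by
    by_contra! hcon
    exact hcard.ne (Finset.card_eq_iff_eq_univ _ |>.2 (Finset.eq_univ_iff_forall.2 hcon))
  simp only [Finset.mem_insert, Finset.mem_singleton, not_or] at hk
  refine mem_of_compressed (h k) hu ?_ (lexLT_add_single u hij) (by simp [hk.1, hk.2])
  have := mem_mons.1 (hB hu)
  rw [sum_add_single] at this
  rw [mem_mons, sum_add_single, this]

/-- Induction on the exponent of the last variable in `w`. Trading one such factor for the preceding
variable stays in `B` by stability and cannot jump over `v`, which does not involve the last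
variable. Once the exponent is zero, `w` and `v` lie in the same fiber. -/
lemma mem_of_lexLT_of_last {n d : ℕ} (hn : 1 ≤ n) {B : Finset (Fin (n + 1) → ℕ)}
    (hB : B ⊆ mons (n + 1) d) (h : ∀ c, IsSeg (d - c) (fiber (Fin.last n) B c))
    (hst : IsStable B) {v : Fin (n + 1) → ℕ} (hv : v ∈ mons (n + 1) d)
    (hv0 : v (Fin.last n) = 0) :
    ∀ (k : ℕ) (w : Fin (n + 1) → ℕ), w (Fin.last n) = k → w ∈ B → lexLT w v → v ∈ B := by
  intro k
  induction k with
  | zero => intro w hw hwB hwv; exact mem_of_compressed h hwB hv hwv (by rw [hw, hv0])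
  | succ k ih =>
    intro w hw hwB hwv
    obtain ⟨w, rfl⟩ := exists_eq_add_single (u := w) (l := Fin.last n) (by omega)
    set t : Fin (n + 1) := ⟨n - 1, by omega⟩ with ht
    have htl : t < Fin.last n := by rw [Fin.lt_def]; simp [ht]; omega
    have hB' : w + Pi.single t 1 ∈ B := hst w t (Fin.last n) htl hwB
    simp only [Pi.add_apply, Pi.single_eq_same] at hw
    rcases lexLT_trichotomy (w + Pi.single t 1) v with h1 | h1 | h1
    · refine ih _ ?_ hB' h1
      simp only [Pi.add_apply, Pi.single_eq_of_ne htl.ne']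
      omega
    · rwa [← h1]
    -- Now `w x_last < v < w x_t`. A first difference of `v` and `w x_t` at or before `t` would give
    -- `v < w x_last`; one at the last variable contradicts equality of degrees.
    exfalso
    obtain ⟨p, hp, hp'⟩ := lexLT_iff.1 h1
    have hlast : ∀ j, t < j → j = Fin.last n := by
      intro j hj
      rw [Fin.lt_def] at hj
      simp only [ht] at hj
      ext; simp; omega
    rcases lt_trichotomy p t with h2 | rfl | h2
    · refine hwv.asymm (lexLT_iff.2 ⟨p, fun j hj => ?_, ?_⟩)
      · rw [hp j hj]
        simp [(hj.trans h2).ne, ((hj.trans h2).trans htl).ne]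
      · simpa [h2.ne, (h2.trans htl).ne] using hp'
    · have hagree : ∀ j < t, v j = (w + Pi.single (Fin.last n) 1 : Fin (n + 1) → ℕ) j := fun j hj => by
        rw [hp j hj]
        simp [hj.ne, (hj.trans htl).ne]
      simp only [Pi.add_apply, Pi.single_eq_same] at hp'
      rcases (Nat.lt_succ_iff.1 hp').eq_or_lt with h3 | h3
      · refine hwv.asymm (lexLT_iff.2 ⟨Fin.last n, fun j hj => ?_, by simp [hv0]⟩)
        rcases lt_trichotomy j t with h4 | rfl | h4
        · exact hagree j h4
        · simp [h3, htl.ne]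
        · exact absurd (hlast j h4) hj.ne
      · refine hwv.asymm (lexLT_iff.2 ⟨t, hagree, ?_⟩)
        simpa [htl.ne] using h3
    · have hd1 := mem_mons.1 (hB hB')
      have hd2 := mem_mons.1 hv
      have := sum_lt_sum_of_lex p hp hp' fun j hj =>
        absurd (hlast j (h2.trans hj)) (by rw [hlast p h2] at hj; exact hj.ne')
      omega

/-- Both shadows are counted by `IsStable.card_shadow` and compared summand by summand. The summand
of the last variable is the size of the set; for the others it suffices that `B` contains every
element of `L` free of the last variable. -/
lemma macaulayBound_succ {n : ℕ} (hn2 : 2 ≤ n) (hn : MacaulayBound n) :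
    MacaulayBound (n + 1) := by
  intro d A L hA hL hcard
  obtain ⟨B, hB, hBc, hBs, hseg⟩ := exists_compressed hn hA
  refine le_trans ?_ hBs
  rw [← hBc] at hcard
  have hst := isStable_of_compressed hn2 hB hseg
  rw [hst.card_shadow, hL.isStable.card_shadow]
  have key : ∀ v ∈ L, v (Fin.last n) = 0 → v ∈ B := by
    intro v hv hv0
    by_contra hvB
    -- If `v ∉ B`, nothing in `B` can lie below `v`, and everything above `v` belongs to `L`; then
    -- `B` would be smaller than `L`.
    have hsub : B ⊆ L.erase v := by
      intro w hw
      have hwv : w ≠ v := fun h => hvB (h ▸ hw)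
      refine Finset.mem_erase.2 ⟨hwv, ?_⟩
      rcases lexLT_trichotomy w v with h | h | h
      · exact absurd (mem_of_lexLT_of_last (by omega) hB (hseg _) hst (hL.subset hv) hv0 _ w rfl
          hw h) hvB
      · exact absurd h hwv
      · exact hL.mem_of_lt v hv w (hB hw) h
    have := Finset.card_le_card hsub
    rw [Finset.card_erase_of_mem hv] at this
    have := Finset.card_pos.2 ⟨v, hv⟩
    omega
  refine Finset.sum_le_sum fun i _ => ?_
  rcases (Fin.le_last i).eq_or_lt with rfl | hi
  · have h : ∀ D : Finset (Fin (n + 1) → ℕ), upTo D (Fin.last n) = D := fun D =>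
      Finset.filter_true_of_mem fun u _ j hj => absurd hj (Fin.le_last j).not_gt
    rw [h, h]
    exact hcard
  · refine Finset.card_le_card fun u hu => ?_
    rw [mem_upTo] at hu ⊢
    exact ⟨key u hu.1 (hu.2 _ hi), hu.2⟩

lemma macaulayBound_of_subsingleton {n : ℕ} (hn : ∀ d, (mons n d : Set (Fin n → ℕ)).Subsingleton) :
    MacaulayBound n := by
  intro d A L hA hL hcard
  refine Finset.card_le_card (shadow_mono fun u hu => ?_)
  obtain ⟨v, hv⟩ := Finset.card_pos.1 ((Finset.card_pos.2 ⟨u, hu⟩).trans_le hcard)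
  rwa [hn d (hL.subset hu) (hA hv)]

/-- Compression does not force stability in two variables, so this case is direct: a segment gains
at most one element in its shadow, and every nonempty set gains at least one. -/
lemma macaulayBound_two : MacaulayBound 2 := by
  intro d A L hA hL hcard
  rcases L.eq_empty_or_nonempty with rfl | hne
  · simp [shadow]
  have hAne : A.Nonempty := Finset.card_pos.1 ((Finset.card_pos.2 hne).trans_le hcard)
  have h1 : (shadow L).card ≤ L.card + 1 := by
    rw [hL.isStable.card_shadow, Fin.sum_univ_two, add_comm]
    refine add_le_add (Finset.card_le_card (Finset.filter_subset _ _)) ?_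
    rw [Finset.card_le_one]
    intro u hu v hv
    rw [mem_upTo] at hu hv
    have hu1 := hu.2 1 (by simp)
    have hv1 := hv.2 1 (by simp)
    have hu2 := mem_mons.1 (hL.subset hu.1)
    have hv2 := mem_mons.1 (hL.subset hv.1)
    rw [Fin.sum_univ_two] at hu2 hv2
    funext j
    fin_cases j
    · simp; omega
    · simp; omega
  have h2 : A.card + 1 ≤ (shadow A).card := by
    -- The multiples by the first variable give `|A|` elements; the monomial with the highest power
    -- of the second variable, times that variable, is a new one.
    obtain ⟨u, hu, hmax⟩ := Finset.exists_max_image A (fun u => u 1) hAne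
    have hnot : u + Pi.single 1 1 ∉ A.image fun v => v + Pi.single (0 : Fin 2) 1 := by
      rw [Finset.mem_image]
      rintro ⟨v, hv, h⟩
      have := congrFun h 1
      have h3 := hmax v hv
      simp at this
      omega
    have := Finset.card_insert_of_notMem hnot
    rw [Finset.card_image_of_injective _ (add_left_injective _)] at this
    rw [← this]
    refine Finset.card_le_card (Finset.insert_subset (add_single_mem_shadow hu 1) ?_)
    intro w hw
    obtain ⟨v, hv, rfl⟩ := Finset.mem_image.1 hw
    exact add_single_mem_shadow hv 0
  omega

/-- **Macaulay's theorem**: among the sets of monomials of degree `d` of given size, the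
lexicographic segments have the fewest multiples in degree `d + 1`. -/
theorem macaulayBound (n : ℕ) : MacaulayBound n := by
  rcases n with _ | _ | n
  · exact macaulayBound_of_subsingleton fun d u _ v _ => Subsingleton.elim _ _
  · refine macaulayBound_of_subsingleton fun d u hu v hv => ?_
    rw [Finset.mem_coe, mem_mons, Fin.sum_univ_one] at hu hv
    funext j
    rw [Fin.fin_one_eq_zero j, hu, hv]
  · induction n with
    | zero => exact macaulayBound_two
    | succ n ih => exact macaulayBound_succ (by omega) ih

/-! ### Graded bases -/

section GradedBasis

variable {K V W ι κ : Type*} [Field K] [AddCommGroup V] [Module K V] [AddCommGroup W] [Module K W]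

/-- The basis `b`, with `b i` in degree `δ i`, induces bases of the graded pieces `A j`. -/
def IsGradedBasis (A : ℕ → Submodule K V) (b : Module.Basis ι K V) (δ : ι → ℕ) : Prop :=
  ∀ j, A j = Submodule.span K (b '' {i | δ i = j})

lemma IsGradedBasis.finrank_eq {A : ℕ → Submodule K V} {b : Module.Basis ι K V} {δ : ι → ℕ}
    (h : IsGradedBasis A b δ) (j : ℕ) :
    Module.finrank K (A j) = Nat.card {i // δ i = j} := by
  have hli : LinearIndependent K fun i : {i // δ i = j} => b i :=
    b.linearIndependent.comp _ Subtype.val_injective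
  have hr : Set.range (fun i : {i // δ i = j} => b i) = b '' {i | δ i = j} := by
    ext; simp
  rw [h j, ← hr]
  exact Module.finrank_eq_nat_card_basis (Module.Basis.span hli)

/-- Bijections of the basis elements, degree by degree, glue to a bijection of the bases and extend
linearly. -/
lemma IsGradedBasis.exists_equiv {A : ℕ → Submodule K V} {b : Module.Basis ι K V} {δ : ι → ℕ}
    (h : IsGradedBasis A b δ) {B : ℕ → Submodule K W} {c : Module.Basis κ K W} {ε : κ → ℕ}
    (h' : IsGradedBasis B c ε) (hfin : ∀ j, Finite {i // δ i = j})
    (hfin' : ∀ j, Finite {i // ε i = j})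
    (hcard : ∀ j, Nat.card {i // δ i = j} = Nat.card {i // ε i = j}) :
    ∃ e : V ≃ₗ[K] W, ∀ j v, v ∈ A j ↔ e v ∈ B j := by
  let σ : ι ≃ κ := Equiv.ofFiberEquiv (f := δ) (g := ε) fun j =>
    (Finite.card_eq.1 (hcard j)).some
  have hσ : ∀ i, ε (σ i) = δ i := Equiv.ofFiberEquiv_map _
  let e : V ≃ₗ[K] W := b.equiv c σ
  refine ⟨e, fun j v => ?_⟩
  have hmap : (A j).map (e : V →ₗ[K] W) = B j := by
    rw [h j, h' j, Submodule.map_span, ← Set.image_comp]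
    congr 1
    ext w
    constructor
    · rintro ⟨i, hi, rfl⟩
      exact ⟨σ i, (hσ i).trans hi, by simp [e]⟩
    · rintro ⟨k, hk, rfl⟩
      refine ⟨σ.symm k, ?_, by simp [e]⟩
      have := hσ (σ.symm k)
      rw [Equiv.apply_symm_apply] at this
      exact this.symm.trans hk
  rw [← hmap]
  constructor
  · exact fun hv => ⟨v, hv, rfl⟩
  · rintro ⟨v', hv', hvv⟩
    rwa [← e.injective hvv]

lemma IsGradedBasis.card_eq_of_equiv {A : ℕ → Submodule K V} {b : Module.Basis ι K V} {δ : ι → ℕ}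
    (h : IsGradedBasis A b δ) {B : ℕ → Submodule K W} {c : Module.Basis κ K W} {ε : κ → ℕ}
    (h' : IsGradedBasis B c ε) (e : V ≃ₗ[K] W) (he : ∀ j v, v ∈ A j ↔ e v ∈ B j) (j : ℕ) :
    Nat.card {i // δ i = j} = Nat.card {i // ε i = j} := by
  rw [← h.finrank_eq, ← h'.finrank_eq]
  have hmap : (A j).map (e : V →ₗ[K] W) = B j := by
    ext w
    constructor
    · rintro ⟨v, hv, rfl⟩; exact (he j v).1 hv
    · intro hw
      exact ⟨e.symm w, (he j _).2 (by simpa using hw), by simp⟩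
  rw [← hmap]
  exact (e.submoduleMap (A j)).finrank_eq

end GradedBasis

/-! ### Leading monomials and Hilbert functions -/

section Leading

variable {K : Type*} [Field K] {n : ℕ}

/-- The exponents of the leading monomials of the nonzero elements of `I`. -/
def initExps (I : Ideal (MvPolynomial (Fin n) K)) : Set (Fin n →₀ ℕ) :=
  {u | ∃ f ∈ I, f ≠ 0 ∧ MonomialOrder.lex.degree f = u}

/-- The graded pieces of `I`, as subspaces of `I`. -/
def gradedPart (I : Ideal (MvPolynomial (Fin n) K)) (j : ℕ) :
    Submodule K ↥(I.restrictScalars K) :=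
  (homogeneousSubmodule (Fin n) K j).comap (I.restrictScalars K).subtype

lemma hilbertFunction_eq_finrank (I : Ideal (MvPolynomial (Fin n) K)) (j : ℕ) :
    hilbertFunction I j = Module.finrank K (gradedPart I j) := by
  rw [hilbertFunction, gradedPart, ← Submodule.map_comap_subtype,
    Submodule.finrank_map_subtype_eq]

lemma IsGradedIdeal.homogeneousComponent_mem {I : Ideal (MvPolynomial (Fin n) K)}
    (hI : IsGradedIdeal I) {f : MvPolynomial (Fin n) K} (hf : f ∈ I) (i : ℕ) :
    homogeneousComponent i f ∈ I := by
  have := hI i hf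
  rwa [← decomposition.decompose'_apply]

/-- The lex order does not refine degree, so `f` itself need not be homogeneous. Its component in
the degree of the leading monomial still contains that monomial and introduces no other monomials.
-/
lemma exists_homogeneous_of_mem_initExps {I : Ideal (MvPolynomial (Fin n) K)}
    (hI : IsGradedIdeal I) {u : Fin n →₀ ℕ} (hu : u ∈ initExps I) :
    ∃ f ∈ I, f ∈ homogeneousSubmodule (Fin n) K u.degree ∧ f ≠ 0 ∧
      MonomialOrder.lex.degree f = u := by
  obtain ⟨f, hf, hf0, rfl⟩ := hu
  set u := MonomialOrder.lex.degree f
  have hc : coeff u (homogeneousComponent u.degree f) = coeff u f := by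
    rw [coeff_homogeneousComponent, if_pos rfl]
  have hcu : coeff u f ≠ 0 := MonomialOrder.lex.coeff_degree_ne_zero_iff.2 hf0
  refine ⟨homogeneousComponent u.degree f, hI.homogeneousComponent_mem hf _,
    homogeneousComponent_isHomogeneous _ _, ?_, ?_⟩
  · intro h
    rw [h, coeff_zero] at hc
    exact hcu hc.symm
  · apply MonomialOrder.lex.toSyn.injective
    refine le_antisymm ?_ (MonomialOrder.lex.le_degree (by rw [mem_support_iff, hc]; exact hcu))
    refine MonomialOrder.degree_le_degree_of_support_subset fun v hv => ?_
    rw [mem_support_iff, coeff_homogeneousComponent] at hv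
    rw [mem_support_iff]
    exact fun h => hv (by rw [h, ite_self])

lemma linearIndependent_of_degree_eq {E : Set (Fin n →₀ ℕ)} {g : E → MvPolynomial (Fin n) K}
    (h0 : ∀ u, g u ≠ 0) (hg : ∀ u, MonomialOrder.lex.degree (g u) = u) :
    LinearIndependent K g := by
  classical
  rw [linearIndependent_iff']
  intro s c hsum
  by_contra! hcon
  obtain ⟨i, hi, hci⟩ := hcon
  obtain ⟨p, hp, hmax⟩ := Finset.exists_max_image (s.filter fun i => c i ≠ 0)
    (fun i => MonomialOrder.lex.toSyn (i : Fin n →₀ ℕ)) ⟨i, Finset.mem_filter.2 ⟨hi, hci⟩⟩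
  rw [Finset.mem_filter] at hp
  have h := congrArg (coeff (p : Fin n →₀ ℕ)) hsum
  rw [coeff_sum, coeff_zero, Finset.sum_eq_single p] at h
  · rw [coeff_smul, smul_eq_mul, mul_eq_zero] at h
    have := MonomialOrder.lex.coeff_degree_ne_zero_iff.2 (h0 p)
    rw [hg] at this
    exact h.elim hp.2 this
  · intro q hq hqp
    rw [coeff_smul]
    by_cases hcq : c q = 0
    · rw [hcq, zero_smul]
    rw [MonomialOrder.lex.coeff_eq_zero_of_lt, smul_zero]
    rw [hg]
    refine lt_of_le_of_ne (hmax q (Finset.mem_filter.2 ⟨hq, hcq⟩)) fun h => hqp ?_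
    exact Subtype.ext (MonomialOrder.lex.toSyn.injective h)
  · exact fun h => absurd hp.1 h

/-- Cancel the leading term and use well-founded induction on the leading exponent. -/
lemma mem_span_of_degree_eq {I : Ideal (MvPolynomial (Fin n) K)}
    {g : initExps I → MvPolynomial (Fin n) K} (hI : ∀ u, g u ∈ I) (h0 : ∀ u, g u ≠ 0)
    (hg : ∀ u, MonomialOrder.lex.degree (g u) = u) :
    ∀ (s : (MonomialOrder.lex (σ := Fin n)).syn) (f : MvPolynomial (Fin n) K), f ∈ I →
      MonomialOrder.lex.toSyn (MonomialOrder.lex.degree f) = s →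
      f ∈ Submodule.span K (Set.range g) := by
  intro s
  induction s using WellFoundedLT.induction with
  | ind s ih =>
    intro f hf hs
    by_cases hf0 : f = 0
    · rw [hf0]; exact Submodule.zero_mem _
    set u := MonomialOrder.lex.degree f with hu
    let p : initExps I := ⟨u, f, hf, hf0, rfl⟩
    have hgu : MonomialOrder.lex.degree (g p) = u := hg p
    have hgc : coeff u (g p) ≠ 0 := by
      have := MonomialOrder.lex.coeff_degree_ne_zero_iff.2 (h0 p)
      rwa [hgu] at this
    set c : K := coeff u f / coeff u (g p)
    have hgs : c • g p ∈ Submodule.span K (Set.range g) :=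
      Submodule.smul_mem _ _ (Submodule.subset_span ⟨p, rfl⟩)
    have hcoef : coeff u (f - c • g p) = 0 := by
      rw [coeff_sub, coeff_smul, smul_eq_mul, div_mul_cancel₀ _ hgc, sub_self]
    rw [← sub_add_cancel f (c • g p)]
    refine Submodule.add_mem _ ?_ hgs
    by_cases hd0 : f - c • g p = 0
    · rw [hd0]; exact Submodule.zero_mem _
    refine ih _ ?_ _ (I.sub_mem hf (Submodule.smul_of_tower_mem I c (hI p))) rfl
    rw [← hs]
    refine lt_of_le_of_ne ?_ fun h => ?_
    · refine MonomialOrder.lex.degree_sub_le.trans (sup_le le_rfl ?_)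
      exact MonomialOrder.lex.degree_smul_le.trans (by rw [hgu])
    · have h1 := MonomialOrder.lex.toSyn.injective h
      have := MonomialOrder.lex.coeff_degree_ne_zero_iff.2 hd0
      rw [h1] at this
      exact this hcoef

/-- One homogeneous element per leading exponent gives a basis, so the Hilbert function counts
leading exponents by degree. -/
lemma exists_gradedBasis {I : Ideal (MvPolynomial (Fin n) K)} (hI : IsGradedIdeal I) :
    ∃ b : Module.Basis (initExps I) K ↥(I.restrictScalars K),
      IsGradedBasis (gradedPart I) b fun u => (u : Fin n →₀ ℕ).degree := by
  choose g hgI hgh hg0 hg using fun u : initExps I => exists_homogeneous_of_mem_initExps hI u.2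
  let g' : initExps I → ↥(I.restrictScalars K) := fun u => ⟨g u, hgI u⟩
  have hli : LinearIndependent K g' := by
    refine LinearIndependent.of_comp (I.restrictScalars K).subtype ?_
    exact linearIndependent_of_degree_eq hg0 hg
  have hspan : ⊤ ≤ Submodule.span K (Set.range g') := by
    rintro ⟨f, hf⟩ -
    have h1 := mem_span_of_degree_eq hgI hg0 hg _ f hf rfl
    have h2 : Set.range g = (I.restrictScalars K).subtype '' Set.range g' := by
      rw [← Set.range_comp]; rfl
    rw [h2, ← Submodule.map_span] at h1
    obtain ⟨x, hx, hxf⟩ := h1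
    have : x = ⟨f, hf⟩ := Subtype.ext hxf
    rwa [← this]
  let b := Module.Basis.mk hli hspan
  have hb : ∀ u, (b u : MvPolynomial (Fin n) K) = g u := fun u => by simp [b, g']
  refine ⟨b, fun j => le_antisymm ?_ ?_⟩
  · intro f hf
    have hf' : (f : MvPolynomial (Fin n) K) ∈ homogeneousSubmodule (Fin n) K j := hf
    set S := Submodule.span K (b '' {u | (u : Fin n →₀ ℕ).degree = j}) with hS
    have h1 : (f : MvPolynomial (Fin n) K) ∈ S.map (I.restrictScalars K).subtype := by
      -- Taking the degree `j` component of the basis expansion discards all basis elements of other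
      -- degrees.
      have h2 : (f : MvPolynomial (Fin n) K) = homogeneousComponent j (f : MvPolynomial (Fin n) K) :=
        by rw [homogeneousComponent_of_mem hf', if_pos rfl]
      have h3 : (f : MvPolynomial (Fin n) K) = (b.repr f).sum fun u c => c • g u := by
        conv_lhs => rw [← b.linearCombination_repr f]
        rw [Finsupp.linearCombination_apply, Finsupp.sum, Finsupp.sum, AddSubmonoidClass.coe_finsetSum]
        simp [hb]
      rw [h2, h3, Finsupp.sum, map_sum]
      refine Submodule.sum_mem _ fun u _ => ?_
      rw [map_smul]
      refine Submodule.smul_mem _ _ ?_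
      rw [homogeneousComponent_of_mem (hgh u)]
      split_ifs with h
      · exact ⟨b u, Submodule.subset_span ⟨u, h.symm, rfl⟩, hb u⟩
      · exact Submodule.zero_mem _
    obtain ⟨x, hx, hxf⟩ := h1
    rwa [← (Subtype.ext hxf : x = f)]
  · rw [Submodule.span_le]
    rintro _ ⟨u, rfl, rfl⟩
    change (b u : MvPolynomial (Fin n) K) ∈ homogeneousSubmodule (Fin n) K _
    rw [hb]
    exact hgh u

lemma IsGradedIdeal.hilbertFunction_eq_card {I : Ideal (MvPolynomial (Fin n) K)}
    (hI : IsGradedIdeal I) (j : ℕ) :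
    hilbertFunction I j = Nat.card {u : initExps I // (u : Fin n →₀ ℕ).degree = j} := by
  obtain ⟨b, hb⟩ := exists_gradedBasis hI
  rw [hilbertFunction_eq_finrank, hb.finrank_eq]

/-! ### Monomial ideals -/

lemma IsMonomialIdeal.isGradedIdeal {J : Ideal (MvPolynomial (Fin n) K)}
    (hJ : IsMonomialIdeal J) : IsGradedIdeal J := by
  obtain ⟨A, rfl⟩ := hJ
  let _ : GradedAlgebra (homogeneousSubmodule (Fin n) K) := MvPolynomial.gradedAlgebra
  refine Ideal.homogeneous_span _ _ ?_
  rintro _ ⟨u, _, rfl⟩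
  exact ⟨u.degree, isHomogeneous_monomial _ rfl⟩

lemma monomial_mem_of_le {J : Ideal (MvPolynomial (Fin n) K)} {u v : Fin n →₀ ℕ} (huv : u ≤ v)
    (hu : monomial u (1 : K) ∈ J) : monomial v (1 : K) ∈ J := by
  obtain ⟨w, rfl⟩ := exists_add_of_le huv
  have : monomial (u + w) (1 : K) = monomial w 1 * monomial u 1 := by
    rw [monomial_mul, one_mul, add_comm]
  rw [this]
  exact J.mul_mem_left _ hu

lemma monomial_mem_span_iff {A : Set (Fin n →₀ ℕ)} {v : Fin n →₀ ℕ} :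
    monomial v (1 : K) ∈ Ideal.span ((fun u => monomial u (1 : K)) '' A) ↔
      ∃ u ∈ A, u ≤ v := by
  rw [mem_ideal_span_monomial_image]
  simp

lemma IsMonomialIdeal.monomial_mem {J : Ideal (MvPolynomial (Fin n) K)} (hJ : IsMonomialIdeal J)
    {f : MvPolynomial (Fin n) K} (hf : f ∈ J) {u : Fin n →₀ ℕ} (hu : u ∈ f.support) :
    monomial u (1 : K) ∈ J := by
  obtain ⟨A, rfl⟩ := hJ
  rw [monomial_mem_span_iff]
  exact mem_ideal_span_monomial_image.1 hf u hu

/-- The exponents of the monomials in `J`. -/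
def exps (J : Ideal (MvPolynomial (Fin n) K)) : Set (Fin n →₀ ℕ) :=
  {u | monomial u (1 : K) ∈ J}

lemma exps_subset_initExps (J : Ideal (MvPolynomial (Fin n) K)) : exps J ⊆ initExps J := by
  classical
  intro u hu
  exact ⟨_, hu, by simp, by rw [MonomialOrder.degree_monomial, if_neg one_ne_zero]⟩

lemma IsMonomialIdeal.initExps_eq {J : Ideal (MvPolynomial (Fin n) K)} (hJ : IsMonomialIdeal J) :
    initExps J = exps J := by
  refine Set.Subset.antisymm ?_ (exps_subset_initExps J)
  rintro u ⟨f, hf, hf0, rfl⟩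
  exact hJ.monomial_mem hf (MonomialOrder.lex.degree_mem_support hf0)

lemma IsMonomialIdeal.hilbertFunction_eq {J : Ideal (MvPolynomial (Fin n) K)}
    (hJ : IsMonomialIdeal J) (j : ℕ) :
    hilbertFunction J j = Nat.card {u : exps J // (u : Fin n →₀ ℕ).degree = j} := by
  rw [hJ.isGradedIdeal.hilbertFunction_eq_card, hJ.initExps_eq]

lemma IsMonomialIdeal.eq_of_exps_eq {J J' : Ideal (MvPolynomial (Fin n) K)}
    (hJ : IsMonomialIdeal J) (hJ' : IsMonomialIdeal J') (h : exps J = exps J') : J = J' := by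
  have key : ∀ J J' : Ideal (MvPolynomial (Fin n) K), IsMonomialIdeal J → exps J = exps J' →
      J ≤ J' := by
    rintro J J' ⟨A, rfl⟩ h
    rw [Ideal.span_le]
    rintro _ ⟨u, hu, rfl⟩
    have : u ∈ exps J' := by
      rw [← h]; exact Ideal.subset_span ⟨u, hu, rfl⟩
    exact this
  exact le_antisymm (key _ _ hJ h) (key _ _ hJ' h.symm)

lemma lexInitialIdeal_eq (I : Ideal (MvPolynomial (Fin n) K)) :
    lexInitialIdeal I = Ideal.span ((fun u => monomial u (1 : K)) '' initExps I) := by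
  rw [lexInitialIdeal]
  congr 1
  ext p
  constructor
  · rintro ⟨f, hf, hf0, rfl⟩; exact ⟨_, ⟨f, hf, hf0, rfl⟩, rfl⟩
  · rintro ⟨_, ⟨f, hf, hf0, rfl⟩, rfl⟩; exact ⟨f, hf, hf0, rfl⟩

lemma isMonomialIdeal_lexInitialIdeal (I : Ideal (MvPolynomial (Fin n) K)) :
    IsMonomialIdeal (lexInitialIdeal I) := ⟨_, lexInitialIdeal_eq I⟩

lemma mem_initExps_of_le {I : Ideal (MvPolynomial (Fin n) K)} {u v : Fin n →₀ ℕ} (huv : u ≤ v)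
    (hu : u ∈ initExps I) : v ∈ initExps I := by
  classical
  obtain ⟨f, hf, hf0, rfl⟩ := hu
  obtain ⟨w, rfl⟩ := exists_add_of_le huv
  have hw : monomial w (1 : K) ≠ 0 := by simp
  refine ⟨f * monomial w 1, I.mul_mem_right _ hf, mul_ne_zero hf0 hw, ?_⟩
  rw [MonomialOrder.lex.degree_mul hf0 hw, MonomialOrder.degree_monomial, if_neg one_ne_zero]

lemma exps_lexInitialIdeal (I : Ideal (MvPolynomial (Fin n) K)) :
    exps (lexInitialIdeal I) = initExps I := by
  ext v
  rw [exps, Set.mem_ofPred_eq, lexInitialIdeal_eq, monomial_mem_span_iff]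
  exact ⟨fun ⟨u, hu, huv⟩ => mem_initExps_of_le huv hu, fun h => ⟨v, h, le_rfl⟩⟩

theorem hilbertFunction_lexInitialIdeal {I : Ideal (MvPolynomial (Fin n) K)}
    (hI : IsGradedIdeal I) (i : ℕ) :
    hilbertFunction (lexInitialIdeal I) i = hilbertFunction I i := by
  rw [(isMonomialIdeal_lexInitialIdeal I).hilbertFunction_eq, exps_lexInitialIdeal,
    hI.hilbertFunction_eq_card]

end Leading

/-! ### Counting monomials -/

lemma finite_degree_eq (σ : Type*) [Finite σ] (j : ℕ) : Finite {u : σ →₀ ℕ // u.degree = j} := by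
  classical
  have := Fintype.ofFinite σ
  refine Set.Finite.subset (s := (Finset.finsuppAntidiag (Finset.univ : Finset σ) j))
    (Finset.finite_toSet _) fun u hu => ?_
  rw [Finset.mem_coe, Finset.mem_finsuppAntidiag]
  exact ⟨by rw [← Finsupp.degree_eq_sum]; exact hu, Finset.subset_univ _⟩

lemma coeff_geom_pow_card {σ : Type*} [DecidableEq σ] (s : Finset σ) (j : ℕ) :
    PowerSeries.coeff j (geom ^ s.card) = (Finset.finsuppAntidiag s j).card := by
  rw [← Finset.prod_const, PowerSeries.coeff_prod]
  simp

lemma card_degree_eq (σ : Type*) [Fintype σ] (j : ℕ) :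
    (Nat.card {u : σ →₀ ℕ // u.degree = j} : ℤ) =
      PowerSeries.coeff j (geom ^ Fintype.card σ) := by
  classical
  rw [← Finset.card_univ, coeff_geom_pow_card, ← Nat.card_eq_finsetCard]
  congr 1
  refine Nat.card_congr (Equiv.subtypeEquivRight fun u => ?_)
  rw [Finset.mem_finsuppAntidiag, ← Finsupp.degree_eq_sum]
  simp

/-! ### Hilbert decompositions -/

section Decomposition

variable {K : Type*} [Field K] {n : ℕ}

lemma mem_shiftedPart_iff {Z : Finset (Fin n)} {s j : ℕ} {f : MvPolynomial Z K} :
    f ∈ shiftedPart K Z s j ↔ ∀ u ∈ f.support, s + u.degree = j := by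
  rw [shiftedPart]
  split_ifs with h
  · rw [homogeneousSubmodule_eq_finsupp_supported, AddMonoidAlgebra.mem_supported]
    constructor
    · intro hf u hu
      have : u.degree = j - s := hf hu
      omega
    · intro hf u hu
      have := hf u hu
      change u.degree = j - s
      omega
  · rw [Submodule.mem_bot]
    constructor
    · rintro rfl; simp
    · intro hf
      by_contra h0
      obtain ⟨u, hu⟩ := support_nonempty.2 h0
      have := hf u hu
      omega

/-- The degree `j` part of `⨁ K[Z_k](-s_k)`. -/
def sumPart (K : Type*) [Field K] {r : ℕ} (s : Fin r → ℕ) (Z : Fin r → Finset (Fin n)) (j : ℕ) :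
    Submodule K (∀ k : Fin r, MvPolynomial (Z k) K) :=
  Submodule.pi Set.univ fun k => shiftedPart K (Z k) (s k) j

lemma mem_sumPart {r : ℕ} {s : Fin r → ℕ} {Z : Fin r → Finset (Fin n)} {j : ℕ}
    {w : ∀ k : Fin r, MvPolynomial (Z k) K} :
    w ∈ sumPart K s Z j ↔ ∀ k, w k ∈ shiftedPart K (Z k) (s k) j := by
  simp [sumPart, Submodule.mem_pi]

lemma isGradedBasis_sumPart {r : ℕ} (s : Fin r → ℕ) (Z : Fin r → Finset (Fin n)) :
    IsGradedBasis (sumPart K s Z) (Pi.basis fun k => basisMonomials (Z k) K)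
      fun p => s p.1 + p.2.degree := by
  intro j
  ext w
  rw [mem_sumPart, Module.Basis.mem_span_image]
  have hrepr : ∀ k u, (Pi.basis fun k => basisMonomials (Z k) K).repr w ⟨k, u⟩ = coeff u (w k) :=
    fun k u => by rw [Pi.basis_repr]; rfl
  constructor
  · rintro h ⟨k, u⟩ hu
    rw [Finset.mem_coe, Finsupp.mem_support_iff, hrepr] at hu
    exact mem_shiftedPart_iff.1 (h k) u (mem_support_iff.2 hu)
  · intro h k
    rw [mem_shiftedPart_iff]
    intro u hu
    refine h (a := ⟨k, u⟩) ?_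
    rw [Finset.mem_coe, Finsupp.mem_support_iff, hrepr]
    exact mem_support_iff.1 hu

lemma finite_sumPart {r : ℕ} (s : Fin r → ℕ) (Z : Fin r → Finset (Fin n)) (j : ℕ) :
    Finite {p : Σ k : Fin r, Z k →₀ ℕ // s p.1 + p.2.degree = j} := by
  have := fun k : Fin r => finite_degree_eq (Z k) (j - s k)
  refine Finite.of_injective
    (β := Σ k : Fin r, {u : Z k →₀ ℕ // u.degree = j - s k})
    (fun p => ⟨p.1.1, p.1.2, by have := p.2; omega⟩) ?_
  rintro ⟨⟨k, u⟩, h⟩ ⟨⟨k', u'⟩, h'⟩ heq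
  simp only [Sigma.mk.injEq] at heq
  obtain ⟨rfl, heq⟩ := heq
  simpa using heq

lemma card_sumPart {r : ℕ} (s : Fin r → ℕ) (Z : Fin r → Finset (Fin n)) (j : ℕ) :
    (Nat.card {p : Σ k : Fin r, Z k →₀ ℕ // s p.1 + p.2.degree = j} : ℤ) =
      PowerSeries.coeff j (∑ k, PowerSeries.X ^ s k * geom ^ (Z k).card) := by
  have e : {p : Σ k : Fin r, Z k →₀ ℕ // s p.1 + p.2.degree = j} ≃
      Σ k : Fin r, {u : Z k →₀ ℕ // s k + u.degree = j} :=
    { toFun := fun p => ⟨p.1.1, p.1.2, p.2⟩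
      invFun := fun p => ⟨⟨p.1, p.2.1⟩, p.2.2⟩
      left_inv := fun _ => rfl
      right_inv := fun _ => rfl }
  have hfin : ∀ k : Fin r, Finite {u : Z k →₀ ℕ // s k + u.degree = j} := fun k => by
    have := finite_degree_eq (Z k) (j - s k)
    exact Finite.of_injective (β := {u : Z k →₀ ℕ // u.degree = j - s k})
      (fun u => ⟨u.1, by have := u.2; omega⟩) fun u u' h => by simpa [Subtype.ext_iff] using h
  rw [Nat.card_congr e, Nat.card_sigma, map_sum, Nat.cast_sum]
  refine Finset.sum_congr rfl fun k _ => ?_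
  rw [PowerSeries.coeff_X_pow_mul']
  split_ifs with h
  · have := card_degree_eq (Z k) (j - s k)
    rw [Fintype.card_coe] at this
    rw [← this]
    congr 1
    exact Nat.card_congr (Equiv.subtypeEquivRight fun u => by omega)
  · have : IsEmpty {u : Z k →₀ ℕ // s k + u.degree = j} := ⟨fun u => by have := u.2; omega⟩
    simp

lemma IsGradedIdeal.coeff_hilbertSeries {I : Ideal (MvPolynomial (Fin n) K)}
    (hI : IsGradedIdeal I) (j : ℕ) :
    PowerSeries.coeff j (hilbertSeries I) =
      (Nat.card {u : initExps I // (u : Fin n →₀ ℕ).degree = j} : ℤ) := by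
  rw [hilbertSeries, PowerSeries.coeff_mk, hI.hilbertFunction_eq_card]

lemma IsGradedIdeal.hilbertFunction_ne_zero_iff {I : Ideal (MvPolynomial (Fin n) K)}
    (hI : IsGradedIdeal I) (j : ℕ) :
    hilbertFunction I j ≠ 0 ↔ ∃ u ∈ initExps I, u.degree = j := by
  have hfin := finite_degree_eq (Fin n) j
  have : Finite {v : initExps I // (v : Fin n →₀ ℕ).degree = j} :=
    Finite.of_injective (β := {v : Fin n →₀ ℕ // v.degree = j})
      (fun v => ⟨v.1.1, v.2⟩) fun v v' h => by simpa [Subtype.ext_iff] using h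
  rw [hI.hilbertFunction_eq_card, Nat.card_ne_zero, and_iff_left this]
  exact ⟨fun ⟨u⟩ => ⟨u.1, u.1.2, u.2⟩, fun ⟨u, hu, h⟩ => ⟨⟨⟨u, hu⟩, h⟩⟩⟩

lemma IsGradedIdeal.exists_hilbertFunction_ne_zero {I : Ideal (MvPolynomial (Fin n) K)}
    (hI : IsGradedIdeal I) (hbot : I ≠ ⊥) : ∃ j, hilbertFunction I j ≠ 0 := by
  obtain ⟨f, hf, hf0⟩ := Submodule.exists_mem_ne_zero_of_ne_bot hbot
  exact ⟨_, (hI.hilbertFunction_ne_zero_iff _).2 ⟨_, ⟨f, hf, hf0, rfl⟩, rfl⟩⟩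

lemma HilbertDecomposition.hilbertSeries_eq {I : Ideal (MvPolynomial (Fin n) K)}
    (hI : IsGradedIdeal I) (D : HilbertDecomposition I) :
    hilbertSeries I = ∑ k, PowerSeries.X ^ D.s k * geom ^ (D.Z k).card := by
  ext j
  obtain ⟨b, hb⟩ := exists_gradedBasis hI
  rw [hI.coeff_hilbertSeries, ← card_sumPart, hb.card_eq_of_equiv
    (isGradedBasis_sumPart D.s D.Z) D.iso fun j v => (D.graded j v).trans mem_sumPart.symm]

/-- Equality of series is equality of dimensions in each degree, and these are finite; the graded
bases can then be matched. -/
lemma exists_hilbertDecomposition {I : Ideal (MvPolynomial (Fin n) K)} (hI : IsGradedIdeal I)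
    {r : ℕ} (s : Fin r → ℕ) (Z : Fin r → Finset (Fin n))
    (h : hilbertSeries I = ∑ k, PowerSeries.X ^ s k * geom ^ (Z k).card) :
    ∃ D : HilbertDecomposition I, D.depth = ⨅ k, (Z k).card := by
  obtain ⟨b, hb⟩ := exists_gradedBasis hI
  obtain ⟨e, he⟩ := hb.exists_equiv (isGradedBasis_sumPart (K := K) s Z)
    (fun j => by
      have := finite_degree_eq (Fin n) j
      exact Finite.of_injective (β := {u : Fin n →₀ ℕ // u.degree = j})
        (fun u => ⟨u.1.1, u.2⟩) fun u u' h => by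
          simpa [Subtype.ext_iff] using h)
    (finite_sumPart s Z)
    (fun j => by
      have := hI.coeff_hilbertSeries j
      rw [h, ← card_sumPart] at this
      exact_mod_cast this.symm)
  exact ⟨⟨r, s, Z, e, fun j f => (he j f).trans mem_sumPart⟩, rfl⟩

lemma HilbertDecomposition.r_pos {I : Ideal (MvPolynomial (Fin n) K)} (hbot : I ≠ ⊥)
    (D : HilbertDecomposition I) : 0 < D.r := by
  rw [Nat.pos_iff_ne_zero]
  intro h0
  have : IsEmpty (Fin D.r) := by rw [h0]; infer_instance
  refine hbot ((Submodule.eq_bot_iff _).2 fun f hf => ?_)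
  have : (⟨f, hf⟩ : ↥(I.restrictScalars K)) = 0 := D.iso.injective (Subsingleton.elim _ _)
  exact congrArg Subtype.val this

lemma one_sub_pow_mul_geom_pow {z n : ℕ} (h : z ≤ n) :
    (1 - PowerSeries.X) ^ n * geom ^ z = (1 - PowerSeries.X) ^ (n - z) := by
  obtain ⟨c, rfl⟩ := Nat.exists_eq_add_of_le h
  rw [Nat.add_sub_cancel_left, pow_add]
  calc _ = (1 - PowerSeries.X) ^ c * (geom ^ z * (1 - PowerSeries.X) ^ z) := by ring
    _ = _ := by rw [geom_pow_mul, mul_one]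

lemma HilbertDecomposition.mem_cone {I : Ideal (MvPolynomial (Fin n) K)} (hI : IsGradedIdeal I)
    (D : HilbertDecomposition I) {Q : Polynomial ℤ}
    (hQ : (Q : PowerSeries ℤ) = (1 - PowerSeries.X) ^ n * hilbertSeries I) :
    Q ∈ cone (n - D.depth) := by
  have h : Q = ∑ k, Polynomial.X ^ D.s k * (1 - Polynomial.X) ^ (n - (D.Z k).card) := by
    apply Polynomial.coe_injective ℤ
    rw [hQ, D.hilbertSeries_eq hI, coe_finsetSum, Finset.mul_sum]
    refine Finset.sum_congr rfl fun k _ => ?_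
    push_cast
    rw [mul_left_comm, one_sub_pow_mul_geom_pow (card_finset_fin_le _)]
  rw [h]
  refine sum_mem fun k _ => mem_cone_of_le _ (Nat.sub_le_sub_left ?_ n)
  exact ciInf_le (OrderBot.bddBelow _) k

lemma HilbertDecomposition.depth_le {I : Ideal (MvPolynomial (Fin n) K)} (hbot : I ≠ ⊥)
    (D : HilbertDecomposition I) : D.depth ≤ n :=
  (ciInf_le (OrderBot.bddBelow _) ⟨0, D.r_pos hbot⟩).trans (card_finset_fin_le _)

/-- A representation of `Q` in the cone is read as a decomposition: the generator `t^s(1-t)^e`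
becomes `K[Z](-s)` with any `Z` of size `n - e`. -/
lemma exists_le_depth {I : Ideal (MvPolynomial (Fin n) K)} (hI : IsGradedIdeal I) (hbot : I ≠ ⊥)
    {Q : Polynomial ℤ} (hQ : (Q : PowerSeries ℤ) = (1 - PowerSeries.X) ^ n * hilbertSeries I)
    {q : ℕ} (hq : q ≤ n) (hc : Q ∈ cone q) : ∃ D : HilbertDecomposition I, n - q ≤ D.depth := by
  obtain ⟨l, hl, hsum⟩ := AddSubmonoid.exists_list_of_mem_closure hc
  choose s e he hse using fun k : Fin l.length => hl (l.get k) (l.get_mem k)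
  have hZ : ∀ k, ∃ Z : Finset (Fin n), Z.card = n - e k := fun k => by
    obtain ⟨Z, _, hZ⟩ := Finset.exists_subset_card_eq (s := (Finset.univ : Finset (Fin n)))
      (n := n - e k) (by simp)
    exact ⟨Z, hZ⟩
  choose Z hZ using hZ
  have hQs : Q = ∑ k, Polynomial.X ^ s k * (1 - Polynomial.X) ^ e k := by
    rw [← hsum, ← Fin.sum_univ_getElem]
    exact Finset.sum_congr rfl fun k _ => hse k
  obtain ⟨D, hD⟩ := exists_hilbertDecomposition hI s Z (by
    have h1 : hilbertSeries I = geom ^ n * (Q : PowerSeries ℤ) := by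
      rw [hQ, ← mul_assoc, geom_pow_mul, one_mul]
    rw [h1, hQs, coe_finsetSum, Finset.mul_sum]
    refine Finset.sum_congr rfl fun k _ => ?_
    push_cast
    rw [hZ, mul_left_comm]
    congr 1
    have hen := (he k).trans hq
    calc geom ^ n * (1 - PowerSeries.X) ^ e k
        = geom ^ (n - e k) * (geom ^ e k * (1 - PowerSeries.X) ^ e k) := by
          rw [← mul_assoc, ← pow_add, Nat.sub_add_cancel hen]
      _ = _ := by rw [geom_pow_mul, mul_one])
  refine ⟨D, ?_⟩
  rw [hD]
  -- An empty infimum in `ℕ` is `0`, so at least one summand is needed; without any, `Q` and the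
  -- Hilbert function would vanish.
  have : Nonempty (Fin l.length) := by
    by_contra hemp
    rw [not_nonempty_iff] at hemp
    have h0 : Q = 0 := by rw [hQs]; exact Finset.sum_of_isEmpty _
    obtain ⟨j, hj⟩ := hI.exists_hilbertFunction_ne_zero hbot
    have h1 : PowerSeries.coeff j (hilbertSeries I) = 0 := by
      rw [← one_mul (hilbertSeries I), ← geom_pow_mul n, mul_assoc, ← hQ, h0]
      simp
    rw [hilbertSeries, PowerSeries.coeff_mk] at h1
    exact hj (by exact_mod_cast h1)
  exact le_ciInf fun k => by rw [hZ]; exact Nat.sub_le_sub_left (he k) n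

theorem isGreatest_hdepthSet {I : Ideal (MvPolynomial (Fin n) K)} (hI : IsGradedIdeal I)
    (hbot : I ≠ ⊥) {Q : Polynomial ℤ}
    (hQ : (Q : PowerSeries ℤ) = (1 - PowerSeries.X) ^ n * hilbertSeries I)
    {q : ℕ} (hq : q ≤ n) (hc : Q ∈ cone q) (hmin : ∀ q' < q, Q ∉ cone q') :
    IsGreatest (hdepthSet I) (n - q) := by
  have hle : ∀ D : HilbertDecomposition I, D.depth ≤ n - q := fun D => by
    have h1 := D.depth_le hbot
    have h2 : ¬ n - D.depth < q := fun h => hmin _ h (D.mem_cone hI hQ)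
    omega
  refine ⟨?_, ?_⟩
  · obtain ⟨D, hD⟩ := exists_le_depth hI hbot hQ hq hc
    exact ⟨D, le_antisymm (hle D) hD⟩
  · rintro _ ⟨D, rfl⟩
    exact hle D

theorem hdepth_eq {I : Ideal (MvPolynomial (Fin n) K)} (hI : IsGradedIdeal I)
    (hbot : I ≠ ⊥) {Q : Polynomial ℤ}
    (hQ : (Q : PowerSeries ℤ) = (1 - PowerSeries.X) ^ n * hilbertSeries I)
    {q : ℕ} (hq : q ≤ n) (hc : Q ∈ cone q) (hmin : ∀ q' < q, Q ∉ cone q') :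
    hdepth I = n - q :=
  (isGreatest_hdepthSet hI hbot hQ hq hc hmin).csSup_eq

end Decomposition

/-! ### Existence and uniqueness of the lex ideal with a given Hilbert function -/

section LexIdeal

variable {K : Type*} [Field K] {n : ℕ}

open Classical in
/-- The monomials of degree `d` in `J`. -/
def degSet (J : Ideal (MvPolynomial (Fin n) K)) (d : ℕ) : Finset (Fin n → ℕ) :=
  (mons n d).filter fun u => Finsupp.equivFunOnFinite.symm u ∈ exps J

lemma mem_degSet {J : Ideal (MvPolynomial (Fin n) K)} {d : ℕ} {u : Fin n → ℕ} :
    u ∈ degSet J d ↔ ∑ i, u i = d ∧ Finsupp.equivFunOnFinite.symm u ∈ exps J := by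
  simp [degSet]

lemma coe_mem_degSet {J : Ideal (MvPolynomial (Fin n) K)} {d : ℕ} {u : Fin n →₀ ℕ} :
    (u : Fin n → ℕ) ∈ degSet J d ↔ u.degree = d ∧ u ∈ exps J := by
  rw [mem_degSet, Finsupp.degree_eq_sum, Finsupp.equivFunOnFinite_symm_coe]

lemma degSet_subset (J : Ideal (MvPolynomial (Fin n) K)) (d : ℕ) : degSet J d ⊆ mons n d :=
  fun _ hu => mem_mons.2 (mem_degSet.1 hu).1

lemma IsMonomialIdeal.hilbertFunction_eq_card_degSet {J : Ideal (MvPolynomial (Fin n) K)}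
    (hJ : IsMonomialIdeal J) (d : ℕ) : hilbertFunction J d = (degSet J d).card := by
  rw [hJ.hilbertFunction_eq, ← Nat.card_eq_finsetCard]
  refine Nat.card_congr
    { toFun := fun u => ⟨u.1.1, coe_mem_degSet.2 ⟨u.2, u.1.2⟩⟩
      invFun := fun u => ⟨⟨Finsupp.equivFunOnFinite.symm u.1, (mem_degSet.1 u.2).2⟩, by
        rw [Finsupp.degree_eq_sum]; exact (mem_degSet.1 u.2).1⟩
      left_inv := fun u => by ext; rfl
      right_inv := fun u => by ext; rfl }

lemma toLex_lt_iff_lexLT {u v : Fin n →₀ ℕ} : toLex u < toLex v ↔ lexLT u v := Iff.rfl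

lemma IsLexIdeal.isSeg_degSet {J : Ideal (MvPolynomial (Fin n) K)} (hJ : IsLexIdeal J) (d : ℕ) :
    IsSeg d (degSet J d) := by
  refine ⟨degSet_subset J d, fun u hu v hv huv => ?_⟩
  rw [mem_degSet] at hu ⊢
  rw [mem_mons] at hv
  refine ⟨hv, hJ.2 _ _ hu.2 ?_ huv⟩
  rw [Finsupp.degree_eq_sum, Finsupp.degree_eq_sum]
  exact hv.trans hu.1.symm

/-- A segment is determined by its degree and its size. -/
lemma IsLexIdeal.eq_of_hilbertFunction_eq {J J' : Ideal (MvPolynomial (Fin n) K)}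
    (hJ : IsLexIdeal J) (hJ' : IsLexIdeal J')
    (h : ∀ i, hilbertFunction J i = hilbertFunction J' i) : J = J' := by
  refine hJ.1.eq_of_exps_eq hJ'.1 ?_
  ext u
  have hc : (degSet J u.degree).card = (degSet J' u.degree).card := by
    rw [← hJ.1.hilbertFunction_eq_card_degSet, ← hJ'.1.hilbertFunction_eq_card_degSet, h]
  have heq : degSet J u.degree = degSet J' u.degree :=
    Finset.eq_of_subset_of_card_le
      ((hJ.isSeg_degSet _).subset_of_card_le (hJ'.isSeg_degSet _) hc.le) hc.ge
  have h1 := coe_mem_degSet (J := J) (d := u.degree) (u := u)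
  rw [heq, coe_mem_degSet] at h1
  simpa using h1.symm

lemma shadow_degSet_subset (J : Ideal (MvPolynomial (Fin n) K)) (d : ℕ) :
    shadow (degSet J d) ⊆ degSet J (d + 1) := by
  intro w hw
  obtain ⟨u, hu, i, rfl⟩ := mem_shadow.1 hw
  have hmem := shadow_subset (degSet_subset J d) (add_single_mem_shadow hu i)
  rw [mem_mons] at hmem
  rw [mem_degSet] at hu ⊢
  refine ⟨hmem, monomial_mem_of_le ?_ hu.2⟩
  intro j
  simp

lemma isUpperSet_of_shadow_subset {F : ℕ → Finset (Fin n → ℕ)}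
    (hF : ∀ d, shadow (F d) ⊆ F (d + 1)) {u : Fin n →₀ ℕ} (hu : (u : Fin n → ℕ) ∈ F u.degree) :
    ∀ (k : ℕ) (v : Fin n →₀ ℕ), v.degree = u.degree + k → u ≤ v →
      (v : Fin n → ℕ) ∈ F v.degree := by
  intro k
  induction k with
  | zero =>
    intro v hv huv
    obtain ⟨w, rfl⟩ := exists_add_of_le huv
    rw [map_add, add_right_inj, Finsupp.degree_eq_zero_iff] at hv
    rwa [hv, add_zero]
  | succ k ih =>
    intro v hv huv
    obtain ⟨w, rfl⟩ := exists_add_of_le huv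
    rw [map_add, add_right_inj] at hv
    have hw : w ≠ 0 := by rintro rfl; simp at hv
    obtain ⟨i, hi⟩ := Finsupp.ne_iff.1 hw
    obtain ⟨w, rfl⟩ : ∃ w', w = w' + Finsupp.single i 1 := by
      refine ⟨w - Finsupp.single i 1, (tsub_add_cancel_of_le ?_).symm⟩
      rw [Finsupp.single_le_iff]
      exact Nat.pos_of_ne_zero hi
    rw [map_add, Finsupp.degree_single] at hv
    have h1 := ih (u + w) (by rw [map_add]; omega) le_self_add
    have h2 := hF _ (add_single_mem_shadow h1 i)
    rw [← add_assoc, map_add, Finsupp.degree_single]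
    convert h2 using 1
    ext j
    simp [Finsupp.single_apply, Pi.single_apply, eq_comm]

/-- Take in each degree the segment of the prescribed size. Macaulay's bound says that the shadow of
one segment fits into the next, so together they are the monomials of an ideal. -/
theorem exists_isLexIdeal {J : Ideal (MvPolynomial (Fin n) K)} (hJ : IsMonomialIdeal J) :
    ∃ L : Ideal (MvPolynomial (Fin n) K), IsLexIdeal L ∧
      ∀ i, hilbertFunction L i = hilbertFunction J i := by
  choose F hF hFc using fun d => exists_isSeg n d _ (Finset.card_le_card (degSet_subset J d))
  have hsh : ∀ d, shadow (F d) ⊆ F (d + 1) := by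
    intro d
    refine (hF d).shadow.subset_of_card_le (hF (d + 1)) ?_
    rw [hFc (d + 1)]
    exact (macaulayBound n d _ _ (degSet_subset J d) (hF d) (hFc d).le).trans
      (Finset.card_le_card (shadow_degSet_subset J d))
  set A : Set (Fin n →₀ ℕ) := {u | (u : Fin n → ℕ) ∈ F u.degree} with hA
  set L : Ideal (MvPolynomial (Fin n) K) := Ideal.span ((fun u => monomial u (1 : K)) '' A) with hL
  have hmon : IsMonomialIdeal L := ⟨A, rfl⟩
  have hexp : ∀ v, v ∈ exps L ↔ (v : Fin n → ℕ) ∈ F v.degree := by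
    intro v
    change monomial v (1 : K) ∈ L ↔ _
    rw [hL, monomial_mem_span_iff]
    constructor
    · rintro ⟨u, hu, huv⟩
      refine isUpperSet_of_shadow_subset hsh hu (v.degree - u.degree) v ?_ huv
      have := Finsupp.degree_mono huv
      omega
    · exact fun h => ⟨v, h, le_rfl⟩
  refine ⟨L, ⟨hmon, fun u v hu hd huv => ?_⟩, fun i => ?_⟩
  · have hu' := (hexp u).1 hu
    refine (hexp v).2 ?_
    rw [hd]
    exact (hF _).mem_of_lt u hu' v (by rw [mem_mons, ← Finsupp.degree_eq_sum, hd]) huv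
  · rw [hmon.hilbertFunction_eq_card_degSet, hJ.hilbertFunction_eq_card_degSet, ← hFc]
    congr 1
    ext u
    rw [mem_degSet, hexp, Finsupp.degree_eq_sum]
    constructor
    · rintro ⟨rfl, h⟩; exact h
    · intro h
      have := mem_mons.1 ((hF i).subset h)
      exact ⟨this, by
        rw [show ∑ j, Finsupp.equivFunOnFinite.symm u j = i from this]; exact h⟩

theorem existsUnique_isLexIdeal {I : Ideal (MvPolynomial (Fin n) K)} (hI : IsGradedIdeal I) :
    ∃! L : Ideal (MvPolynomial (Fin n) K), IsLexIdeal L ∧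
      ∀ i, hilbertFunction L i = hilbertFunction I i := by
  obtain ⟨L, hL, h⟩ := exists_isLexIdeal (isMonomialIdeal_lexInitialIdeal I)
  refine ⟨L, ⟨hL, fun i => by rw [h, hilbertFunction_lexInitialIdeal hI]⟩, ?_⟩
  rintro L' ⟨hL', h'⟩
  exact hL'.eq_of_hilbertFunction_eq hL fun i => by rw [h', h, hilbertFunction_lexInitialIdeal hI]

end LexIdeal

/-! ### Minimal generators -/

section MinGens

variable {K : Type*} [Field K] {n : ℕ}

lemma exists_minGens_le {J : Ideal (MvPolynomial (Fin n) K)} {w : Fin n →₀ ℕ} (hw : w ∈ exps J) :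
    ∃ u ∈ minGens J, u ≤ w := by
  obtain ⟨u, huw, hu⟩ := exists_minimal_le_of_wellFoundedLT (· ∈ exps J) w hw
  exact ⟨u, ⟨hu.1, fun v hv hvJ => le_antisymm hv (hu.2 hvJ hv)⟩, huw⟩

lemma finite_minGens (J : Ideal (MvPolynomial (Fin n) K)) : (minGens J).Finite := by
  exact WellQuasiOrderedLE.finite_of_isAntichain fun u hu v hv huv h => huv (hv.2 u h hu.1)

end MinGens

/-! ### Monomials as sorted words -/

/-- The increasing list of the indices (from `0`) of the variables of a monomial. -/
def word {n : ℕ} (u : Fin n →₀ ℕ) : List ℕ :=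
  (List.finRange n).flatMap fun i => List.replicate (u i) (i : ℕ)

/-- The monomial with a given list of indices. -/
def ofWord (n : ℕ) (l : List ℕ) : Fin n →₀ ℕ :=
  Finsupp.equivFunOnFinite.symm fun i => l.count (i : ℕ)

@[simp] lemma ofWord_apply {n : ℕ} (l : List ℕ) (i : Fin n) : ofWord n l i = l.count (i : ℕ) := rfl

lemma count_word {n : ℕ} (u : Fin n →₀ ℕ) (i : Fin n) : (word u).count (i : ℕ) = u i := by
  rw [word, List.count_flatMap, ← Fin.sum_univ_def, Finset.sum_eq_single i]
  · simp
  · intro j _ hj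
    simp [List.count_replicate, Fin.val_inj, hj]
  · simp

@[simp] lemma ofWord_word {n : ℕ} (u : Fin n →₀ ℕ) : ofWord n (word u) = u := by
  ext i; simp [count_word]

lemma mem_word {n : ℕ} {u : Fin n →₀ ℕ} {x : ℕ} :
    x ∈ word u ↔ ∃ i : Fin n, u i ≠ 0 ∧ x = i := by
  simp [word, List.mem_flatMap, List.mem_replicate]

lemma lt_of_mem_word {n : ℕ} {u : Fin n →₀ ℕ} {x : ℕ} (h : x ∈ word u) : x < n := by
  obtain ⟨i, _, rfl⟩ := mem_word.1 h
  exact i.2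

lemma pairwise_word {n : ℕ} (u : Fin n →₀ ℕ) : (word u).Pairwise (· ≤ ·) := by
  rw [word, List.pairwise_flatMap]
  constructor
  · intro i _
    rw [List.pairwise_replicate]
    right; exact le_rfl
  · refine (List.pairwise_lt_finRange n).imp fun h x hx y hy => ?_
    rw [List.eq_of_mem_replicate hx, List.eq_of_mem_replicate hy]
    exact h.le

lemma length_word {n : ℕ} (u : Fin n →₀ ℕ) : (word u).length = u.degree := by
  rw [word, List.length_flatMap, Finsupp.degree_eq_sum, Fin.sum_univ_def]
  simp

lemma word_ofWord {n : ℕ} {l : List ℕ} (hl : l.Pairwise (· ≤ ·)) (hn : ∀ x ∈ l, x < n) :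
    word (ofWord n l) = l := by
  refine List.Perm.eq_of_pairwise' (pairwise_word _) hl (List.perm_iff_count.2 fun a => ?_)
  by_cases ha : a < n
  · exact count_word (ofWord n l) ⟨a, ha⟩
  · rw [List.count_eq_zero_of_not_mem fun h => ha (lt_of_mem_word h),
      List.count_eq_zero_of_not_mem fun h => ha (hn a h)]

lemma word_sublist {n : ℕ} {u v : Fin n →₀ ℕ} (h : u ≤ v) : (word u).Sublist (word v) := by
  refine List.sublist_of_subperm_of_pairwise (List.subperm_ext_iff.2 fun x hx => ?_)
    (pairwise_word u) (pairwise_word v)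
  obtain ⟨i, _, rfl⟩ := mem_word.1 hx
  rw [count_word, count_word]
  exact h i

lemma le_of_word_sublist {n : ℕ} {u v : Fin n →₀ ℕ} (h : (word u).Sublist (word v)) : u ≤ v := by
  intro i
  rw [← count_word, ← count_word]
  exact h.count_le _

lemma le_of_word_prefix {n : ℕ} {u v : Fin n →₀ ℕ} (h : word u <+: word v) : u ≤ v :=
  le_of_word_sublist h.sublist

lemma word_prefix_iff {n : ℕ} {u w : Fin n →₀ ℕ} :
    word u <+: word w ↔ ∃ v, w = u + v ∧ ∀ i j, u i ≠ 0 → v j ≠ 0 → i ≤ j := by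
  constructor
  · rintro ⟨t, ht⟩
    have hp := pairwise_word w
    rw [← ht, List.pairwise_append] at hp
    refine ⟨ofWord n t, ?_, fun i j hi hj => ?_⟩
    · ext i
      rw [Finsupp.add_apply, ofWord_apply, ← count_word w, ← count_word u, ← ht, List.count_append]
    · rw [ofWord_apply, ← Nat.pos_iff_ne_zero, List.count_pos_iff] at hj
      exact hp.2.2 _ (mem_word.2 ⟨i, hi, rfl⟩) _ hj
  · rintro ⟨v, rfl, h⟩
    refine ⟨word v, List.Perm.eq_of_pairwise' ?_ (pairwise_word _)
      (List.perm_iff_count.2 fun a => ?_)⟩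
    · rw [List.pairwise_append]
      refine ⟨pairwise_word u, pairwise_word v, fun x hx y hy => ?_⟩
      obtain ⟨i, hi, rfl⟩ := mem_word.1 hx
      obtain ⟨j, hj, rfl⟩ := mem_word.1 hy
      exact h i j hi hj
    · rw [List.count_append]
      by_cases ha : a < n
      · have h1 := count_word u ⟨a, ha⟩
        have h2 := count_word v ⟨a, ha⟩
        have h3 := count_word (u + v) ⟨a, ha⟩
        rw [Finsupp.add_apply] at h3
        dsimp only at h1 h2 h3
        omega
      · have h0 : ∀ u : Fin n →₀ ℕ, (word u).count a = 0 := fun u =>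
          List.count_eq_zero_of_not_mem fun h => ha (lt_of_mem_word h)
        rw [h0, h0, h0]

lemma lt_maxIndex {n : ℕ} {u : Fin n →₀ ℕ} {x : ℕ} (hx : x ∈ word u) : x < maxIndex u := by
  obtain ⟨i, hi, rfl⟩ := mem_word.1 hx
  exact Finset.le_sup (f := fun i : Fin n => (i : ℕ) + 1) (Finsupp.mem_support_iff.2 hi)

lemma maxIndex_le_iff {n : ℕ} {u : Fin n →₀ ℕ} {N : ℕ} :
    maxIndex u ≤ N ↔ ∀ i : Fin n, u i ≠ 0 → (i : ℕ) < N := by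
  rw [maxIndex, Finset.sup_le_iff]
  simp only [Finsupp.mem_support_iff, Nat.succ_le_iff]

lemma maxIndex_eq {n : ℕ} {u : Fin n →₀ ℕ} {l : List ℕ} {x : ℕ} (h : word u = l ++ [x]) :
    maxIndex u = x + 1 := by
  refine le_antisymm (maxIndex_le_iff.2 fun i hi => ?_) (lt_maxIndex (by rw [h]; simp))
  have h1 : (i : ℕ) ∈ word u := mem_word.2 ⟨i, hi, rfl⟩
  have h2 := pairwise_word u
  rw [h] at h1 h2
  rw [List.pairwise_append] at h2
  rcases List.mem_append.1 h1 with h3 | h3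
  · exact Nat.lt_succ_of_le (h2.2.2 _ h3 x (by simp))
  · rw [List.mem_singleton] at h3; omega

lemma maxIndex_le_card {n : ℕ} (u : Fin n →₀ ℕ) : maxIndex u ≤ n :=
  maxIndex_le_iff.2 fun i _ => i.2

lemma exists_word_eq_append {n : ℕ} {u : Fin n →₀ ℕ} (hu : u ≠ 0) :
    ∃ l x, word u = l ++ [x] := by
  rcases List.eq_nil_or_concat (word u) with h | ⟨l, x, h⟩
  · have := length_word u
    rw [h, List.length_nil, eq_comm, Finsupp.degree_eq_zero_iff] at this
    exact absurd this hu
  · exact ⟨l, x, by rw [h, List.concat_eq_append]⟩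

lemma one_le_maxIndex {n : ℕ} {u : Fin n →₀ ℕ} (hu : u ≠ 0) : 1 ≤ maxIndex u := by
  obtain ⟨l, x, h⟩ := exists_word_eq_append hu
  rw [maxIndex_eq h]; omega

lemma one_le_degree {n : ℕ} {u : Fin n →₀ ℕ} (hu : u ≠ 0) : 1 ≤ u.degree := by
  rw [Nat.one_le_iff_ne_zero, Ne, Finsupp.degree_eq_zero_iff]
  exact hu

/-! #### Comparison of words -/

lemma ofWord_cons {n : ℕ} (a : ℕ) (l : List ℕ) (i : Fin n) :
    ofWord n (a :: l) i = ofWord n l i + if a = i then 1 else 0 := by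
  simp [List.count_cons]

/-- Lowering the letters of a word raises its monomial. Equal head letters cancel; at the first
strict inequality `a < b`, the sorted word starting with `b` has no letter below `b`, while the
other contains `a`. -/
lemma forall₂_lex {n : ℕ} {l l' : List ℕ} (h : List.Forall₂ (· ≤ ·) l l')
    (hl' : l'.Pairwise (· ≤ ·)) (hn : ∀ x ∈ l', x < n) :
    ofWord n l' = ofWord n l ∨ toLex (ofWord n l') < toLex (ofWord n l) := by
  induction h with
  | nil => left; rfl
  | @cons a b l l' hab _ ih =>
    rw [List.pairwise_cons] at hl'
    have hbn : b < n := hn b (by simp)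
    rcases hab.eq_or_lt with rfl | hlt
    · rcases ih hl'.2 fun x hx => hn x (List.mem_cons_of_mem _ hx) with h | h
      · left
        ext i
        rw [ofWord_cons, ofWord_cons, h]
      · right
        obtain ⟨i, hi, hi'⟩ := lexLT_iff.1 (toLex_lt_iff_lexLT.1 h)
        refine toLex_lt_iff_lexLT.2 (lexLT_iff.2 ⟨i, fun j hj => ?_, ?_⟩)
        · rw [ofWord_cons, ofWord_cons, hi j hj]
        · rw [ofWord_cons, ofWord_cons]; omega
    · right
      have hzero : ∀ i : Fin n, (i : ℕ) < b → ofWord n (b :: l') i = 0 := by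
        intro i hi
        rw [ofWord_apply, List.count_eq_zero]
        intro hmem
        rcases List.mem_cons.1 hmem with h | h
        · omega
        · have := hl'.1 _ h; omega
      have hpos : ofWord n (a :: l) ⟨a, hlt.trans hbn⟩ ≠ 0 := by
        rw [ofWord_cons]; simp
      rcases lexLT_trichotomy (ofWord n (b :: l')) (ofWord n (a :: l)) with h | h | h
      · exact h
      · rw [← h] at hpos
        exact absurd (hzero _ hlt) hpos
      · exfalso
        obtain ⟨i, hi, hi'⟩ := lexLT_iff.1 h
        have hbi : b ≤ i := by
          by_contra hcon
          rw [hzero i (by omega)] at hi'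
          omega
        rw [hi ⟨a, hlt.trans hbn⟩ (Fin.lt_def.2 (hlt.trans_le hbi))] at hpos
        exact hpos (hzero _ hlt)

lemma forall₂_take_of_sublist {l W : List ℕ} (h : l.Sublist W) (hW : W.Pairwise (· ≤ ·)) :
    List.Forall₂ (· ≤ ·) (W.take l.length) l := by
  induction W generalizing l with
  | nil => rw [List.sublist_nil.1 h]; simp
  | cons a W ih =>
    rw [List.pairwise_cons] at hW
    rcases l with _ | ⟨b, l⟩
    · simp
    · rw [List.length_cons, List.take_succ_cons]
      rcases List.cons_sublist_cons'.1 h with h2 | ⟨rfl, h2⟩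
      · exact List.Forall₂.cons (hW.1 b (h2.subset (by simp)))
          (ih ((List.sublist_cons_self b l).trans h2) hW.2)
      · exact List.Forall₂.cons le_rfl (ih h2 hW.2)

/-! ### Prefixes in lex ideals -/

section Prefix

variable {K : Type*} [Field K] {n : ℕ} {L : Ideal (MvPolynomial (Fin n) K)}

lemma IsLexIdeal.ofWord_mem (hL : IsLexIdeal L) {u : Fin n →₀ ℕ} (hu : u ∈ exps L) {l : List ℕ}
    (hl : l.Pairwise (· ≤ ·)) (h : List.Forall₂ (· ≤ ·) l (word u)) : ofWord n l ∈ exps L := by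
  have hn : ∀ x ∈ l, x < n := by
    intro x hx
    obtain ⟨i, hi, rfl⟩ := List.mem_iff_getElem.1 hx
    have h2 := (List.forall₂_iff_get.1 h)
    have h3 := h2.2 i hi (h2.1 ▸ hi)
    exact lt_of_le_of_lt h3 (lt_of_mem_word (List.get_mem _ _))
  have h1 := forall₂_lex (n := n) h (pairwise_word u) fun x hx => lt_of_mem_word hx
  rw [ofWord_word] at h1
  rcases h1 with h1 | h1
  · rwa [← h1]
  · refine hL.2 _ _ hu ?_ h1
    rw [← length_word, ← length_word, word_ofWord hl hn, h.length_eq]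

/-- Take the shortest prefix of `w` that lies in `L`. If a proper divisor `v` of it were in `L`, the
prefix of length `deg v` would be letterwise at most `v`, hence also in `L` and shorter. -/
lemma IsLexIdeal.exists_prefix (hL : IsLexIdeal L) {w : Fin n →₀ ℕ} (hw : w ∈ exps L) :
    ∃ u ∈ minGens L, word u <+: word w := by
  classical
  have hex : ∃ k, ofWord n ((word w).take k) ∈ exps L :=
    ⟨(word w).length, by rw [List.take_length, ofWord_word]; exact hw⟩
  set k := Nat.find hex with hk
  set u := ofWord n ((word w).take k) with hu
  have hsub := (List.take_prefix k (word w)).sublist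
  have hword : word u = (word w).take k :=
    word_ofWord ((pairwise_word w).sublist hsub) fun x hx => lt_of_mem_word (hsub.subset hx)
  refine ⟨u, ⟨Nat.find_spec hex, fun v hvu hv => ?_⟩, hword ▸ List.take_prefix _ _⟩
  by_contra hne
  have hlt : v.degree < u.degree := by
    obtain ⟨t, ht⟩ := exists_add_of_le hvu
    have : t ≠ 0 := by rintro rfl; exact hne (by rw [ht, add_zero])
    have := one_le_degree this
    rw [ht, map_add]; omega
  have hvw : (word v).Sublist (word w) := (word_sublist hvu).trans (hword ▸ hsub)
  have h1 := hL.ofWord_mem hv (l := (word w).take (word v).length)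
    ((pairwise_word w).sublist (List.take_sublist _ _))
    (forall₂_take_of_sublist hvw (pairwise_word w))
  have h2 : k ≤ (word v).length := Nat.find_min' hex h1
  rw [length_word] at h2
  have h3 : u.degree ≤ k := by
    rw [← length_word, hword]
    exact List.length_take_le _ _
  omega

lemma minGens_eq_of_le {u v : Fin n →₀ ℕ} (hu : u ∈ minGens L) (hv : v ∈ minGens L)
    (h : u ≤ v) : u = v := hv.2 u h hu.1

lemma eq_of_prefix {u v w : Fin n →₀ ℕ} (hu : u ∈ minGens L) (hv : v ∈ minGens L)
    (h : word u <+: word w) (h' : word v <+: word w) : u = v := by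
  rcases List.prefix_or_prefix_of_prefix h h' with h1 | h1
  · exact minGens_eq_of_le hu hv (le_of_word_prefix h1)
  · exact (minGens_eq_of_le hv hu (le_of_word_prefix h1)).symm

end Prefix

/-! ### The squarefree operator on words -/

/-- The list `l₀, l₁ + 1, l₂ + 2, …`. -/
def stretch (l : List ℕ) : List ℕ := l.mapIdx fun k i => i + k

/-- The list `l₀, l₁ - 1, l₂ - 2, …`. -/
def shrink (l : List ℕ) : List ℕ := l.mapIdx fun k i => i - k

@[simp] lemma length_stretch (l : List ℕ) : (stretch l).length = l.length := List.length_mapIdx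

@[simp] lemma length_shrink (l : List ℕ) : (shrink l).length = l.length := List.length_mapIdx

@[simp] lemma getElem_stretch (l : List ℕ) (i : ℕ) (h : i < (stretch l).length) :
    (stretch l)[i] = l[i]'(by simpa using h) + i := List.getElem_mapIdx

@[simp] lemma getElem_shrink (l : List ℕ) (i : ℕ) (h : i < (shrink l).length) :
    (shrink l)[i] = l[i]'(by simpa using h) - i := List.getElem_mapIdx

lemma pairwise_stretch {l : List ℕ} (hl : l.Pairwise (· ≤ ·)) :
    (stretch l).Pairwise (· < ·) := by
  rw [List.pairwise_iff_getElem] at hl ⊢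
  intro i j hi hj hij
  have := hl i j (by simpa using hi) (by simpa using hj) hij
  simp only [getElem_stretch]
  omega

lemma add_le_getElem_of_pairwise_lt {W : List ℕ} (hW : W.Pairwise (· < ·)) (k : ℕ) :
    ∀ (j i : ℕ) (hj : j < W.length) (hij : j = i + k), (W[i]'(by omega)) + k ≤ W[j] := by
  induction k with
  | zero =>
    intro j i hj hij
    obtain rfl : j = i := hij
    exact le_rfl
  | succ k ih =>
    rintro j i hj rfl
    have h1 := ih (i + k) i (by omega) rfl
    have h2 := List.pairwise_iff_getElem.1 hW (i + k) (i + (k + 1)) (by omega) hj (by omega)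
    omega

lemma pairwise_shrink {W : List ℕ} (hW : W.Pairwise (· < ·)) :
    (shrink W).Pairwise (· ≤ ·) := by
  rw [List.pairwise_iff_getElem]
  intro i j hi hj hij
  simp only [length_shrink] at hi hj
  have := add_le_getElem_of_pairwise_lt hW (j - i) j i hj (by omega)
  simp only [getElem_shrink]
  omega

lemma stretch_shrink {W : List ℕ} (hW : W.Pairwise (· < ·)) : stretch (shrink W) = W := by
  refine List.ext_getElem (by simp) fun i h _ => ?_
  simp only [length_stretch, length_shrink] at h
  have := add_le_getElem_of_pairwise_lt hW i i 0 h (by omega)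
  simp only [getElem_stretch, getElem_shrink]
  omega

lemma stretch_prefix_iff {l l' : List ℕ} : stretch l <+: stretch l' ↔ l <+: l' := by
  rw [List.prefix_iff_getElem, List.prefix_iff_getElem]
  simp

lemma mem_stretch_lt {l : List ℕ} {N x : ℕ} (h : ∀ y ∈ l, y < N) (hx : x ∈ stretch l) :
    x < N + l.length - 1 := by
  obtain ⟨i, hi, rfl⟩ := List.mem_iff_getElem.1 hx
  rw [getElem_stretch]
  have := h _ (List.getElem_mem (by simpa using hi))
  simp only [length_stretch] at hi
  omega

/-- The bound on `m` ensures that restricting to `Fin m` loses no stretched letter. -/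
lemma word_sigmaExponent {n m : ℕ} {u : Fin n →₀ ℕ} (h : maxIndex u + u.degree - 1 ≤ m) :
    word (sigmaExponent m u) = stretch (word u) := by
  refine word_ofWord (n := m) ((pairwise_stretch (pairwise_word u)).imp le_of_lt) fun x hx => ?_
  have := mem_stretch_lt (fun y hy => lt_maxIndex hy) hx
  rw [length_word] at this
  omega

lemma degree_sigmaExponent {n m : ℕ} {u : Fin n →₀ ℕ} (h : maxIndex u + u.degree - 1 ≤ m) :
    (sigmaExponent m u).degree = u.degree := by
  rw [← length_word, word_sigmaExponent h, length_stretch, length_word]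

lemma maxIndex_sigmaExponent {n m : ℕ} {u : Fin n →₀ ℕ} (hu : u ≠ 0)
    (h : maxIndex u + u.degree - 1 ≤ m) :
    maxIndex (sigmaExponent m u) = maxIndex u + u.degree - 1 := by
  obtain ⟨l, x, hlx⟩ := exists_word_eq_append hu
  have h1 : word (sigmaExponent m u) = stretch l ++ [x + l.length] := by
    rw [word_sigmaExponent h, hlx]
    simp [stretch, List.mapIdx_append]
  have h2 := length_word u
  rw [hlx, List.length_append, List.length_singleton] at h2
  rw [maxIndex_eq h1, maxIndex_eq hlx]
  omega

/-- Squarefree monomials. -/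
def IsSquarefree {n : ℕ} (w : Fin n →₀ ℕ) : Prop := ∀ j, w j ≤ 1

lemma IsSquarefree.mono {n : ℕ} {v w : Fin n →₀ ℕ} (hw : IsSquarefree w) (h : v ≤ w) :
    IsSquarefree v := fun j => (h j).trans (hw j)

lemma isSquarefree_iff {n : ℕ} {w : Fin n →₀ ℕ} :
    IsSquarefree w ↔ (word w).Pairwise (· < ·) := by
  have h1 : (word w).Pairwise (· < ·) ↔ (word w).Nodup := by
    constructor
    · exact fun h => h.imp fun h => h.ne
    · intro h
      exact ((pairwise_word w).and h).imp fun h => lt_of_le_of_ne h.1 h.2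
  rw [h1, List.nodup_iff_count_le_one]
  constructor
  · intro h a
    by_cases ha : a < n
    · exact (count_word w ⟨a, ha⟩).le.trans (h _)
    · rw [List.count_eq_zero_of_not_mem fun h => ha (lt_of_mem_word h)]
      exact Nat.zero_le _
  · intro h j
    rw [← count_word]
    exact h _

lemma isSquarefree_sigmaExponent {n m : ℕ} {u : Fin n →₀ ℕ}
    (h : maxIndex u + u.degree - 1 ≤ m) : IsSquarefree (sigmaExponent m u) := by
  rw [isSquarefree_iff, word_sigmaExponent h]
  exact pairwise_stretch (pairwise_word u)

/-! ### Squarefree monomials of the stretched ideal -/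

section Sigma

variable {K : Type*} [Field K] {n : ℕ} {L : Ideal (MvPolynomial (Fin n) K)}

lemma le_sigmaVars {u : Fin n →₀ ℕ} (hu : u ∈ minGens L) :
    maxIndex u + u.degree - 1 ≤ sigmaVars L :=
  le_csSup ((finite_minGens L).image _).bddAbove ⟨u, hu, rfl⟩

lemma mem_exps_sigmaIdeal {w : Fin (sigmaVars L) →₀ ℕ} :
    w ∈ exps (sigmaIdeal L) ↔ ∃ u ∈ minGens L, sigmaExponent (sigmaVars L) u ≤ w := by
  change monomial w (1 : K) ∈ sigmaIdeal L ↔ _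
  rw [sigmaIdeal, ← Set.image_image (fun u => monomial u (1 : K)), monomial_mem_span_iff]
  simp

lemma isMonomialIdeal_sigmaIdeal (L : Ideal (MvPolynomial (Fin n) K)) :
    IsMonomialIdeal (sigmaIdeal L) :=
  ⟨sigmaExponent (sigmaVars L) '' minGens L, by rw [Set.image_image]; rfl⟩

/-- If `u^σ` divides `w`, the first `deg u` letters of `w` are at most those of `u^σ`. Shrinking
them gives a word letterwise at most that of `u`, so its monomial lies in `L`; it has a generator as
prefix, which is stretched back. -/
lemma IsLexIdeal.exists_sigma_prefix (hL : IsLexIdeal L) {w : Fin (sigmaVars L) →₀ ℕ}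
    (hw : w ∈ exps (sigmaIdeal L)) (hsq : IsSquarefree w) :
    ∃ u ∈ minGens L, word (sigmaExponent (sigmaVars L) u) <+: word w := by
  obtain ⟨u, hu, huw⟩ := mem_exps_sigmaIdeal.1 hw
  have hsub := word_sublist huw
  rw [word_sigmaExponent (le_sigmaVars hu)] at hsub
  have h1 := forall₂_take_of_sublist hsub (pairwise_word w)
  rw [length_stretch] at h1
  set W := (word w).take (word u).length with hWdef
  have hW : W.Pairwise (· < ·) := (isSquarefree_iff.1 hsq).sublist (List.take_sublist _ _)
  have hlen := h1.length_eq
  rw [length_stretch] at hlen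
  have h2 : List.Forall₂ (· ≤ ·) (shrink W) (word u) := by
    rw [List.forall₂_iff_get] at h1 ⊢
    refine ⟨by rw [length_shrink, hlen], fun i hi hi' => ?_⟩
    have h3 := h1.2 i (by simpa using hi) (by simpa using hi')
    simp only [List.get_eq_getElem, getElem_stretch, getElem_shrink] at h3 ⊢
    omega
  have hmem := hL.ofWord_mem hu.1 (pairwise_shrink hW) h2
  obtain ⟨u', hu', hpre⟩ := hL.exists_prefix hmem
  have hn : ∀ x ∈ shrink W, x < n := by
    intro x hx
    obtain ⟨i, hi, rfl⟩ := List.mem_iff_getElem.1 hx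
    have h4 := List.forall₂_iff_get.1 h2
    exact lt_of_le_of_lt (h4.2 i hi (h4.1 ▸ hi)) (lt_of_mem_word (List.get_mem _ _))
  rw [word_ofWord (pairwise_shrink hW) hn] at hpre
  refine ⟨u', hu', ?_⟩
  rw [word_sigmaExponent (le_sigmaVars hu')]
  have h5 := stretch_prefix_iff.2 hpre
  rw [stretch_shrink hW] at h5
  exact h5.trans (List.take_prefix _ _)

lemma eq_of_sigma_prefix {u v : Fin n →₀ ℕ} {w : Fin (sigmaVars L) →₀ ℕ} (hu : u ∈ minGens L)
    (hv : v ∈ minGens L) (h : word (sigmaExponent (sigmaVars L) u) <+: word w)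
    (h' : word (sigmaExponent (sigmaVars L) v) <+: word w) : u = v := by
  rw [word_sigmaExponent (le_sigmaVars hu)] at h
  rw [word_sigmaExponent (le_sigmaVars hv)] at h'
  rcases List.prefix_or_prefix_of_prefix h h' with h1 | h1
  · exact minGens_eq_of_le hu hv (le_of_word_prefix (stretch_prefix_iff.1 h1))
  · exact (minGens_eq_of_le hv hu (le_of_word_prefix (stretch_prefix_iff.1 h1))).symm

end Sigma

/-! ### Counting monomials with a given prefix -/

lemma card_filter_le_val (n c : ℕ) :
    (Finset.univ.filter fun i : Fin n => c ≤ (i : ℕ)).card = n - c := by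
  rw [← Nat.card_Ico, ← Finset.card_image_of_injective _ Fin.val_injective]
  congr 1
  ext x
  simp only [Finset.mem_image, Finset.mem_filter, Finset.mem_univ, true_and, Finset.mem_Ico]
  exact ⟨by rintro ⟨i, hi, rfl⟩; exact ⟨hi, i.2⟩, fun h => ⟨⟨x, h.2⟩, h.1, rfl⟩⟩

lemma mem_antidiag_univ {n j : ℕ} {u : Fin n →₀ ℕ} :
    u ∈ Finset.finsuppAntidiag Finset.univ j ↔ u.degree = j := by
  rw [Finset.mem_finsuppAntidiag, ← Finsupp.degree_eq_sum]
  simp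

lemma mem_antidiag {n j : ℕ} {s : Finset (Fin n)} {u : Fin n →₀ ℕ} :
    u ∈ Finset.finsuppAntidiag s j ↔ u.degree = j ∧ ∀ i, u i ≠ 0 → i ∈ s := by
  rw [Finset.mem_finsuppAntidiag]
  have h : (∀ i, u i ≠ 0 → i ∈ s) ↔ u.support ⊆ s :=
    ⟨fun h i hi => h i (Finsupp.mem_support_iff.1 hi),
      fun h i hi => h (Finsupp.mem_support_iff.2 hi)⟩
  rw [h, and_congr_left_iff]
  intro hs
  rw [Finsupp.degree_apply, Finset.sum_subset hs]
  intro i _ hi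
  exact Finsupp.notMem_support_iff.1 hi

open Classical in
-- Such `w` are `u v` with `v` any monomial in the variables from index `m(u)` on, counted from `1`.
lemma card_prefix {n : ℕ} (u : Fin n →₀ ℕ) (j : ℕ) :
    (((Finset.finsuppAntidiag Finset.univ j).filter fun w : Fin n →₀ ℕ => word u <+: word w).card : ℤ) =
      PowerSeries.coeff j (PowerSeries.X ^ u.degree * geom ^ (n - (maxIndex u - 1))) := by
  rw [PowerSeries.coeff_X_pow_mul', ← card_filter_le_val n (maxIndex u - 1)]
  split_ifs with h
  · rw [coeff_geom_pow_card, ← Finset.card_image_of_injective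
      (Finset.finsuppAntidiag _ (j - u.degree)) (add_right_injective u)]
    congr 2
    ext w
    simp only [Finset.mem_filter, Finset.mem_image, mem_antidiag,
      word_prefix_iff, Finset.mem_univ, true_and, implies_true, and_true]
    constructor
    · rintro ⟨rfl, v, rfl, hv⟩
      refine ⟨v, ⟨by rw [map_add]; omega, fun i hi => ?_⟩, rfl⟩
      have : maxIndex u ≤ i + 1 := maxIndex_le_iff.2 fun k hk =>
        Nat.lt_succ_of_le (hv k i hk hi)
      omega
    · rintro ⟨v, ⟨hv, hs⟩, rfl⟩
      refine ⟨by rw [map_add]; omega, v, rfl, fun i k hi hk => ?_⟩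
      have h1 := hs k hk
      have h2 := maxIndex_le_iff.1 le_rfl i hi
      rw [Fin.le_def]
      omega
  · rw [Nat.cast_eq_zero, Finset.card_eq_zero, Finset.filter_eq_empty_iff]
    intro w hw hpre
    rw [mem_antidiag_univ] at hw
    have := Finsupp.degree_mono (le_of_word_prefix hpre)
    omega

open Classical in
lemma card_squarefree_antidiag {n : ℕ} (s : Finset (Fin n)) (j : ℕ) :
    (((Finset.finsuppAntidiag s j).filter IsSquarefree).card : ℤ) =
      ((1 + Polynomial.X : Polynomial ℤ) ^ s.card).coeff j := by
  have h1 : ((1 + Polynomial.X : Polynomial ℤ) ^ s.card).coeff j =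
      PowerSeries.coeff j (∏ _i ∈ s, (1 + PowerSeries.X : PowerSeries ℤ)) := by
    rw [Finset.prod_const, ← Polynomial.coeff_coe]
    push_cast
    rfl
  rw [h1, PowerSeries.coeff_prod, Finset.card_filter, Nat.cast_sum]
  refine Finset.sum_congr rfl fun v hv => ?_
  have hc : ∀ k, PowerSeries.coeff k (1 + PowerSeries.X : PowerSeries ℤ) =
      if k ≤ 1 then 1 else 0 := by
    intro k
    rw [map_add, PowerSeries.coeff_one, PowerSeries.coeff_X]
    rcases k with _ | _ | k <;> simp
  simp only [hc]
  rw [Finset.prod_ite_zero, Finset.prod_const_one, Nat.cast_ite, Nat.cast_one, Nat.cast_zero]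
  congr 1
  refine propext ⟨fun h i _ => h i, fun h i => ?_⟩
  by_cases hi : v i = 0
  · rw [hi]; exact Nat.zero_le _
  · exact h i ((mem_antidiag.1 hv).2 i hi)

open Classical in
-- As in `card_prefix`, but the cofactor is squarefree and must avoid the last variable of `p`,
-- which leaves `n - m(p)` variables.
lemma card_squarefree_prefix {n : ℕ} {p : Fin n →₀ ℕ} (hp : IsSquarefree p) (j : ℕ) :
    (((Finset.finsuppAntidiag Finset.univ j).filter fun w : Fin n →₀ ℕ =>
      IsSquarefree w ∧ word p <+: word w).card : ℤ) =
      (Polynomial.X ^ p.degree * (1 + Polynomial.X) ^ (n - maxIndex p) : Polynomial ℤ).coeff j := by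
  rw [Polynomial.coeff_X_pow_mul', ← card_filter_le_val n (maxIndex p)]
  split_ifs with h
  · rw [← card_squarefree_antidiag, ← Finset.card_image_of_injective
      ((Finset.finsuppAntidiag _ (j - p.degree)).filter IsSquarefree) (add_right_injective p)]
    congr 2
    ext w
    simp only [Finset.mem_filter, Finset.mem_image, mem_antidiag,
      word_prefix_iff, Finset.mem_univ, true_and, implies_true, and_true]
    constructor
    · rintro ⟨rfl, hw, v, rfl, hv⟩
      refine ⟨v, ⟨⟨by rw [map_add]; omega, fun i hi => ?_⟩, hw.mono le_add_self⟩, rfl⟩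
      refine maxIndex_le_iff.2 fun k hk => ?_
      refine Fin.lt_def.1 (lt_of_le_of_ne (hv k i hk hi) ?_)
      rintro rfl
      have := hw k
      rw [Finsupp.add_apply] at this
      omega
    · rintro ⟨v, ⟨⟨hv, hs⟩, hsq⟩, rfl⟩
      have hlt : ∀ i k, p i ≠ 0 → v k ≠ 0 → i < k := fun i k hi hk =>
        Fin.lt_def.2 ((maxIndex_le_iff.1 le_rfl i hi).trans_le (hs k hk))
      refine ⟨by rw [map_add]; omega, fun i => ?_, v, rfl, fun i k hi hk => (hlt i k hi hk).le⟩
      have h1 := hp i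
      have h2 := hsq i
      rw [Finsupp.add_apply]
      by_cases h3 : p i = 0
      · omega
      by_cases h4 : v i = 0
      · omega
      exact absurd (hlt i i h3 h4) (lt_irrefl _)
  · rw [Nat.cast_eq_zero, Finset.card_eq_zero, Finset.filter_eq_empty_iff]
    rintro w hw ⟨-, hpre⟩
    rw [mem_antidiag_univ] at hw
    have := Finsupp.degree_mono (le_of_word_prefix hpre)
    omega

/-! ### Hilbert series of lex and squarefree ideals -/

section Series

variable {K : Type*} [Field K] {n : ℕ}

open Classical in
lemma IsMonomialIdeal.hilbertFunction_eq_card_filter {J : Ideal (MvPolynomial (Fin n) K)}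
    (hJ : IsMonomialIdeal J) (j : ℕ) :
    hilbertFunction J j =
      ((Finset.finsuppAntidiag Finset.univ j).filter fun w => w ∈ exps J).card := by
  rw [hJ.hilbertFunction_eq, ← Nat.card_eq_finsetCard]
  refine Nat.card_congr
    { toFun := fun u => ⟨u.1.1, Finset.mem_filter.2 ⟨mem_antidiag_univ.2 u.2, u.1.2⟩⟩
      invFun := fun u => ⟨⟨u.1, (Finset.mem_filter.1 u.2).2⟩,
        mem_antidiag_univ.1 (Finset.mem_filter.1 u.2).1⟩
      left_inv := fun _ => rfl
      right_inv := fun _ => rfl }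

/-- The monomials of `L` are partitioned according to their unique generator prefix. -/
lemma IsLexIdeal.hilbertSeries_eq {L : Ideal (MvPolynomial (Fin n) K)} (hL : IsLexIdeal L) :
    hilbertSeries L = ∑ u ∈ (finite_minGens L).toFinset,
      PowerSeries.X ^ u.degree * geom ^ (n - (maxIndex u - 1)) := by
  classical
  ext j
  rw [hilbertSeries, PowerSeries.coeff_mk, hL.1.hilbertFunction_eq_card_filter, map_sum]
  simp only [← card_prefix]
  rw [← Nat.cast_sum, ← Finset.card_biUnion]
  · congr 2
    ext w
    simp only [Finset.mem_filter, Finset.mem_biUnion, Set.Finite.mem_toFinset]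
    constructor
    · rintro ⟨hj, hw⟩
      obtain ⟨u, hu, hpre⟩ := hL.exists_prefix hw
      exact ⟨u, hu, hj, hpre⟩
    · rintro ⟨u, hu, hj, hpre⟩
      exact ⟨hj, monomial_mem_of_le (le_of_word_prefix hpre) hu.1⟩
  · intro u hu v hv huv
    simp only [Finset.mem_coe, Set.Finite.mem_toFinset] at hu hv
    rw [Function.onFun, Finset.disjoint_left]
    intro w hw hw'
    exact huv (eq_of_prefix hu hv (Finset.mem_filter.1 hw).2 (Finset.mem_filter.1 hw').2)

/-- The numerator of the Hilbert series of a lex ideal. -/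
def numerator (L : Ideal (MvPolynomial (Fin n) K)) : Polynomial ℤ :=
  ∑ u ∈ (finite_minGens L).toFinset,
    Polynomial.X ^ u.degree * (1 - Polynomial.X) ^ (maxIndex u - 1)

lemma IsLexIdeal.coe_numerator {L : Ideal (MvPolynomial (Fin n) K)} (hL : IsLexIdeal L) :
    (numerator L : PowerSeries ℤ) = (1 - PowerSeries.X) ^ n * hilbertSeries L := by
  rw [hL.hilbertSeries_eq, numerator, coe_finsetSum, Finset.mul_sum]
  refine Finset.sum_congr rfl fun u _ => ?_
  push_cast
  rw [mul_left_comm, one_sub_pow_mul_geom_pow (Nat.sub_le _ _)]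
  congr 2
  have := maxIndex_le_card u
  omega

lemma numerator_mem_cone (L : Ideal (MvPolynomial (Fin n) K)) : numerator L ∈ cone n :=
  sum_mem fun u _ => mem_cone_of_le _ ((Nat.sub_le _ _).trans (maxIndex_le_card u))

lemma ne_zero_of_mem_minGens {L : Ideal (MvPolynomial (Fin n) K)} (htop : L ≠ ⊤)
    {u : Fin n →₀ ℕ} (hu : u ∈ minGens L) : u ≠ 0 := by
  rintro rfl
  exact htop ((Ideal.eq_top_iff_one _).2 hu.1)

lemma natDegree_numerator_le {L : Ideal (MvPolynomial (Fin n) K)} (htop : L ≠ ⊤) :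
    (numerator L).natDegree ≤ sigmaVars L := by
  refine Polynomial.natDegree_sum_le_of_forall_le _ _ fun u hu => ?_
  rw [Set.Finite.mem_toFinset] at hu
  have h1 := le_sigmaVars hu
  have h2 := one_le_maxIndex (ne_zero_of_mem_minGens htop hu)
  exact (natDegree_X_pow_mul_le _ _).trans (by omega)

open Classical in
lemma squarefreeCount_eq (J : Ideal (MvPolynomial (Fin n) K)) (i : ℕ) :
    squarefreeCount J i = ((Finset.finsuppAntidiag Finset.univ i).filter fun w =>
      IsSquarefree w ∧ w ∈ exps J).card := by
  rw [squarefreeCount, ← Set.ncard_coe_finset]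
  congr 1
  ext w
  rw [Finset.mem_coe, Finset.mem_filter, mem_antidiag_univ]
  exact ⟨fun h => ⟨h.2.1, h.1, h.2.2⟩, fun h => ⟨h.2.1, h.1, h.2.2⟩⟩

lemma IsLexIdeal.squarefreeCount_sigmaIdeal {L : Ideal (MvPolynomial (Fin n) K)}
    (hL : IsLexIdeal L) (htop : L ≠ ⊤) (i : ℕ) :
    (squarefreeCount (sigmaIdeal L) i : ℤ) = (∑ u ∈ (finite_minGens L).toFinset,
      Polynomial.X ^ u.degree *
        (1 + Polynomial.X) ^ (sigmaVars L - (maxIndex u + u.degree - 1)) : Polynomial ℤ).coeff i := by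
  classical
  rw [squarefreeCount_eq, Polynomial.finsetSum_coeff]
  have h : ∀ u ∈ (finite_minGens L).toFinset, (Polynomial.X ^ u.degree *
      (1 + Polynomial.X) ^ (sigmaVars L - (maxIndex u + u.degree - 1)) : Polynomial ℤ).coeff i =
      (((Finset.finsuppAntidiag Finset.univ i).filter fun w : Fin (sigmaVars L) →₀ ℕ =>
        IsSquarefree w ∧ word (sigmaExponent (sigmaVars L) u) <+: word w).card : ℤ) := by
    intro u hu
    rw [Set.Finite.mem_toFinset] at hu
    have h1 := le_sigmaVars hu
    rw [card_squarefree_prefix (isSquarefree_sigmaExponent h1), degree_sigmaExponent h1,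
      maxIndex_sigmaExponent (ne_zero_of_mem_minGens htop hu) h1]
  rw [Finset.sum_congr rfl h, ← Nat.cast_sum, ← Finset.card_biUnion]
  · congr 2
    ext w
    simp only [Finset.mem_filter, Finset.mem_biUnion, Set.Finite.mem_toFinset]
    constructor
    · rintro ⟨hj, hsq, hw⟩
      obtain ⟨u, hu, hpre⟩ := hL.exists_sigma_prefix hw hsq
      exact ⟨u, hu, hj, hsq, hpre⟩
    · rintro ⟨u, hu, hj, hsq, hpre⟩
      exact ⟨hj, hsq, mem_exps_sigmaIdeal.2 ⟨u, hu, le_of_word_prefix hpre⟩⟩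
  · intro u hu v hv huv
    simp only [Finset.mem_coe, Set.Finite.mem_toFinset] at hu hv
    rw [Function.onFun, Finset.disjoint_left]
    intro w hw hw'
    exact huv (eq_of_sigma_prefix hu hv (Finset.mem_filter.1 hw).2.2
      (Finset.mem_filter.1 hw').2.2)

/-- Homogenizing the generating function of the counts in degree `m` turns the summand of `u` into
`t^(deg u)(1-t)^(m(u)-1)`, since `m - deg u - (m - (m(u) + deg u - 1)) = m(u) - 1`. -/
lemma IsLexIdeal.numerator_eq {L : Ideal (MvPolynomial (Fin n) K)}
    (hL : IsLexIdeal L) (htop : L ≠ ⊤) :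
    numerator L = ∑ i ∈ Finset.range (sigmaVars L + 1),
      Polynomial.C (squarefreeCount (sigmaIdeal L) i : ℤ) *
        (Polynomial.X ^ i * (1 - Polynomial.X) ^ (sigmaVars L - i)) := by
  have h : bernstein (sigmaVars L) (∑ u ∈ (finite_minGens L).toFinset,
      Polynomial.X ^ u.degree *
        (1 + Polynomial.X) ^ (sigmaVars L - (maxIndex u + u.degree - 1))) = numerator L := by
    rw [bernstein_sum, numerator]
    refine Finset.sum_congr rfl fun u hu => ?_
    rw [Set.Finite.mem_toFinset] at hu
    have h1 := le_sigmaVars hu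
    have h2 := one_le_maxIndex (ne_zero_of_mem_minGens htop hu)
    rw [bernstein_X_pow_mul _ _ (by omega)]
    congr 2
    omega
  rw [← h, bernstein]
  exact Finset.sum_congr rfl fun i _ => by rw [hL.squarefreeCount_sigmaIdeal htop]

/-! ### The Hilbert series of a squarefree monomial ideal -/

/-- The squarefree monomial with support `s`. -/
def ind (s : Finset (Fin n)) : Fin n →₀ ℕ := Finsupp.indicator s fun _ _ => 1

lemma ind_apply (s : Finset (Fin n)) (i : Fin n) : ind s i = if i ∈ s then 1 else 0 := by
  simp [ind, Finsupp.indicator_apply]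

lemma support_ind (s : Finset (Fin n)) : (ind s).support = s := by
  ext i; simp [ind_apply]

lemma degree_ind (s : Finset (Fin n)) : (ind s).degree = s.card := by
  rw [Finsupp.degree_apply, support_ind, Finset.card_eq_sum_ones]
  exact Finset.sum_congr rfl fun i hi => by rw [ind_apply, if_pos hi]

lemma isSquarefree_ind (s : Finset (Fin n)) : IsSquarefree (ind s) := fun i => by
  rw [ind_apply]; split_ifs <;> simp

lemma IsSquarefree.le_ind_of_le {u w : Fin n →₀ ℕ} (hu : IsSquarefree u) (h : u ≤ w) :
    u ≤ ind w.support := by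
  intro i
  rw [ind_apply]
  split_ifs with hi
  · exact hu i
  · rw [Finsupp.notMem_support_iff] at hi
    exact hi ▸ h i

lemma ind_support_le (w : Fin n →₀ ℕ) : ind w.support ≤ w := by
  intro i
  rw [ind_apply]
  split_ifs with hi
  · exact Nat.pos_of_ne_zero (Finsupp.mem_support_iff.1 hi)
  · exact Nat.zero_le _

lemma IsSquarefree.ind_support {w : Fin n →₀ ℕ} (hw : IsSquarefree w) : ind w.support = w :=
  le_antisymm (ind_support_le w) (hw.le_ind_of_le le_rfl)

lemma card_support_eq (s : Finset (Fin n)) (j : ℕ) :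
    (((Finset.finsuppAntidiag Finset.univ j).filter fun w : Fin n →₀ ℕ =>
      w.support = s).card : ℤ) = PowerSeries.coeff j ((PowerSeries.X * geom) ^ s.card) := by
  rw [← Finset.prod_const, PowerSeries.coeff_prod]
  have hc : ∀ k, PowerSeries.coeff k (PowerSeries.X * geom) = if k ≠ 0 then (1 : ℤ) else 0 := by
    intro k
    rcases k with _ | k
    · simp
    · rw [PowerSeries.coeff_succ_X_mul]; simp
  simp only [hc]
  have h : (Finset.finsuppAntidiag Finset.univ j).filter (fun w : Fin n →₀ ℕ => w.support = s) =
      (Finset.finsuppAntidiag s j).filter fun w => ∀ i ∈ s, w i ≠ 0 := by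
    ext w
    rw [Finset.mem_filter, Finset.mem_filter, mem_antidiag_univ, mem_antidiag]
    constructor
    · rintro ⟨hj, rfl⟩
      exact ⟨⟨hj, fun i hi => Finsupp.mem_support_iff.2 hi⟩, fun i hi =>
        Finsupp.mem_support_iff.1 hi⟩
    · rintro ⟨⟨hj, h1⟩, h2⟩
      refine ⟨hj, Finset.ext fun i => ?_⟩
      rw [Finsupp.mem_support_iff]
      exact ⟨h1 i, h2 i⟩
  rw [h, Finset.card_filter, Nat.cast_sum]
  refine Finset.sum_congr rfl fun v _ => ?_
  rw [Finset.prod_ite_zero, Finset.prod_const_one]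
  split_ifs <;> simp

/-- Membership of a monomial depends only on its support, and the monomials with support `s` have
series `(t/(1-t))^|s|`. -/
lemma hilbertSeries_of_squarefree {J : Ideal (MvPolynomial (Fin n) K)} (hJ : IsMonomialIdeal J)
    (hsq : ∀ w, w ∈ exps J → ind w.support ∈ exps J) :
    hilbertSeries J = ∑ i ∈ Finset.range (n + 1),
      PowerSeries.C (squarefreeCount J i : ℤ) * (PowerSeries.X * geom) ^ i := by
  classical
  have hiff : ∀ w : Fin n →₀ ℕ, w ∈ exps J ↔ ind w.support ∈ exps J := fun w =>
    ⟨hsq w, monomial_mem_of_le (ind_support_le w)⟩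
  set t : Finset (Finset (Fin n)) := Finset.univ.filter fun s => ind s ∈ exps J with ht
  have hcount : ∀ i, squarefreeCount J i = (t.filter fun s => s.card = i).card := by
    intro i
    rw [squarefreeCount_eq]
    refine Finset.card_bij' (fun w _ => w.support) (fun s _ => ind s) ?_ ?_ ?_ ?_
    · intro w hw
      rw [Finset.mem_filter, mem_antidiag_univ] at hw
      rw [Finset.mem_filter, ht, Finset.mem_filter, ← degree_ind, hw.2.1.ind_support]
      exact ⟨⟨Finset.mem_univ _, hw.2.2⟩, hw.1⟩
    · intro s hs
      rw [Finset.mem_filter, ht, Finset.mem_filter] at hs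
      rw [Finset.mem_filter, mem_antidiag_univ, degree_ind]
      exact ⟨hs.2, isSquarefree_ind s, hs.1.2⟩
    · intro w hw
      exact (Finset.mem_filter.1 hw).2.1.ind_support
    · intro s _
      exact support_ind s
  ext j
  rw [hilbertSeries, PowerSeries.coeff_mk, hJ.hilbertFunction_eq_card_filter,
    Finset.card_eq_sum_card_fiberwise (f := Finsupp.support) (t := t), Nat.cast_sum, map_sum]
  · have h1 : ∀ s ∈ t, ((((Finset.finsuppAntidiag Finset.univ j).filter fun w => w ∈ exps J).filter
        fun w => w.support = s).card : ℤ) =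
        PowerSeries.coeff j ((PowerSeries.X * geom) ^ s.card) := by
      intro s hs
      rw [← card_support_eq, Finset.filter_filter]
      congr 2
      refine Finset.filter_congr fun w _ => ?_
      rw [and_iff_right_iff_imp]
      rintro rfl
      exact (hiff w).2 (Finset.mem_filter.1 hs).2
    rw [Finset.sum_congr rfl h1,
      ← Finset.sum_fiberwise_of_maps_to (g := Finset.card) (t := Finset.range (n + 1))]
    · refine Finset.sum_congr rfl fun i _ => ?_
      rw [PowerSeries.coeff_C_mul, hcount, Finset.sum_congr rfl fun s hs => by
        rw [(Finset.mem_filter.1 hs).2], Finset.sum_const, nsmul_eq_mul]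
    · intro s _
      rw [Finset.mem_range]
      exact Nat.lt_succ_of_le (card_finset_fin_le s)
  · intro w hw
    rw [Finset.mem_coe, Finset.mem_filter] at hw
    rw [Finset.mem_coe, ht, Finset.mem_filter]
    exact ⟨Finset.mem_univ _, hsq w hw.2⟩

lemma IsLexIdeal.coe_numerator_sigmaIdeal {L : Ideal (MvPolynomial (Fin n) K)}
    (hL : IsLexIdeal L) (htop : L ≠ ⊤) :
    (numerator L : PowerSeries ℤ) =
      (1 - PowerSeries.X) ^ sigmaVars L * hilbertSeries (sigmaIdeal L) := by
  rw [hilbertSeries_of_squarefree (isMonomialIdeal_sigmaIdeal L), hL.numerator_eq htop,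
    coe_finsetSum, Finset.mul_sum]
  · refine Finset.sum_congr rfl fun i hi => ?_
    rw [Finset.mem_range] at hi
    push_cast
    rw [← one_sub_pow_mul_geom_pow (show i ≤ sigmaVars L by omega)]
    ring
  · intro w hw
    obtain ⟨u, hu, huw⟩ := mem_exps_sigmaIdeal.1 hw
    exact mem_exps_sigmaIdeal.2
      ⟨u, hu, (isSquarefree_sigmaExponent (le_sigmaVars hu)).le_ind_of_le huw⟩

/-! ### The least degree of a generator -/

lemma exists_mem_minGens_degree_eq {J : Ideal (MvPolynomial (Fin n) K)}
    (hne : (minGens J).Nonempty) : ∃ p ∈ minGens J, p.degree = minGenDegree J := by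
  obtain ⟨p, hp, hpd⟩ := Nat.sInf_mem (hne.image Finsupp.degree)
  exact ⟨p, hp, hpd⟩

lemma minGenDegree_le {J : Ideal (MvPolynomial (Fin n) K)} {w : Fin n →₀ ℕ} (hw : w ∈ exps J) :
    minGenDegree J ≤ w.degree := by
  obtain ⟨u, hu, huw⟩ := exists_minGens_le hw
  exact (Nat.sInf_le (Set.mem_image_of_mem Finsupp.degree hu)).trans (Finsupp.degree_mono huw)

lemma squarefreeCount_eq_zero {J : Ideal (MvPolynomial (Fin n) K)} {i : ℕ}
    (hi : i < minGenDegree J) : squarefreeCount J i = 0 := by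
  classical
  rw [squarefreeCount_eq, Finset.card_eq_zero, Finset.filter_eq_empty_iff]
  rintro w hw ⟨-, hwJ⟩
  rw [mem_antidiag_univ] at hw
  have := minGenDegree_le hwJ
  omega

lemma IsSquarefree.degree_le {w : Fin n →₀ ℕ} (hw : IsSquarefree w) : w.degree ≤ n := by
  rw [← hw.ind_support, degree_ind]
  exact card_finset_fin_le _

/-- A minimal generator of least degree is divisible by some `u^σ`, hence equal to it and
squarefree. -/
lemma exists_squarefree_minGenDegree {L : Ideal (MvPolynomial (Fin n) K)}
    (hne : (minGens L).Nonempty) : ∃ p ∈ exps (sigmaIdeal L), IsSquarefree p ∧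
      p.degree = minGenDegree (sigmaIdeal L) := by
  obtain ⟨u, hu⟩ := hne
  obtain ⟨v, hv, _⟩ := exists_minGens_le (mem_exps_sigmaIdeal.2 ⟨u, hu, le_rfl⟩)
  obtain ⟨p, hp, hpd⟩ := exists_mem_minGens_degree_eq ⟨v, hv⟩
  obtain ⟨u', hu', hle⟩ := mem_exps_sigmaIdeal.1 hp.1
  have := hp.2 _ hle (mem_exps_sigmaIdeal.2 ⟨u', hu', le_rfl⟩)
  exact ⟨p, hp.1, this ▸ isSquarefree_sigmaExponent (le_sigmaVars hu'), hpd⟩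

lemma squarefreeCount_minGenDegree_pos {L : Ideal (MvPolynomial (Fin n) K)}
    (hne : (minGens L).Nonempty) :
    0 < squarefreeCount (sigmaIdeal L) (minGenDegree (sigmaIdeal L)) := by
  classical
  obtain ⟨p, hp, hsq, hpd⟩ := exists_squarefree_minGenDegree hne
  rw [squarefreeCount_eq, Finset.card_pos]
  exact ⟨p, Finset.mem_filter.2 ⟨mem_antidiag_univ.2 hpd, hsq, hp⟩⟩

lemma minGenDegree_sigmaIdeal_le {L : Ideal (MvPolynomial (Fin n) K)}
    (hne : (minGens L).Nonempty) : minGenDegree (sigmaIdeal L) ≤ sigmaVars L := by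
  obtain ⟨p, _, hsq, hpd⟩ := exists_squarefree_minGenDegree hne
  exact hpd ▸ hsq.degree_le

lemma IsLexIdeal.numerator_eq_Icc {L : Ideal (MvPolynomial (Fin n) K)}
    (hL : IsLexIdeal L) (htop : L ≠ ⊤) :
    numerator L = ∑ i ∈ Finset.Icc (minGenDegree (sigmaIdeal L)) (sigmaVars L),
      Polynomial.C (squarefreeCount (sigmaIdeal L) i : ℤ) *
        (Polynomial.X ^ i * (1 - Polynomial.X) ^ (sigmaVars L - i)) := by
  rw [hL.numerator_eq htop]
  symm
  refine Finset.sum_subset (fun i hi => ?_) fun i hi hi' => ?_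
  · rw [Finset.mem_Icc] at hi
    rw [Finset.mem_range]; omega
  · rw [Finset.mem_range] at hi
    rw [Finset.mem_Icc] at hi'
    rw [squarefreeCount_eq_zero (by omega)]
    simp

/-! ### Nontriviality -/

lemma eq_bot_of_hilbertFunction_eq_zero {I : Ideal (MvPolynomial (Fin n) K)}
    (hI : IsGradedIdeal I) (h : ∀ j, hilbertFunction I j = 0) : I = ⊥ := by
  by_contra hbot
  obtain ⟨j, hj⟩ := hI.exists_hilbertFunction_ne_zero hbot
  exact hj (h j)

lemma hilbertFunction_bot (j : ℕ) :
    hilbertFunction (⊥ : Ideal (MvPolynomial (Fin n) K)) j = 0 := by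
  rw [hilbertFunction, Submodule.restrictScalars_bot, bot_inf_eq, finrank_bot]

lemma hilbertFunction_zero_eq_zero_iff {I : Ideal (MvPolynomial (Fin n) K)}
    (hI : IsGradedIdeal I) : hilbertFunction I 0 = 0 ↔ I ≠ ⊤ := by
  rw [← not_iff_not, ← ne_eq, hI.hilbertFunction_ne_zero_iff, not_not]
  constructor
  · rintro ⟨u, hu, hu0⟩
    obtain ⟨f, hf, hfh, hf0, _⟩ := exists_homogeneous_of_mem_initExps hI hu
    rw [hu0, mem_homogeneousSubmodule, ← totalDegree_zero_iff_isHomogeneous,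
      totalDegree_eq_zero_iff_eq_C] at hfh
    rw [hfh] at hf hf0
    refine Ideal.eq_top_of_isUnit_mem _ hf ?_
    refine IsUnit.map C (Ne.isUnit fun h => hf0 ?_)
    rw [h, C_0]
  · rintro rfl
    refine ⟨0, exps_subset_initExps _ ?_, map_zero _⟩
    change monomial 0 (1 : K) ∈ (⊤ : Ideal (MvPolynomial (Fin n) K))
    exact Submodule.mem_top

end Series

end HilbertDepth

end

/-! ### The main theorem -/

theorem mainTheorem4 {K : Type*} [Field K] (n : ℕ) (I : Ideal (MvPolynomial (Fin n) K))
    (hI : HilbertDepth.IsGradedIdeal I) (hbot : I ≠ ⊥) (htop : I ≠ ⊤) :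
    -- the initial ideal has the Hilbert function of `I`, and exactly one lex ideal has it
    (∀ i, HilbertDepth.hilbertFunction (HilbertDepth.lexInitialIdeal I) i =
      HilbertDepth.hilbertFunction I i) ∧
    (∃! L : Ideal (MvPolynomial (Fin n) K), HilbertDepth.IsLexIdeal L ∧
      ∀ i, HilbertDepth.hilbertFunction L i = HilbertDepth.hilbertFunction I i) ∧
    ∀ L : Ideal (MvPolynomial (Fin n) K), HilbertDepth.IsLexIdeal L →
      (∀ i, HilbertDepth.hilbertFunction L i = HilbertDepth.hilbertFunction I i) →
      -- the Hilbert depths are attained maxima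
      IsGreatest (HilbertDepth.hdepthSet I) (HilbertDepth.hdepth I) ∧
      IsGreatest (HilbertDepth.hdepthSet L) (HilbertDepth.hdepth L) ∧
      IsGreatest (HilbertDepth.hdepthSet (HilbertDepth.sigmaIdeal L))
        (HilbertDepth.hdepth (HilbertDepth.sigmaIdeal L)) ∧
      -- the algorithm through `L^σ`
      HilbertDepth.SquarefreeAlgorithmReturns (HilbertDepth.sigmaIdeal L)
        (HilbertDepth.hdepth (HilbertDepth.sigmaIdeal L)) ∧
      HilbertDepth.hdepth I = HilbertDepth.hdepth L ∧
      (HilbertDepth.hdepth I : ℤ) =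
        (HilbertDepth.hdepth (HilbertDepth.sigmaIdeal L) : ℤ) -
          ((HilbertDepth.sigmaVars L : ℤ) - (n : ℤ)) ∧
      -- the algorithm through the numerator of the Hilbert series
      ∃ Q : Polynomial ℤ,
        (Q : PowerSeries ℤ) = (1 - PowerSeries.X) ^ n * HilbertDepth.hilbertSeries I ∧
        Q.natDegree ≤ HilbertDepth.sigmaVars L ∧
        HilbertDepth.NumeratorAlgorithmReturns n (HilbertDepth.sigmaVars L) Q
          (HilbertDepth.hdepth I : ℤ) := by
  classical
  open HilbertDepth in
  refine ⟨hilbertFunction_lexInitialIdeal hI, existsUnique_isLexIdeal hI, fun L hL hHF => ?_⟩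
  have hgr := hL.1.isGradedIdeal
  have hLbot : L ≠ ⊥ := by
    rintro rfl
    exact hbot (eq_bot_of_hilbertFunction_eq_zero hI fun j => by
      rw [← hHF, hilbertFunction_bot])
  have hLtop : L ≠ ⊤ := by
    rw [← hilbertFunction_zero_eq_zero_iff hgr, hHF, hilbertFunction_zero_eq_zero_iff hI]
    exact htop
  have hexps : (exps L).Nonempty := by
    obtain ⟨j, hj⟩ := hgr.exists_hilbertFunction_ne_zero hLbot
    obtain ⟨u, hu, _⟩ := (hgr.hilbertFunction_ne_zero_iff j).1 hj
    exact ⟨u, hL.1.initExps_eq ▸ hu⟩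
  have hne : (minGens L).Nonempty := by
    obtain ⟨w, hw⟩ := hexps
    obtain ⟨u, hu, _⟩ := exists_minGens_le hw
    exact ⟨u, hu⟩
  have hJbot : sigmaIdeal L ≠ ⊥ := by
    intro h
    obtain ⟨u, hu⟩ := hne
    have hmem : sigmaExponent (sigmaVars L) u ∈ exps (sigmaIdeal L) :=
      mem_exps_sigmaIdeal.2 ⟨u, hu, le_rfl⟩
    rw [h] at hmem
    have h0 : monomial (sigmaExponent (sigmaVars L) u) (1 : K) = 0 := hmem
    simp at h0
  set Q := numerator L with hQ
  set m := sigmaVars L with hm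
  set d := minGenDegree (sigmaIdeal L) with hd
  set a := squarefreeCount (sigmaIdeal L) with ha
  have hdm : d ≤ m := minGenDegree_sigmaIdeal_le hne
  have had : 0 < a d := squarefreeCount_minGenDegree_pos hne
  have hQe : Q = ∑ i ∈ Finset.Icc d m,
      Polynomial.C (a i : ℤ) * (Polynomial.X ^ i * (1 - Polynomial.X) ^ (m - i)) :=
    hL.numerator_eq_Icc hLtop
  have hQL : (Q : PowerSeries ℤ) = (1 - PowerSeries.X) ^ n * hilbertSeries L := hL.coe_numerator
  have hQI : (Q : PowerSeries ℤ) = (1 - PowerSeries.X) ^ n * hilbertSeries I := by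
    rw [hQL]
    congr 1
    ext j
    rw [hilbertSeries, hilbertSeries, PowerSeries.coeff_mk, PowerSeries.coeff_mk, hHF]
  have hQJ : (Q : PowerSeries ℤ) = (1 - PowerSeries.X) ^ m * hilbertSeries (sigmaIdeal L) :=
    hL.coe_numerator_sigmaIdeal hLtop
  have hex : ∃ q, Q ∈ cone q := ⟨n, numerator_mem_cone L⟩
  obtain ⟨q, hqc, hqmin⟩ : ∃ q, Q ∈ cone q ∧ ∀ q' < q, Q ∉ cone q' :=
    ⟨Nat.find hex, Nat.find_spec hex, fun q' h => Nat.find_min hex h⟩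
  have hle : ∀ {r}, Q ∈ cone r → q ≤ r := fun {r} hr => not_lt.1 fun h => hqmin r h hr
  have hqn : q ≤ n := hle (numerator_mem_cone L)
  -- The expansion of `Q` with coefficients `a_i` only involves exponents `m - i ≤ m - d`.
  have hqd : q ≤ m - d := by
    refine hle ?_
    rw [hQe]
    refine sum_mem fun i hi => C_mul_mem_cone (mem_cone_of_le _ ?_) (by positivity)
    rw [Finset.mem_Icc] at hi
    omega
  have hJgr := (isMonomialIdeal_sigmaIdeal L).isGradedIdeal
  have hdI := hdepth_eq hI hbot hQI hqn hqc hqmin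
  have hdL := hdepth_eq hgr hLbot hQL hqn hqc hqmin
  have hdJ := hdepth_eq hJgr hJbot hQJ (by omega) hqc hqmin
  have htest : ∀ j q', d + j + q' = m → (SquarefreeTest (sigmaIdeal L) j ↔ Q ∈ cone q') :=
    fun j q' h => (numeratorTest_iff h had hQe).symm.trans (numeratorTest_iff_mem_cone h had hQe)
  refine ⟨?_, ?_, ?_, ?_, ?_, ?_, Q, hQI, natDegree_numerator_le hLtop, q, ?_, ?_, ?_, ?_⟩
  · rw [hdI]; exact isGreatest_hdepthSet hI hbot hQI hqn hqc hqmin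
  · rw [hdL]; exact isGreatest_hdepthSet hgr hLbot hQL hqn hqc hqmin
  · rw [hdJ]; exact isGreatest_hdepthSet hJgr hJbot hQJ (by omega) hqc hqmin
  · have hj : d + (m - d - q) + q = m := by omega
    -- The successful `j` is the one with `d + j + q = m`; a larger `j'` would put `Q` in the cone
    -- of a smaller exponent.
    refine ⟨m - d - q, le_min ?_ (by omega), (htest _ q hj).2 hqc, fun j' h1 h2 h3 => ?_, ?_⟩
    -- Non-negativity of `b_{d+1} = a_{d+1} - j a_d` shows that starting at `j₀` does not skip this
    -- `j`.
    · rw [Nat.le_div_iff_mul_le had]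
      rcases Nat.eq_zero_or_pos (m - d - q) with h0 | hpos
      · rw [h0, zero_mul]; exact Nat.zero_le _
      have h1 := (numeratorTest_iff hj had hQe).1 ((numeratorTest_iff_mem_cone hj had hQe).2 hqc)
        (d + 1) (Finset.mem_Icc.2 ⟨by omega, by omega⟩)
      rw [truncCoeff_succ a d _ hpos] at h1
      have h2 : ((m - d - q : ℕ) : ℤ) * (a d : ℤ) ≤ (a (d + 1) : ℤ) := by linarith
      exact_mod_cast h2
    · have h4 : j' ≤ m - d := h2.trans (min_le_right _ _)
      exact hqmin (m - d - j') (by omega) ((htest j' (m - d - j') (by omega)).1 h3)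
    · rw [hdJ]; omega
  · rw [hdI, hdL]
  · rw [hdI, hdJ]; omega
  · rw [natTrailingDegree_of_expansion hdm had hQe]; omega
  · exact (numeratorTest_iff_mem_cone (j := m - d - q) (by omega) had hQe).2 hqc
  · intro q' h1 h2
    exact hqmin q' h1
      ((numeratorTest_iff_mem_cone (j := m - d - q') (by omega) had hQe).1 h2)
  · rw [hdI]; push_cast [Nat.cast_sub hqn]; ring
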